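/- **Conventions.** A (pseudo) double category $\mathbb D$ has objects, arrows $x\to y$ (forming a category), proarrows $m:x\nrightarrow y$ and cells; a cell bounded by $m:x\nrightarrow y$, $n:x'\nrightarrow y'$, $f:x\to x'$, $g:y\to y'$ is written $m\Rightarrow n$ over $(f,g)$. External composition $m\odot n$ (in diagrammatic order) of proarrows is associative and unital up to coherent globular isomorphism. The underlying bicategory $\mathbf D$ consists of the objects, the proarrows and the globular cells. A *companion* of $f:x\to y$ is a proarrow $f_!:x\nrightarrow y$ with cells $\mathrm{id}_x\Rightarrow f_!$ over $(1,f)$ and $f_!\Rightarrow \mathrm{id}_y$ over $(f,1)$ whose two composites are the identity cells $\mathrm{id}_f$ and (modulo unitors) $1_{f_!}$; a *conjoint* of $f$ is a proarrow $f^*:y\nrightarrow x$ with the dual structure. If $f$ and $g$ have companions, *sliding* turns a cell $\alpha:m\Rightarrow n$ over $(f,g)$ into a globular cell $m\odot g_!\Rightarrow f_!\odot n$. **Finite products.** *Lax finite products* in $\mathbb D$ are a lax right adjoint $\Pi$ of the diagonal double functor from $\mathbb D$ to the double category of finite families in $\mathbb D$ (in which an arrow $(I,x)\to(J,y)$ is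 a function $\phi:J\to I$ with arrows $x_{\phi(j)}\to y_j$, and a proarrow $(I,x)\nrightarrow (J,y)$ is a span of finite sets $I\xleftarrow{l}A\xrightarrow{r}J$ with proarrows $m_a:x_{l(a)}\nrightarrow y_{r(a)}$). Explicitly, it is a choice of * a product $\Pi x$ with projections $\pi_i:\Pi x\to x_i$ for every finite family $x$ of objects, and * for every finite span-indexed family $m$ of proarrows, a proarrow $\Pi m:\Pi x\nrightarrow \Pi y$ with cells $\pi_a:\Pi m\Rightarrow m_a$ over $(\pi_{l(a)},\pi_{r(a)})$, such that for every proarrow $p:s\nrightarrow t$ and all arrows $f:s\to\Pi x$, $g:t\to\Pi y$, each family of cells $p\Rightarrow m_a$ over $(\pi_{l(a)}f,\pi_{r(a)}g)$ factors through the cells $\pi_a$ by a unique cell $p\Rightarrow\Pi m$ over $(f,g)$. They are *iso-strong* if parallel products (those indexed by identity spans) commute with external identities and external composition up to isomorphism: the canonical globular cells $\mathrm{id}_{\Pi x}\Rightarrow\Pi(\mathrm{id}_{x_i})_i$ and $\Pi m\odot\Pi n\Rightarrow\Pi(m_i\odot n_i)_i$ are invertible. As usual, products of one-member families are taken to be trivial,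 $\Pi\{x\}=x$; more generally, it is enough to assume that for each $x$ the canonical isomorphism $\Pi\{x\}\to x$ has a companion and a conjoint. **Cartesian bicategories.** A *map* in a bicategory is a 1-cell that has a right adjoint. An oplax transformation $\tau:F\Rightarrow G$ of pseudofunctors has components $\tau_x:Fx\to Gx$ and naturality 2-cells $Fm\odot\tau_y\Rightarrow\tau_x\odot Gm$. A *lax adjunction* $(\eta,\kappa,s,t):F\dashv G$ between pseudofunctors consists of oplax transformations $\eta:1\Rightarrow GF$ and $\kappa:FG\Rightarrow1$ and invertible modifications with components $s_x:1_{Fx}\Rightarrow F\eta_x\odot\kappa_{Fx}$ and $t_y:\eta_{Gy}\odot G\kappa_y\Rightarrow1_{Gy}$ that satisfy the two swallowtail identities: modulo the structure isomorphisms of the bicategories and of $F$ and $G$, the composites $$\eta_x\xrightarrow{\ \eta_x\odot t_{Fx}^{-1}\ }\eta_x\odot\eta_{GFx}\odot G\kappa_{Fx}\xrightarrow{\ \eta_{\eta_x}\odot G\kappa_{Fx}\ }\eta_x\odot GF\eta_x\odot G\kappa_{Fx}\xrightarrow{\ \eta_x\odot G s_x^{-1}\ }\eta_x,$$ $$\kappa_y\xrightarrow{\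 Ft_y^{-1}\odot\kappa_y\ }F\eta_{Gy}\odot FG\kappa_y\odot\kappa_y\xrightarrow{\ F\eta_{Gy}\odot\kappa_{\kappa_y}\ }F\eta_{Gy}\odot\kappa_{FGy}\odot\kappa_y\xrightarrow{\ s_{Gy}^{-1}\odot\kappa_y\ }\kappa_y$$ are identities for all objects $x$ and $y$. A *cartesian structure* (in Trimble's sense) on a bicategory $\mathbf B$ consists of pseudofunctors $\otimes:\mathbf B^2\to\mathbf B$ and $I:\mathbf 1\to\mathbf B$; oplax transformations $\delta:1_{\mathbf B}\Rightarrow\otimes\circ\Delta$, $\pi:\Delta\circ\otimes\Rightarrow1_{\mathbf B^2}$ and $\varepsilon:1_{\mathbf B}\Rightarrow I\circ{!}$ whose components are maps; and invertible modifications $s$, $t$, $u$ such that $(\delta,\pi,s,t):\Delta\dashv\otimes$ and $(\varepsilon,1,1,u):{!}\dashv I$ are lax adjunctions. **Theorem.** Let $\mathbb D$ be a double category with iso-strong finite products. Then its underlying bicategory $\mathbf D$ has a cartesian structure $(\otimes,I,\delta,\pi,\varepsilon,s,t,u)$ that is obtained from the products of $\mathbb D$ by taking companions: 1. $\otimes$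 sends pairs of objects to their products $x\times y$ in the category of objects and arrows, and pairs of proarrows to their products in the category of proarrows and cells; its action on 2-cells and its comparison isomorphisms are those compatible with the projections. Similarly, $I$ picks a terminal object $1$ and a terminal proarrow. 2. The components of $\delta$, $\pi$ and $\varepsilon$ are companions of the diagonals $x\to x\times x$, of the pairs of projections from $x\times y$ to $x$ and $y$, and of the arrows $x\to1$. Their naturality 2-cells at a proarrow are obtained by sliding the corresponding diagonal cell, projection cells and unique cell to the terminal proarrow. 3. The two components of the triangulator $s_x$ are the canonical isomorphisms $1_x\cong\delta_x\odot\pi^i_{x,x}$ ($i=1,2$) between companions of the identity arrow $1_x$. -/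

import Mathlib

open CategoryTheory CategoryTheory.Limits CategoryTheory.Bicategory
open scoped CategoryTheory.Oplax.OplaxTrans

universe z w v u z₁ w₁ u₁ z₂ w₂ u₂ z₃ w₃ u₃

/-! ## Double categories -/

set_option linter.checkUnivs false in
/-- A (pseudo) double category: objects and arrows form a category, and there are proarrows
`m : Pro x y` and cells

```
     x --m--> y
   f |        | g
     v        v
     x'--n--> y'
```

of type `Cell f g m n`. Composition of arrows and of cells in the arrow direction is strict;
external composition (`compPro`, `hcomp`) is associative and unital up to coherent globular
isomorphism. In `vcomp α β hf hg` the boundary arrows of the composite may be any arrows that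
*equal* the composites of the boundary arrows, so that no axiom needs a transport. -/
class DoubleCategory (D : Type u) extends Category.{v} D where
  Pro : D → D → Type w
  Cell : ∀ {x y x' y' : D}, (x ⟶ x') → (y ⟶ y') → Pro x y → Pro x' y' → Type z
  idPro : ∀ x : D, Pro x x
  compPro : ∀ {x y t : D}, Pro x y → Pro y t → Pro x t
  /-- identity cell of a proarrow -/
  vid : ∀ {x y : D} (m : Pro x y), Cell (𝟙 x) (𝟙 y) m m
  /-- composition of cells in the arrow direction -/
  vcomp : ∀ {x y x' y' x'' y'' : D} {f : x ⟶ x'} {g : y ⟶ y'} {f' : x' ⟶ x''} {g' : y' ⟶ y''}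
    {f'' : x ⟶ x''} {g'' : y ⟶ y''} {m : Pro x y} {n : Pro x' y'} {p : Pro x'' y''},
    Cell f g m n → Cell f' g' n p → f ≫ f' = f'' → g ≫ g' = g'' → Cell f'' g'' m p
  /-- external identity cell of an arrow -/
  hid : ∀ {x x' : D} (f : x ⟶ x'), Cell f f (idPro x) (idPro x')
  /-- external composition of cells -/
  hcomp : ∀ {x y t x' y' t' : D} {f : x ⟶ x'} {g : y ⟶ y'} {h : t ⟶ t'} {m : Pro x y}
    {n : Pro y t} {m' : Pro x' y'} {n' : Pro y' t'},
    Cell f g m m' → Cell g h n n' → Cell f h (compPro m n) (compPro m' n')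
  assocHom : ∀ {x y t s : D} (m : Pro x y) (n : Pro y t) (p : Pro t s),
    Cell (𝟙 x) (𝟙 s) (compPro (compPro m n) p) (compPro m (compPro n p))
  assocInv : ∀ {x y t s : D} (m : Pro x y) (n : Pro y t) (p : Pro t s),
    Cell (𝟙 x) (𝟙 s) (compPro m (compPro n p)) (compPro (compPro m n) p)
  leftHom : ∀ {x y : D} (m : Pro x y), Cell (𝟙 x) (𝟙 y) (compPro (idPro x) m) m
  leftInv : ∀ {x y : D} (m : Pro x y), Cell (𝟙 x) (𝟙 y) m (compPro (idPro x) m)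
  rightHom : ∀ {x y : D} (m : Pro x y), Cell (𝟙 x) (𝟙 y) (compPro m (idPro y)) m
  rightInv : ∀ {x y : D} (m : Pro x y), Cell (𝟙 x) (𝟙 y) m (compPro m (idPro y))
  vid_vcomp : ∀ {x y x' y' : D} {f : x ⟶ x'} {g : y ⟶ y'} {m : Pro x y} {n : Pro x' y'}
    (α : Cell f g m n) (hf : 𝟙 x ≫ f = f) (hg : 𝟙 y ≫ g = g), vcomp (vid m) α hf hg = α
  vcomp_vid : ∀ {x y x' y' : D} {f : x ⟶ x'} {g : y ⟶ y'} {m : Pro x y} {n : Pro x' y'}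
    (α : Cell f g m n) (hf : f ≫ 𝟙 x' = f) (hg : g ≫ 𝟙 y' = g), vcomp α (vid n) hf hg = α
  vcomp_assoc : ∀ {x₀ y₀ x₁ y₁ x₂ y₂ x₃ y₃ : D} {f₁ : x₀ ⟶ x₁} {g₁ : y₀ ⟶ y₁} {f₂ : x₁ ⟶ x₂}
    {g₂ : y₁ ⟶ y₂} {f₃ : x₂ ⟶ x₃} {g₃ : y₂ ⟶ y₃} {f₁₂ : x₀ ⟶ x₂} {g₁₂ : y₀ ⟶ y₂}
    {f₂₃ : x₁ ⟶ x₃} {g₂₃ : y₁ ⟶ y₃} {f : x₀ ⟶ x₃} {g : y₀ ⟶ y₃} {m₀ : Pro x₀ y₀}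
    {m₁ : Pro x₁ y₁} {m₂ : Pro x₂ y₂} {m₃ : Pro x₃ y₃} (α : Cell f₁ g₁ m₀ m₁)
    (β : Cell f₂ g₂ m₁ m₂) (γ : Cell f₃ g₃ m₂ m₃) (hf₁₂ : f₁ ≫ f₂ = f₁₂) (hg₁₂ : g₁ ≫ g₂ = g₁₂)
    (hf : f₁₂ ≫ f₃ = f) (hg : g₁₂ ≫ g₃ = g) (hf₂₃ : f₂ ≫ f₃ = f₂₃) (hg₂₃ : g₂ ≫ g₃ = g₂₃)
    (hf' : f₁ ≫ f₂₃ = f) (hg' : g₁ ≫ g₂₃ = g),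
    vcomp (vcomp α β hf₁₂ hg₁₂) γ hf hg = vcomp α (vcomp β γ hf₂₃ hg₂₃) hf' hg'
  /-- external identities are functorial -/
  hid_id : ∀ x : D, hid (𝟙 x) = vid (idPro x)
  hid_comp : ∀ {x y t : D} {f : x ⟶ y} {g : y ⟶ t} {k : x ⟶ t} (h : f ≫ g = k),
    hid k = vcomp (hid f) (hid g) h h
  /-- external composition is functorial -/
  hcomp_vid : ∀ {x y t : D} (m : Pro x y) (n : Pro y t),
    hcomp (vid m) (vid n) = vid (compPro m n)
  interchange : ∀ {x y t x' y' t' x'' y'' t'' : D} {f : x ⟶ x'} {g : y ⟶ y'} {h : t ⟶ t'}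
    {f' : x' ⟶ x''} {g' : y' ⟶ y''} {h' : t' ⟶ t''} {f'' : x ⟶ x''} {g'' : y ⟶ y''}
    {h'' : t ⟶ t''} {m : Pro x y} {n : Pro y t} {m' : Pro x' y'} {n' : Pro y' t'}
    {m'' : Pro x'' y''} {n'' : Pro y'' t''} (α : Cell f g m m') (β : Cell g h n n')
    (α' : Cell f' g' m' m'') (β' : Cell g' h' n' n'') (hf : f ≫ f' = f'') (hg : g ≫ g' = g'')
    (hh : h ≫ h' = h''),
    hcomp (vcomp α α' hf hg) (vcomp β β' hg hh) = vcomp (hcomp α β) (hcomp α' β') hf hh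
  /-- associators and unitors are invertible -/
  assoc_hom_inv : ∀ {x y t s : D} (m : Pro x y) (n : Pro y t) (p : Pro t s),
    vcomp (assocHom m n p) (assocInv m n p) (Category.id_comp _) (Category.id_comp _) = vid _
  assoc_inv_hom : ∀ {x y t s : D} (m : Pro x y) (n : Pro y t) (p : Pro t s),
    vcomp (assocInv m n p) (assocHom m n p) (Category.id_comp _) (Category.id_comp _) = vid _
  left_hom_inv : ∀ {x y : D} (m : Pro x y),
    vcomp (leftHom m) (leftInv m) (Category.id_comp _) (Category.id_comp _) = vid _
  left_inv_hom : ∀ {x y : D} (m : Pro x y),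
    vcomp (leftInv m) (leftHom m) (Category.id_comp _) (Category.id_comp _) = vid _
  right_hom_inv : ∀ {x y : D} (m : Pro x y),
    vcomp (rightHom m) (rightInv m) (Category.id_comp _) (Category.id_comp _) = vid _
  right_inv_hom : ∀ {x y : D} (m : Pro x y),
    vcomp (rightInv m) (rightHom m) (Category.id_comp _) (Category.id_comp _) = vid _
  /-- associators and unitors are natural with respect to all cells -/
  assoc_naturality : ∀ {x y t s x' y' t' s' : D} {f : x ⟶ x'} {g : y ⟶ y'} {h : t ⟶ t'}
    {k : s ⟶ s'} {m : Pro x y} {n : Pro y t} {p : Pro t s} {m' : Pro x' y'} {n' : Pro y' t'}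
    {p' : Pro t' s'} (α : Cell f g m m') (β : Cell g h n n') (γ : Cell h k p p'),
    vcomp (hcomp (hcomp α β) γ) (assocHom m' n' p') (Category.comp_id f) (Category.comp_id k) =
      vcomp (assocHom m n p) (hcomp α (hcomp β γ)) (Category.id_comp f) (Category.id_comp k)
  left_naturality : ∀ {x y x' y' : D} {f : x ⟶ x'} {g : y ⟶ y'} {m : Pro x y} {m' : Pro x' y'}
    (α : Cell f g m m'),
    vcomp (hcomp (hid f) α) (leftHom m') (Category.comp_id f) (Category.comp_id g) =
      vcomp (leftHom m) α (Category.id_comp f) (Category.id_comp g)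
  right_naturality : ∀ {x y x' y' : D} {f : x ⟶ x'} {g : y ⟶ y'} {m : Pro x y} {m' : Pro x' y'}
    (α : Cell f g m m'),
    vcomp (hcomp α (hid g)) (rightHom m') (Category.comp_id f) (Category.comp_id g) =
      vcomp (rightHom m) α (Category.id_comp f) (Category.id_comp g)
  /-- coherence -/
  pentagon : ∀ {x y t s r : D} (m : Pro x y) (n : Pro y t) (p : Pro t s) (q : Pro s r),
    vcomp (hcomp (assocHom m n p) (vid q))
      (vcomp (assocHom m (compPro n p) q) (hcomp (vid m) (assocHom n p q))
        (Category.id_comp _) (Category.id_comp _)) (Category.id_comp _) (Category.id_comp _) =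
    vcomp (assocHom (compPro m n) p q) (assocHom m n (compPro p q))
      (Category.id_comp _) (Category.id_comp _)
  triangle : ∀ {x y t : D} (m : Pro x y) (n : Pro y t),
    vcomp (assocHom m (idPro y) n) (hcomp (vid m) (leftHom n))
      (Category.id_comp _) (Category.id_comp _) = hcomp (rightHom m) (vid n)

namespace DoubleCategory

variable {D : Type u} [DoubleCategory.{z, w, v} D]

/-- Composition of globular cells. -/
def gcomp {x y : D} {m n p : Pro x y} (α : Cell (𝟙 x) (𝟙 y) m n) (β : Cell (𝟙 x) (𝟙 y) n p) :
    Cell (𝟙 x) (𝟙 y) m p :=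
  vcomp α β (Category.id_comp _) (Category.id_comp _)

/-- Invertibility of a globular cell. -/
def IsInvertible {x y : D} {m n : Pro x y} (α : Cell (𝟙 x) (𝟙 y) m n) : Prop :=
  ∃ β : Cell (𝟙 x) (𝟙 y) n m, gcomp α β = vid m ∧ gcomp β α = vid n

/-- `Companion f m`: the structure of a companion of the arrow `f` on the proarrow `m`. -/
structure Companion {x y : D} (f : x ⟶ y) (m : Pro x y) where
  unit : Cell (𝟙 x) f (idPro x) m
  counit : Cell f (𝟙 y) m (idPro y)
  /-- modulo the unit isomorphisms, the external composite `unit ⊙ counit` is `1_m` -/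
  external : gcomp (hcomp unit counit) (rightHom m) = leftHom m
  internal : vcomp unit counit (Category.id_comp f) (Category.comp_id f) = hid f

/-- `Conjoint f m`: the structure of a conjoint of the arrow `f` on the proarrow `m`. -/
structure Conjoint {x y : D} (f : x ⟶ y) (m : Pro y x) where
  unit : Cell f (𝟙 x) (idPro x) m
  counit : Cell (𝟙 y) f m (idPro y)
  /-- modulo the unit isomorphisms, the external composite `counit ⊙ unit` is `1_m` -/
  external : gcomp (hcomp counit unit) (leftHom m) = rightHom m
  internal : vcomp unit counit (Category.comp_id f) (Category.id_comp f) = hid f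

/-- The globular cell `m ⊙ g_! → f_! ⊙ n` obtained from a cell `α` by sliding its boundary
arrows `f` and `g` into companions. -/
def slide {x y x' y' : D} {f : x ⟶ x'} {g : y ⟶ y'} {f' : Pro x x'} {g' : Pro y y'}
    (cf : Companion f f') (cg : Companion g g') {m : Pro x y} {n : Pro x' y'}
    (α : Cell f g m n) : Cell (𝟙 x) (𝟙 y') (compPro m g') (compPro f' n) :=
  gcomp (hcomp (leftInv m) (vid g'))
    (gcomp (hcomp (hcomp cf.unit α) cg.counit) (rightHom (compPro f' n)))

/-- The unit cell of the composite of two companions. -/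
def compUnit {x y t : D} {f : x ⟶ y} {g : y ⟶ t} {k : x ⟶ t} {f' : Pro x y} {g' : Pro y t}
    (cf : Companion f f') (cg : Companion g g') (h : f ≫ g = k) :
    Cell (𝟙 x) k (idPro x) (compPro f' g') :=
  vcomp (vcomp (leftInv (idPro x)) (hcomp cf.unit (hid f))
      (Category.id_comp _) (Category.id_comp _))
    (hcomp (vid f') cg.unit) (Category.id_comp _) h

/-! ## Finite products in a double category -/

/-- A cone over a family of proarrows `m a : x (l a) ⇸ y (r a)`, indexed by a span of sets
`I ←l- A -r→ J`, that lies over given cones `cx` on the objects `x` and `cy` on the objects `y`. -/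
structure ProCone {I J A : Type} {x : I → D} {y : J → D} (cx : Fan x) (cy : Fan y)
    (l : A → I) (r : A → J) (m : ∀ a, Pro (x (l a)) (y (r a))) where
  pro : Pro cx.pt cy.pt
  proj : ∀ a, Cell (cx.proj (l a)) (cy.proj (r a)) pro (m a)

/-- The universal property of a product of a span-indexed family of proarrows. -/
def ProCone.IsProduct {I J A : Type} {x : I → D} {y : J → D} {cx : Fan x} {cy : Fan y}
    {l : A → I} {r : A → J} {m : ∀ a, Pro (x (l a)) (y (r a))} (c : ProCone cx cy l r m) : Prop :=
  ∀ ⦃s t : D⦄ (p : Pro s t) (f : s ⟶ cx.pt) (g : t ⟶ cy.pt)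
    (α : ∀ a, Cell (f ≫ cx.proj (l a)) (g ≫ cy.proj (r a)) p (m a)),
    ∃! β : Cell f g p c.pro, ∀ a, vcomp β (c.proj a) rfl rfl = α a

/-- Lax finite products in a double category. This is a choice of the data of a lax right adjoint
to the diagonal double functor `D → Fam D` into the double category of finite families, whose
objects are finite families of objects, whose arrows `(I, x) → (J, y)` are functions `J → I` with
a family of arrows over them, and whose proarrows are families of proarrows indexed by spans of
finite sets. The right adjoint is given by its values on objects and on proarrows and by the
universal counit components; its comparison cells are induced. -/
structure LaxFiniteProducts (D : Type u) [DoubleCategory.{z, w, v} D] where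
  fan : ∀ {I : Type} [Finite I] (x : I → D), Fan x
  isLimit : ∀ {I : Type} [Finite I] (x : I → D), IsLimit (fan x)
  cone : ∀ {I J A : Type} [Finite I] [Finite J] [Finite A] {x : I → D} {y : J → D}
    (l : A → I) (r : A → J) (m : ∀ a, Pro (x (l a)) (y (r a))), ProCone (fan x) (fan y) l r m
  isProduct : ∀ {I J A : Type} [Finite I] [Finite J] [Finite A] {x : I → D} {y : J → D}
    (l : A → I) (r : A → J) (m : ∀ a, Pro (x (l a)) (y (r a))), (cone l r m).IsProduct

namespace LaxFiniteProducts

variable (P : LaxFiniteProducts D)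

/-- The product of a parallel family of proarrows, indexed by an identity span. -/
abbrev parallel {I : Type} [Finite I] {x y : I → D} (m : ∀ i, Pro (x i) (y i)) :
    ProCone (P.fan x) (P.fan y) (fun i => i) (fun i => i) m :=
  P.cone (fun i => i) (fun i => i) m

/-- The iso-strong condition: parallel products commute with external identities and with
external composition up to isomorphism, i.e. the canonical comparison cells
`id (Π x) → Π (id x)` and `Π m ⊙ Π n → Π (m ⊙ n)`, the unique globular cells compatible with the
projections, are invertible. -/
structure IsIsoStrong : Prop where
  unit : ∀ {I : Type} [Finite I] (x : I → D)
    (κ : Cell (𝟙 _) (𝟙 _) (idPro (P.fan x).pt) (P.parallel fun i => idPro (x i)).pro),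
    (∀ i, vcomp κ ((P.parallel fun i => idPro (x i)).proj i)
      (Category.id_comp _) (Category.id_comp _) = hid ((P.fan x).proj i)) → IsInvertible κ
  comp : ∀ {I : Type} [Finite I] {x y t : I → D} (m : ∀ i, Pro (x i) (y i))
    (n : ∀ i, Pro (y i) (t i))
    (κ : Cell (𝟙 _) (𝟙 _) (compPro (P.parallel m).pro (P.parallel n).pro)
      (P.parallel fun i => compPro (m i) (n i)).pro),
    (∀ i, vcomp κ ((P.parallel fun i => compPro (m i) (n i)).proj i)
      (Category.id_comp _) (Category.id_comp _) =
        hcomp ((P.parallel m).proj i) ((P.parallel n).proj i)) → IsInvertible κ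

/-- For each object `x`, the canonical isomorphism from the chosen product of the one-member
family `x` to `x` has a companion and a conjoint. This is automatic if that product is chosen to
be `x` itself, with the identity as projection, and also if every isomorphism of `D` has a
companion. -/
def UnaryTransposable : Prop :=
  ∀ x : D, (∃ m, Nonempty (Companion ((P.fan fun _ : Unit => x).proj ()) m)) ∧
    ∃ m, Nonempty (Conjoint ((P.fan fun _ : Unit => x).proj ()) m)

end LaxFiniteProducts

end DoubleCategory

open DoubleCategory

/-! ## The underlying bicategory -/

/-- The underlying bicategory of a double category: objects, proarrows and globular cells. -/
structure UnderlyingBicategory (D : Type u) where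
  obj : D

namespace UnderlyingBicategory

variable {D : Type u} [DoubleCategory.{z, w, v} D]

instance : CategoryStruct (UnderlyingBicategory D) where
  Hom x y := Pro x.obj y.obj
  id x := idPro x.obj
  comp m n := compPro m n

instance homCategory (x y : UnderlyingBicategory D) : Category (x ⟶ y) where
  Hom m n := Cell (𝟙 x.obj) (𝟙 y.obj) m n
  id m := vid m
  comp α β := gcomp α β
  id_comp α := vid_vcomp α _ _
  comp_id α := vcomp_vid α _ _
  assoc α β γ := vcomp_assoc α β γ _ _ _ _ _ _ _ _

theorem hcomp_gcomp {x y t : D} {m m' m'' : Pro x y} {n n' n'' : Pro y t}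
    (α : Cell (𝟙 x) (𝟙 y) m m') (α' : Cell (𝟙 x) (𝟙 y) m' m'') (β : Cell (𝟙 y) (𝟙 t) n n')
    (β' : Cell (𝟙 y) (𝟙 t) n' n'') :
    hcomp (gcomp α α') (gcomp β β') = gcomp (hcomp α β) (hcomp α' β') :=
  interchange _ _ _ _ _ _ _

theorem gcomp_assoc {x y : D} {m n p q : Pro x y} (α : Cell (𝟙 x) (𝟙 y) m n)
    (β : Cell (𝟙 x) (𝟙 y) n p) (γ : Cell (𝟙 x) (𝟙 y) p q) :
    gcomp (gcomp α β) γ = gcomp α (gcomp β γ) :=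
  vcomp_assoc α β γ _ _ _ _ _ _ _ _

theorem vid_gcomp {x y : D} {m n : Pro x y} (α : Cell (𝟙 x) (𝟙 y) m n) :
    gcomp (vid m) α = α := vid_vcomp α _ _

theorem gcomp_vid {x y : D} {m n : Pro x y} (α : Cell (𝟙 x) (𝟙 y) m n) :
    gcomp α (vid n) = α := vcomp_vid α _ _

theorem conj_eq {x y : D} {m m' n n' : Pro x y} {a : Cell (𝟙 x) (𝟙 y) m n}
    {α : Cell (𝟙 x) (𝟙 y) m m'} {β : Cell (𝟙 x) (𝟙 y) n n'} {b : Cell (𝟙 x) (𝟙 y) m' n'}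
    {b' : Cell (𝟙 x) (𝟙 y) n' m'} (h : gcomp α b = gcomp a β) (hb : gcomp b b' = vid m') :
    α = gcomp a (gcomp β b') := by
  rw [← gcomp_assoc, ← h, gcomp_assoc, hb, gcomp_vid]

theorem conj_eq' {x y : D} {m m' n n' : Pro x y} {a : Cell (𝟙 x) (𝟙 y) m n}
    {α : Cell (𝟙 x) (𝟙 y) m m'} {β : Cell (𝟙 x) (𝟙 y) n n'} {b : Cell (𝟙 x) (𝟙 y) m' n'}
    {a' : Cell (𝟙 x) (𝟙 y) n m} (h : gcomp α b = gcomp a β) (ha : gcomp a' a = vid n) :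
    β = gcomp a' (gcomp α b) := by
  rw [h, ← gcomp_assoc, ha, vid_gcomp]

instance bicategory : Bicategory (UnderlyingBicategory D) where
  homCategory := homCategory
  whiskerLeft m _ _ β := hcomp (vid m) β
  whiskerRight α n := hcomp α (vid n)
  associator m n p :=
    { hom := assocHom m n p
      inv := assocInv m n p
      hom_inv_id := assoc_hom_inv m n p
      inv_hom_id := assoc_inv_hom m n p }
  leftUnitor m :=
    { hom := leftHom m
      inv := leftInv m
      hom_inv_id := left_hom_inv m
      inv_hom_id := left_inv_hom m }
  rightUnitor m :=
    { hom := rightHom m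
      inv := rightInv m
      hom_inv_id := right_hom_inv m
      inv_hom_id := right_inv_hom m }
  whiskerLeft_id m n := hcomp_vid m n
  whiskerLeft_comp m _ _ _ β γ := by
    have h := hcomp_gcomp (vid m) (vid m) β γ
    rw [vid_gcomp] at h
    exact h
  id_whiskerLeft β := by
    have h := left_naturality β
    rw [hid_id] at h
    exact conj_eq h (left_hom_inv _)
  comp_whiskerLeft m n _ _ β := by
    have h := assoc_naturality (vid m) (vid n) β
    rw [hcomp_vid] at h
    exact conj_eq h (assoc_hom_inv _ _ _)
  id_whiskerRight m n := hcomp_vid m n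
  comp_whiskerRight α β n := by
    have h := hcomp_gcomp α β (vid n) (vid n)
    rw [vid_gcomp] at h
    exact h
  whiskerRight_id α := by
    have h := right_naturality α
    rw [hid_id] at h
    exact conj_eq h (right_hom_inv _)
  whiskerRight_comp {_ _ _ _ m m'} α n p := by
    have h := assoc_naturality α (vid n) (vid p)
    rw [hcomp_vid] at h
    exact conj_eq' h (assoc_inv_hom m n p)
  whisker_assoc m _ _ β p := conj_eq (assoc_naturality (vid m) β (vid p)) (assoc_hom_inv _ _ _)
  whisker_exchange {_ _ _ m m' n n'} α β := by
    have h := hcomp_gcomp (vid m) α β (vid n')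
    have h' := hcomp_gcomp α (vid m') (vid n) β
    rw [vid_gcomp, gcomp_vid] at h h'
    exact h.symm.trans h'
  pentagon m n p q := DoubleCategory.pentagon m n p q
  triangle m n := DoubleCategory.triangle m n

end UnderlyingBicategory

/-! ## Lax adjunctions and cartesian structures on bicategories -/

section Bicategorical

variable {B : Type u₁} [Bicategory.{z₁, w₁} B] {C : Type u₂} [Bicategory.{z₂, w₂} C]
  {E : Type u₃} [Bicategory.{z₃, w₃} E]

/-- The diagonal pseudofunctor `B → B × B`. -/
@[simps]
def diagonal (B : Type u₁) [Bicategory.{z₁, w₁} B] : B ⥤ᵖ B × B where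
  obj x := (x, x)
  map f := (f, f)
  map₂ α := (α, α)
  mapId _ := Iso.refl _
  mapComp _ _ := Iso.refl _
  map₂_whisker_left f _ _ η := Prod.ext (by simp) (by simp)
  map₂_whisker_right η h := Prod.ext (by simp) (by simp)
  map₂_associator f g h := Prod.ext (by simp) (by simp)
  map₂_left_unitor f := Prod.ext (by simp) (by simp)
  map₂_right_unitor f := Prod.ext (by simp) (by simp)

/-- The terminal bicategory. -/
abbrev TerminalBicategory : Type := LocallyDiscrete (Discrete PUnit.{1})

/-- The unique pseudofunctor to the terminal bicategory. -/
def toTerminal (B : Type u₁) [Bicategory.{z₁, w₁} B] : B ⥤ᵖ TerminalBicategory where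
  obj _ := ⟨⟨PUnit.unit⟩⟩
  map _ := 𝟙 _
  map₂ _ := 𝟙 _
  mapId _ := Iso.refl _
  mapComp _ _ := (λ_ _).symm

theorem whisker_aux {x x' y y' : E} {g g' g'' : x ⟶ x'} {h h' h'' : y ⟶ y'} {t : x ⟶ y}
    {t' : x' ⟶ y'} {n : g ≫ t' ⟶ t ≫ h} {n' : g' ≫ t' ⟶ t ≫ h'} {a : g ⟶ g'} {a' : g' ⟶ g''}
    {b : h ⟶ h'} {b' : h' ⟶ h''} {k : g'' ≫ t' ⟶ t ≫ h''} (h₁ : a ▷ t' ≫ n' = n ≫ t ◁ b)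
    (h₂ : n' ≫ t ◁ b' = a' ▷ t' ≫ k) : n ≫ t ◁ (b ≫ b') = (a ≫ a') ▷ t' ≫ k := by
  rw [Bicategory.whiskerLeft_comp, ← Category.assoc, ← h₁, Category.assoc, h₂,
    comp_whiskerRight, Category.assoc]

/-- The image of a square `n` under a pseudofunctor. -/
def mapSquare (H : C ⥤ᵖ E) {x x' y y' : C} {f : x ⟶ x'} {g : y ⟶ y'} {t : x ⟶ y} {t' : x' ⟶ y'}
    (n : f ≫ t' ⟶ t ≫ g) : H.map f ≫ H.map t' ⟶ H.map t ≫ H.map g :=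
  (H.mapComp _ _).inv ≫ H.map₂ n ≫ (H.mapComp _ _).hom

theorem mapSquare_naturality (H : C ⥤ᵖ E) {x x' y y' : C} {f f' : x ⟶ x'} {g g' : y ⟶ y'}
    {t : x ⟶ y} {t' : x' ⟶ y'} {n : f ≫ t' ⟶ t ≫ g} {n' : f' ≫ t' ⟶ t ≫ g'} {a : f ⟶ f'}
    {b : g ⟶ g'} (h : a ▷ t' ≫ n' = n ≫ t ◁ b) :
    H.map₂ a ▷ H.map t' ≫ mapSquare H n' = mapSquare H n ≫ H.map t ◁ H.map₂ b := by
  have h := congrArg (fun t => H.map₂ t) h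
  simp only [PrelaxFunctor.map₂_comp, Pseudofunctor.map₂_whisker_left,
    Pseudofunctor.map₂_whisker_right, Category.assoc] at h
  rw [← cancel_epi (H.mapComp f t').hom, ← cancel_mono (H.mapComp t g').inv]
  simpa [mapSquare] using h

theorem mapSquare_id (H : C ⥤ᵖ E) {x y : C} {f : x ⟶ x} {g : y ⟶ y}
    {t : x ⟶ y} {n : f ≫ t ⟶ t ≫ g} {a : f ⟶ 𝟙 x} {b : g ⟶ 𝟙 y}
    (h : n ≫ t ◁ b = a ▷ t ≫ (λ_ t).hom ≫ (ρ_ t).inv) :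
    mapSquare H n ≫ H.map t ◁ (H.map₂ b ≫ (H.mapId y).hom) =
      (H.map₂ a ≫ (H.mapId x).hom) ▷ H.map t ≫ (λ_ (H.map t)).hom ≫ (ρ_ (H.map t)).inv := by
  have h := congrArg (fun t => H.map₂ t) h
  simp only [PrelaxFunctor.map₂_comp, Pseudofunctor.map₂_whisker_left,
    Pseudofunctor.map₂_whisker_right, Category.assoc] at h
  rw [← cancel_epi (H.mapComp f t).hom]
  simp [mapSquare] at h ⊢
  have e : H.map₂ (ρ_ t).inv ≫ (H.mapComp t (𝟙 y)).hom ≫ H.map t ◁ (H.mapId y).hom =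
      (ρ_ (H.map t)).inv := by
    rw [← cancel_epi (H.map₂ (ρ_ t).hom), PrelaxFunctor.map₂_hom_inv_assoc]
    simp
  have h := h =≫ ((H.mapComp t (𝟙 y)).hom ≫ H.map t ◁ (H.mapId y).hom)
  simp only [Category.assoc, e, Iso.inv_hom_id_assoc] at h
  exact h

theorem mapSquare_comp (H : C ⥤ᵖ E) {x x' x'' y y' y'' : C} {f : x ⟶ x'} {f' : x' ⟶ x''}
    {f'' : x ⟶ x''} {g : y ⟶ y'} {g' : y' ⟶ y''} {g'' : y ⟶ y''} {t : x ⟶ y} {t' : x' ⟶ y'}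
    {t'' : x'' ⟶ y''} {n : f ≫ t' ⟶ t ≫ g} {n' : f' ≫ t'' ⟶ t' ≫ g'} {n'' : f'' ≫ t'' ⟶ t ≫ g''}
    {a : f'' ⟶ f ≫ f'} {b : g'' ⟶ g ≫ g'}
    (h : n'' ≫ t ◁ b = a ▷ t'' ≫ (α_ _ _ _).hom ≫ f ◁ n' ≫ (α_ _ _ _).inv ≫ n ▷ g' ≫
      (α_ _ _ _).hom) :
    mapSquare H n'' ≫ H.map t ◁ (H.map₂ b ≫ (H.mapComp g g').hom) =
      (H.map₂ a ≫ (H.mapComp f f').hom) ▷ H.map t'' ≫ (α_ _ _ _).hom ≫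
        H.map f ◁ mapSquare H n' ≫ (α_ _ _ _).inv ≫ mapSquare H n ▷ H.map g' ≫
          (α_ _ _ _).hom := by
  have h := congrArg (fun t => H.map₂ t) h
  simp only [PrelaxFunctor.map₂_comp, Pseudofunctor.map₂_whisker_left,
    Pseudofunctor.map₂_whisker_right, Category.assoc] at h
  rw [← cancel_epi (H.mapComp f'' t'').hom]
  simp [mapSquare] at h ⊢
  have e : (H.mapComp f (t' ≫ g')).inv ≫ H.map₂ (α_ f t' g').inv ≫ (H.mapComp (f ≫ t') g').hom =
      H.map f ◁ (H.mapComp t' g').hom ≫ (α_ (H.map f) (H.map t') (H.map g')).inv ≫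
        (H.mapComp f t').inv ▷ H.map g' := by
    rw [Iso.inv_comp_eq]
    have := H.mapComp_assoc_right_hom f t' g'
    rw [reassoc_of% this]
    simp
  have h := h =≫ ((H.mapComp t (g ≫ g')).hom ≫ H.map t ◁ (H.mapComp g g').hom)
  simp only [Category.assoc, Iso.inv_hom_id_assoc, reassoc_of% e] at h
  rw [h]
  simp

/-- The pre-whiskering `τ * F` of an oplax transformation. -/
def preWhisker (F : B ⥤ᵖ C) {G H : C ⥤ᵖ E} (τ : Oplax.OplaxTrans G.toOplax H.toOplax) :
    Oplax.OplaxTrans (F.comp G).toOplax (F.comp H).toOplax where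
  app x := τ.app (F.obj x)
  naturality f := τ.naturality (F.map f)
  naturality_naturality η := τ.naturality_naturality (F.map₂ η)
  naturality_id x :=
    whisker_aux (τ.naturality_naturality (F.mapId x).hom) (τ.naturality_id (F.obj x))
  naturality_comp f g :=
    whisker_aux (τ.naturality_naturality (F.mapComp f g).hom)
      (τ.naturality_comp (F.map f) (F.map g))

/-- The post-whiskering `H * τ` of an oplax transformation. -/
def postWhisker {F G : B ⥤ᵖ C} (τ : Oplax.OplaxTrans F.toOplax G.toOplax) (H : C ⥤ᵖ E) :
    Oplax.OplaxTrans (F.comp H).toOplax (G.comp H).toOplax where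
  app x := H.map (τ.app x)
  naturality f := mapSquare H (τ.naturality f)
  naturality_naturality η := mapSquare_naturality H (τ.naturality_naturality η)
  naturality_id x := mapSquare_id H (τ.naturality_id x)
  naturality_comp f g := mapSquare_comp H (τ.naturality_comp f g)

theorem map₂_comp_aux (H : C ⥤ᵖ E) {x y : C} {f g h : x ⟶ y} {k : H.obj x ⟶ H.obj y} (a : f ⟶ g)
    (b : g ⟶ h) (c : H.map h ⟶ k) : H.map₂ (a ≫ b) ≫ c = H.map₂ a ≫ H.map₂ b ≫ c := by
  simp

theorem map₂_id_aux (H : C ⥤ᵖ E) {x y : C} {f : x ⟶ y} {k : H.obj x ⟶ H.obj y}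
    (c : H.map f ⟶ k) : H.map₂ (𝟙 f) ≫ c = c := by
  simp

theorem adjust_aux {x y x' y' : C} {f f' : x ⟶ y} {g g' : x' ⟶ y'} {t : x ⟶ x'} {t' : y ⟶ y'}
    {n : f ≫ t' ⟶ t ≫ g} {b b₀ : g ⟶ g'} {a a₀ : f ⟶ f'} {r : f' ≫ t' ⟶ t ≫ g'}
    (e : n ≫ t ◁ b₀ = a₀ ▷ t' ≫ r) (hb : b₀ = b) (ha : a₀ = a) : n ≫ t ◁ b = a ▷ t' ≫ r := by
  rw [← hb, ← ha, e]

/-! Composition of pseudofunctors is associative and unital up to equality. The following four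
definitions only use this to adjust the source and the target of a whiskered transformation. -/

/-- `F * η : F → F ∘ G ∘ F`. -/
def unitLeft {F : B ⥤ᵖ C} {G : C ⥤ᵖ B}
    (η : Oplax.OplaxTrans (Pseudofunctor.id B).toOplax (F.comp G).toOplax) :
    Oplax.OplaxTrans F.toOplax (F.comp (G.comp F)).toOplax where
  app := (postWhisker η F).app
  naturality := (postWhisker η F).naturality
  naturality_naturality := (postWhisker η F).naturality_naturality
  naturality_id x :=
    adjust_aux ((postWhisker η F).naturality_id x) (map₂_comp_aux F _ _ _) (map₂_id_aux F _)
  naturality_comp f g :=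
    adjust_aux ((postWhisker η F).naturality_comp f g) (map₂_comp_aux F _ _ _) (map₂_id_aux F _)

/-- `κ * F : F ∘ G ∘ F → F`. -/
def counitLeft {F : B ⥤ᵖ C} {G : C ⥤ᵖ B}
    (κ : Oplax.OplaxTrans (G.comp F).toOplax (Pseudofunctor.id C).toOplax) :
    Oplax.OplaxTrans (F.comp (G.comp F)).toOplax F.toOplax where
  app := (preWhisker F κ).app
  naturality := (preWhisker F κ).naturality
  naturality_naturality := (preWhisker F κ).naturality_naturality
  naturality_id x :=
    adjust_aux ((preWhisker F κ).naturality_id x) (Category.comp_id _) rfl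
  naturality_comp f g :=
    adjust_aux ((preWhisker F κ).naturality_comp f g) (Category.comp_id _) rfl

/-- `η * G : G → G ∘ F ∘ G`. -/
def unitRight {F : B ⥤ᵖ C} {G : C ⥤ᵖ B}
    (η : Oplax.OplaxTrans (Pseudofunctor.id B).toOplax (F.comp G).toOplax) :
    Oplax.OplaxTrans G.toOplax (G.comp (F.comp G)).toOplax where
  app := (preWhisker G η).app
  naturality := (preWhisker G η).naturality
  naturality_naturality := (preWhisker G η).naturality_naturality
  naturality_id x :=
    adjust_aux ((preWhisker G η).naturality_id x) rfl (Category.comp_id _)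
  naturality_comp f g :=
    adjust_aux ((preWhisker G η).naturality_comp f g) rfl (Category.comp_id _)

/-- `G * κ : G ∘ F ∘ G → G`. -/
def counitRight {F : B ⥤ᵖ C} {G : C ⥤ᵖ B}
    (κ : Oplax.OplaxTrans (G.comp F).toOplax (Pseudofunctor.id C).toOplax) :
    Oplax.OplaxTrans (G.comp (F.comp G)).toOplax G.toOplax where
  app := (postWhisker κ G).app
  naturality := (postWhisker κ G).naturality
  naturality_naturality := (postWhisker κ G).naturality_naturality
  naturality_id x :=
    adjust_aux ((postWhisker κ G).naturality_id x) (map₂_id_aux G _) (map₂_comp_aux G _ _ _)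
  naturality_comp f g :=
    adjust_aux ((postWhisker κ G).naturality_comp f g) (map₂_id_aux G _) (map₂_comp_aux G _ _ _)

/-- The composite `(F * η) ; (κ * F)`, with components `F η_x ⊙ κ_{F x}`. -/
def leftTriangle {F : B ⥤ᵖ C} {G : C ⥤ᵖ B}
    (η : Oplax.OplaxTrans (Pseudofunctor.id B).toOplax (F.comp G).toOplax)
    (κ : Oplax.OplaxTrans (G.comp F).toOplax (Pseudofunctor.id C).toOplax) :
    F.toOplax ⟶ F.toOplax :=
  Oplax.OplaxTrans.vcomp (unitLeft η) (counitLeft κ)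

/-- The composite `(η * G) ; (G * κ)`, with components `η_{G y} ⊙ G κ_y`. -/
def rightTriangle {F : B ⥤ᵖ C} {G : C ⥤ᵖ B}
    (η : Oplax.OplaxTrans (Pseudofunctor.id B).toOplax (F.comp G).toOplax)
    (κ : Oplax.OplaxTrans (G.comp F).toOplax (Pseudofunctor.id C).toOplax) :
    G.toOplax ⟶ G.toOplax :=
  Oplax.OplaxTrans.vcomp (unitRight η) (counitRight κ)

/-- Lax adjunctions `F ⊣ G` between pseudofunctors, comprising oplax transformations (unit and
counit) and invertible modifications (the triangulators `s` and `t`) that satisfy the two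
swallowtail identities. -/
structure LaxAdjunction (F : B ⥤ᵖ C) (G : C ⥤ᵖ B) where
  unit : Oplax.OplaxTrans (Pseudofunctor.id B).toOplax (F.comp G).toOplax
  counit : Oplax.OplaxTrans (G.comp F).toOplax (Pseudofunctor.id C).toOplax
  s : 𝟙 F.toOplax ≅ leftTriangle unit counit
  t : rightTriangle unit counit ≅ 𝟙 G.toOplax
  /-- As `x ↦ unit.app x` is oplax, its naturality cell at `η := unit.app x` goes from
  `η ≫ η_{GFx}` to `η ≫ GF(η)`, so that it is composed with the inverses of `s` and `t`. -/
  swallowtail_unit : ∀ x : B,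
    (ρ_ (unit.app x)).inv ≫
      unit.app x ◁ (show 𝟙 (G.obj (F.obj x)) ⟶
        unit.app (G.obj (F.obj x)) ≫ G.map (counit.app (F.obj x)) from t.inv.as.app (F.obj x)) ≫
      (α_ _ _ _).inv ≫
      (show unit.app x ≫ unit.app (G.obj (F.obj x)) ⟶ unit.app x ≫ G.map (F.map (unit.app x))
        from unit.naturality (unit.app x)) ▷ G.map (counit.app (F.obj x)) ≫
      (α_ _ _ _).hom ≫
      unit.app x ◁ ((G.mapComp (F.map (unit.app x)) (counit.app (F.obj x))).inv ≫
        G.map₂ (show F.map (unit.app x) ≫ counit.app (F.obj x) ⟶ 𝟙 (F.obj x)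
          from s.inv.as.app x) ≫ (G.mapId (F.obj x)).hom) ≫
      (ρ_ (unit.app x)).hom = 𝟙 (unit.app x)
  swallowtail_counit : ∀ y : C,
    (λ_ (counit.app y)).inv ≫
      ((F.mapId (G.obj y)).inv ≫
        F.map₂ (show 𝟙 (G.obj y) ⟶ unit.app (G.obj y) ≫ G.map (counit.app y)
          from t.inv.as.app y) ≫
        (F.mapComp (unit.app (G.obj y)) (G.map (counit.app y))).hom) ▷ counit.app y ≫
      (α_ _ _ _).hom ≫
      F.map (unit.app (G.obj y)) ◁
        (show F.map (G.map (counit.app y)) ≫ counit.app y ⟶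
          counit.app (F.obj (G.obj y)) ≫ counit.app y from counit.naturality (counit.app y)) ≫
      (α_ _ _ _).inv ≫
      (show F.map (unit.app (G.obj y)) ≫ counit.app (F.obj (G.obj y)) ⟶ 𝟙 (F.obj (G.obj y))
        from s.inv.as.app (G.obj y)) ▷ counit.app y ≫
      (λ_ (counit.app y)).hom = 𝟙 (counit.app y)

/-- A cartesian structure on a bicategory, in the sense of Trimble. A *map* is a 1-cell that has
a right adjoint. The oplax transformations are `δ = adjTensor.unit`, `π = adjTensor.counit` and
`ε = adjUnit.unit`. All 1-cells and 2-cells of the terminal bicategory being identities, the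
counit and the triangulator `s` of `adjUnit` are identities. -/
structure CartesianStructure (B : Type u₁) [Bicategory.{z₁, w₁} B] where
  tensor : B × B ⥤ᵖ B
  unit : TerminalBicategory ⥤ᵖ B
  adjTensor : LaxAdjunction (diagonal B) tensor
  adjUnit : LaxAdjunction (toTerminal B) unit
  isMap_diag : ∀ x : B, IsLeftAdjoint (adjTensor.unit.app x)
  isMap_proj : ∀ p : B × B, IsLeftAdjoint (adjTensor.counit.app p)
  isMap_aug : ∀ x : B, IsLeftAdjoint (adjUnit.unit.app x)

end Bicategorical

/-! ## Cartesian structures obtained from double products -/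

section Transposition

variable {D : Type u} [DoubleCategory.{z, w, v} D]

/-- A pseudofunctor `T` that underlies a right adjoint to the diagonal double functor
`D → D × D`: `T` sends pairs of objects to binary products and pairs of proarrows to binary
products in the category of proarrows and cells, and its action on 2-cells and its comparison
cells are the ones that are compatible with the projections. -/
structure BinaryDoubleProduct
    (T : UnderlyingBicategory D × UnderlyingBicategory D ⥤ᵖ UnderlyingBicategory D) where
  fst : ∀ p : UnderlyingBicategory D × UnderlyingBicategory D, (T.obj p).obj ⟶ p.1.obj
  snd : ∀ p : UnderlyingBicategory D × UnderlyingBicategory D, (T.obj p).obj ⟶ p.2.obj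
  isLimit : ∀ p, IsLimit (BinaryFan.mk (fst p) (snd p))
  fstCell : ∀ {p q : UnderlyingBicategory D × UnderlyingBicategory D} (m : p ⟶ q),
    Cell (fst p) (fst q) (T.map m) m.1
  sndCell : ∀ {p q : UnderlyingBicategory D × UnderlyingBicategory D} (m : p ⟶ q),
    Cell (snd p) (snd q) (T.map m) m.2
  existsUnique : ∀ {p q : UnderlyingBicategory D × UnderlyingBicategory D} (m : p ⟶ q) {s t : D}
    (n : Pro s t) (f : s ⟶ (T.obj p).obj) (g : t ⟶ (T.obj q).obj)
    (α : Cell (f ≫ fst p) (g ≫ fst q) n m.1) (β : Cell (f ≫ snd p) (g ≫ snd q) n m.2),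
    ∃! γ : Cell f g n (T.map m),
      vcomp γ (fstCell m) rfl rfl = α ∧ vcomp γ (sndCell m) rfl rfl = β
  map₂_fst : ∀ {p q : UnderlyingBicategory D × UnderlyingBicategory D} {m n : p ⟶ q} (α : m ⟶ n),
    vcomp (T.map₂ α) (fstCell n) (Category.id_comp _) (Category.id_comp _) =
      vcomp (fstCell m) α.1 (Category.comp_id _) (Category.comp_id _)
  map₂_snd : ∀ {p q : UnderlyingBicategory D × UnderlyingBicategory D} {m n : p ⟶ q} (α : m ⟶ n),
    vcomp (T.map₂ α) (sndCell n) (Category.id_comp _) (Category.id_comp _) =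
      vcomp (sndCell m) α.2 (Category.comp_id _) (Category.comp_id _)
  mapId_fst : ∀ p, vcomp (T.mapId p).inv (fstCell (𝟙 p)) (Category.id_comp _) (Category.id_comp _) =
    hid (fst p)
  mapId_snd : ∀ p, vcomp (T.mapId p).inv (sndCell (𝟙 p)) (Category.id_comp _) (Category.id_comp _) =
    hid (snd p)
  mapComp_fst : ∀ {p q r : UnderlyingBicategory D × UnderlyingBicategory D} (m : p ⟶ q)
    (n : q ⟶ r), vcomp (T.mapComp m n).inv (fstCell (m ≫ n)) (Category.id_comp _)
      (Category.id_comp _) = hcomp (fstCell m) (fstCell n)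
  mapComp_snd : ∀ {p q r : UnderlyingBicategory D × UnderlyingBicategory D} (m : p ⟶ q)
    (n : q ⟶ r), vcomp (T.mapComp m n).inv (sndCell (m ≫ n)) (Category.id_comp _)
      (Category.id_comp _) = hcomp (sndCell m) (sndCell n)

/-- A pseudofunctor `U` that underlies a right adjoint to the double functor from `D` to the
terminal double category: it picks a terminal object and a terminal proarrow. -/
structure NullaryDoubleProduct (U : TerminalBicategory ⥤ᵖ UnderlyingBicategory D) where
  isTerminal : ∀ a, IsTerminal (U.obj a).obj
  uniqueCell : ∀ {a b} (m : a ⟶ b) {s t : D} (n : Pro s t) (f : s ⟶ (U.obj a).obj)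
    (g : t ⟶ (U.obj b).obj), Unique (Cell f g n (U.map m))

/-- The cartesian structure `S` is obtained from double products by taking companions: `⊗` and `I`
underlie right adjoints to `D → D × D` and to `D → 1`; the components of `δ`, `π` and `ε` are
companions of the diagonals, the projections and the arrows to the terminal object; their
naturality cells are obtained from the cells of the double adjunctions by sliding the boundary
arrows into companions; and `s` is the canonical isomorphism between companions of `1`. The
swallowtail identities then determine the other triangulators. -/
structure TransposedFromProducts (S : CartesianStructure (UnderlyingBicategory D)) where
  prod : BinaryDoubleProduct S.tensor
  term : NullaryDoubleProduct S.unit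
  diag : ∀ x : UnderlyingBicategory D, x.obj ⟶ (S.tensor.obj (x, x)).obj
  diag_fst : ∀ x, diag x ≫ prod.fst (x, x) = 𝟙 x.obj
  diag_snd : ∀ x, diag x ≫ prod.snd (x, x) = 𝟙 x.obj
  diagCell : ∀ {x y : UnderlyingBicategory D} (m : x ⟶ y),
    Cell (diag x) (diag y) m (S.tensor.map (Prod.mkHom m m))
  diagCell_fst : ∀ {x y : UnderlyingBicategory D} (m : x ⟶ y),
    vcomp (diagCell m) (prod.fstCell (Prod.mkHom m m)) (diag_fst x) (diag_fst y) = vid m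
  diagCell_snd : ∀ {x y : UnderlyingBicategory D} (m : x ⟶ y),
    vcomp (diagCell m) (prod.sndCell (Prod.mkHom m m)) (diag_snd x) (diag_snd y) = vid m
  diagCompanion : ∀ x, Companion (diag x) (S.adjTensor.unit.app x)
  diag_naturality : ∀ {x y : UnderlyingBicategory D} (m : x ⟶ y),
    S.adjTensor.unit.naturality m = slide (diagCompanion x) (diagCompanion y) (diagCell m)
  fstCompanion : ∀ p, Companion (prod.fst p) (S.adjTensor.counit.app p).1
  sndCompanion : ∀ p, Companion (prod.snd p) (S.adjTensor.counit.app p).2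
  fst_naturality : ∀ {p q : UnderlyingBicategory D × UnderlyingBicategory D} (m : p ⟶ q),
    (S.adjTensor.counit.naturality m).1 =
      slide (fstCompanion p) (fstCompanion q) (prod.fstCell m)
  snd_naturality : ∀ {p q : UnderlyingBicategory D × UnderlyingBicategory D} (m : p ⟶ q),
    (S.adjTensor.counit.naturality m).2 =
      slide (sndCompanion p) (sndCompanion q) (prod.sndCell m)
  augCompanion : ∀ x : UnderlyingBicategory D,
    Companion ((term.isTerminal _).from x.obj) (S.adjUnit.unit.app x)
  aug_naturality : ∀ {x y : UnderlyingBicategory D} (m : x ⟶ y),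
    S.adjUnit.unit.naturality m =
      slide (augCompanion x) (augCompanion y) (term.uniqueCell (𝟙 _) m _ _).default
  s_fst : ∀ x, (S.adjTensor.s.hom.as.app x).1 =
    compUnit (diagCompanion x) (fstCompanion (x, x)) (diag_fst x)
  s_snd : ∀ x, (S.adjTensor.s.hom.as.app x).2 =
    compUnit (diagCompanion x) (sndCompanion (x, x)) (diag_snd x)

end Transposition

/-!
# Cartesian bicategories from double categories with iso-strong finite products

All equations between cells are proved in the category `Proarrow D`, whose objects are the
proarrows of `D` and whose morphisms are its cells; the morphism given by a cell `α` is `sq α`,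
and `gsq α` if `α` is a 2-cell of the underlying bicategory.

**Sliding through units.** A cell out of `m ⊙ g_!` is determined by its composite with the cell
`insertRight m v : m ⇒ m ⊙ g_!` that inserts the unit `v` of the companion `g_!`
(`Companion.hom_ext_insertRight`). Hence a globular cell `X : m ⊙ g_! ⇒ f_! ⊙ n` amounts to the
cell `α` with `insertRight m v ≫ X = insertLeft u α`, where `u` is the unit of `f_!`; this is the
relation `Represents u v α X`, and it holds for `X = slide α`. It is compatible with pasting in
both directions and with change of companions (`Represents.vcomp`, `Represents.hcomp` and the
lemmas next to them), so that each axiom of an oplax transformation or of a modification between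
slid cells reduces to an equation between the original cells, which holds by a universal property.

**Existence of companions.** In the iso-strong case the reindexing arrow `Π x → Π (x ∘ φ)` of a
function `φ : J → I` has as companion and conjoint the products of external identities that are
indexed by the spans `I ←φ- J → J` and `J ← J -φ→ I`. A companion is left adjoint to a conjoint
(`Companion.adjunction`). Projections, diagonals and the arrows to the terminal object are
composites of reindexing arrows with canonical isomorphisms `Π {x} → x` and their inverses, so
they are transposable: they have companions that are maps.

**The lax adjunction `Δ ⊣ ⊗`.** Products of proarrows make up a pseudofunctor
(`LaxFiniteProducts.IsIsoStrong.tensor`), which preserves companions and represented cells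
(`BinaryDoubleProduct.companion`, `BinaryDoubleProduct.represents_mapSquare`). The components of
the unit and of the counit are companions of the diagonals and the projections, their naturality
cells are slid. Both triangulators are the canonical isomorphisms between companions of identity
arrows; for `t⁻¹` the companion is `δ ⊙ (π¹ × π²)`, whose unit is the composite of the unit of `δ`
with the product of the units of the projections. Each 2-cell in a swallowtail composite carries
the unit cell of its source, formed from the units of the companions involved, to the unit cell of
its target. So the composite fixes the unit of a companion, and a globular endocell of a companion
that fixes the unit is the identity (`Companion.hom_ext_unit`).

**The lax adjunction `! ⊣ I`.** Cells into the terminal proarrow are unique, hence so are 2-cells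
into its external composites with companions of arrows to the terminal object, and all equations
are trivial.
-/

namespace DoubleCategory

variable {D : Type u} [DoubleCategory.{z, w, v} D]

/-! ### The category of proarrows and cells -/

variable (D) in
/-- A proarrow of a double category, bundled with its source and target. -/
structure Proarrow where
  {src : D}
  {tgt : D}
  pro : Pro src tgt

/-- A cell, bundled with its boundary arrows. -/
structure Square (m n : Proarrow D) where
  left : m.src ⟶ n.src
  right : m.tgt ⟶ n.tgt
  cell : Cell left right m.pro n.pro

theorem square_vcomp {x y x' y' x'' y'' : D} {f : x ⟶ x'} {g : y ⟶ y'} {f' : x' ⟶ x''}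
    {g' : y' ⟶ y''} {f'' : x ⟶ x''} {g'' : y ⟶ y''} {m : Pro x y} {n : Pro x' y'}
    {p : Pro x'' y''} (α : Cell f g m n) (β : Cell f' g' n p) (hf : f ≫ f' = f'')
    (hg : g ≫ g' = g'') :
    (⟨f'', g'', vcomp α β hf hg⟩ : Square ⟨m⟩ ⟨p⟩) = ⟨_, _, vcomp α β rfl rfl⟩ := by
  subst hf hg
  rfl

/-- The category of proarrows and cells. In it, cells whose boundary arrows are only
propositionally equal can be compared without transport. -/
instance : Category (Proarrow D) where
  Hom := Square
  id m := ⟨𝟙 _, 𝟙 _, vid m.pro⟩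
  comp S T := ⟨S.left ≫ T.left, S.right ≫ T.right, vcomp S.cell T.cell rfl rfl⟩
  id_comp S := by
    rw [← square_vcomp _ _ (Category.id_comp _) (Category.id_comp _), vid_vcomp]
  comp_id S := by
    rw [← square_vcomp _ _ (Category.comp_id _) (Category.comp_id _), vcomp_vid]
  assoc S T U := by
    rw [← square_vcomp _ _ (Category.assoc _ _ _).symm (Category.assoc _ _ _).symm]
    exact congrArg (Square.mk _ _) (vcomp_assoc _ _ _ _ _ _ _ _ _ _ _)

/-- A cell as a morphism of the category of proarrows and cells. -/
def sq {x y x' y' : D} {f : x ⟶ x'} {g : y ⟶ y'} {m : Pro x y} {n : Pro x' y'}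
    (α : Cell f g m n) : (⟨m⟩ : Proarrow D) ⟶ ⟨n⟩ :=
  ⟨f, g, α⟩

theorem sq_injective {x y x' y' : D} {f : x ⟶ x'} {g : y ⟶ y'} {m : Pro x y} {n : Pro x' y'}
    {α β : Cell f g m n} (h : sq α = sq β) : α = β := by
  cases h
  rfl

theorem left_eq_of_sq_eq {x y x' y' : D} {f f' : x ⟶ x'} {g g' : y ⟶ y'} {m : Pro x y}
    {n : Pro x' y'} {α : Cell f g m n} {β : Cell f' g' m n} (h : sq α = sq β) : f = f' :=
  congrArg Square.left h

theorem right_eq_of_sq_eq {x y x' y' : D} {f f' : x ⟶ x'} {g g' : y ⟶ y'} {m : Pro x y}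
    {n : Pro x' y'} {α : Cell f g m n} {β : Cell f' g' m n} (h : sq α = sq β) : g = g' :=
  congrArg Square.right h

/-- A cell with prescribed boundary arrows that are equal to its own. -/
theorem exists_sq_eq {x y x' y' : D} {f f' : x ⟶ x'} {g g' : y ⟶ y'} {m : Pro x y}
    {n : Pro x' y'} (α : Cell f g m n) (hf : f = f') (hg : g = g') :
    ∃ β : Cell f' g' m n, sq β = sq α := by
  subst hf hg
  exact ⟨α, rfl⟩

theorem sq_vid {x y : D} (m : Pro x y) : sq (vid m) = 𝟙 (⟨m⟩ : Proarrow D) := rfl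

theorem sq_vcomp {x y x' y' x'' y'' : D} {f : x ⟶ x'} {g : y ⟶ y'} {f' : x' ⟶ x''}
    {g' : y' ⟶ y''} {f'' : x ⟶ x''} {g'' : y ⟶ y''} {m : Pro x y} {n : Pro x' y'}
    {p : Pro x'' y''} (α : Cell f g m n) (β : Cell f' g' n p) (hf : f ≫ f' = f'')
    (hg : g ≫ g' = g'') : sq (vcomp α β hf hg) = sq α ≫ sq β :=
  square_vcomp α β hf hg

theorem sq_gcomp {x y : D} {m n p : Pro x y} (α : Cell (𝟙 x) (𝟙 y) m n)
    (β : Cell (𝟙 x) (𝟙 y) n p) : sq (gcomp α β) = sq α ≫ sq β :=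
  sq_vcomp α β _ _

theorem sq_hid_comp {x y t : D} (f : x ⟶ y) (g : y ⟶ t) :
    sq (hid (f ≫ g)) = sq (hid f) ≫ sq (hid g) := by
  rw [hid_comp rfl, sq_vcomp]

theorem sq_hid_id (x : D) : sq (hid (𝟙 x)) = 𝟙 (⟨idPro x⟩ : Proarrow D) := by
  rw [hid_id, sq_vid]

theorem sq_hcomp_vid {x y t : D} (m : Pro x y) (n : Pro y t) :
    sq (hcomp (vid m) (vid n)) = 𝟙 (⟨compPro m n⟩ : Proarrow D) := by
  rw [hcomp_vid, sq_vid]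

/-- External composites may be compared without transport as well. -/
theorem sq_hcomp_congr {x y t x' y' t' : D} {f f₁ : x ⟶ x'} {g g₁ : y ⟶ y'} {h h₁ : t ⟶ t'}
    {m : Pro x y} {n : Pro y t} {m' : Pro x' y'} {n' : Pro y' t'}
    {α : Cell f g m m'} {β : Cell g h n n'} {α₁ : Cell f₁ g₁ m m'} {β₁ : Cell g₁ h₁ n n'}
    (hα : sq α = sq α₁) (hβ : sq β = sq β₁) : sq (hcomp α β) = sq (hcomp α₁ β₁) := by
  obtain rfl := left_eq_of_sq_eq hα
  obtain rfl := right_eq_of_sq_eq hα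
  obtain rfl := right_eq_of_sq_eq hβ
  rw [sq_injective hα, sq_injective hβ]

/-- The interchange law, in a form that determines a composite of external composites from the
composites of the factors. -/
theorem sq_hcomp_comp {x y t x' y' t' x'' y'' t'' : D} {f : x ⟶ x'} {g : y ⟶ y'} {h : t ⟶ t'}
    {f' : x' ⟶ x''} {g' : y' ⟶ y''} {h' : t' ⟶ t''} {f'' : x ⟶ x''} {g'' : y ⟶ y''}
    {h'' : t ⟶ t''} {m : Pro x y} {n : Pro y t} {m' : Pro x' y'} {n' : Pro y' t'}
    {m'' : Pro x'' y''} {n'' : Pro y'' t''} {α : Cell f g m m'} {β : Cell g h n n'}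
    {α' : Cell f' g' m' m''} {β' : Cell g' h' n' n''} {α'' : Cell f'' g'' m m''}
    {β'' : Cell g'' h'' n n''} (hα : sq α ≫ sq α' = sq α'') (hβ : sq β ≫ sq β' = sq β'') :
    sq (hcomp α β) ≫ sq (hcomp α' β') = sq (hcomp α'' β'') := by
  rw [← sq_vcomp _ _ rfl rfl, ← interchange _ _ _ _ rfl rfl rfl]
  exact sq_hcomp_congr (by rw [sq_vcomp, hα]) (by rw [sq_vcomp, hβ])

/-- Two composable pairs of external composites agree if the composites of the factors agree. -/
theorem sq_hcomp_comp_eq {x y t x' y' t' x₁ y₁ t₁ x'' y'' t'' : D} {f : x ⟶ x'} {g : y ⟶ y'}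
    {h : t ⟶ t'} {f' : x' ⟶ x''} {g' : y' ⟶ y''} {h' : t' ⟶ t''} {f₁ : x ⟶ x₁} {g₁ : y ⟶ y₁}
    {h₁ : t ⟶ t₁} {f₁' : x₁ ⟶ x''} {g₁' : y₁ ⟶ y''} {h₁' : t₁ ⟶ t''} {m : Pro x y} {n : Pro y t}
    {m' : Pro x' y'} {n' : Pro y' t'} {m₁ : Pro x₁ y₁} {n₁ : Pro y₁ t₁}
    {m'' : Pro x'' y''} {n'' : Pro y'' t''} {α : Cell f g m m'} {β : Cell g h n n'}
    {α' : Cell f' g' m' m''} {β' : Cell g' h' n' n''} {α₁ : Cell f₁ g₁ m m₁}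
    {β₁ : Cell g₁ h₁ n n₁} {α₁' : Cell f₁' g₁' m₁ m''} {β₁' : Cell g₁' h₁' n₁ n''}
    (hα : sq α ≫ sq α' = sq α₁ ≫ sq α₁') (hβ : sq β ≫ sq β' = sq β₁ ≫ sq β₁') :
    sq (hcomp α β) ≫ sq (hcomp α' β') = sq (hcomp α₁ β₁) ≫ sq (hcomp α₁' β₁') := by
  have h₁ := hα.trans (sq_vcomp α₁ α₁' rfl rfl).symm
  have h₂ := hβ.trans (sq_vcomp β₁ β₁' rfl rfl).symm
  rw [sq_hcomp_comp h₁ h₂, sq_hcomp_comp (sq_vcomp α₁ α₁' rfl rfl).symm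
    (sq_vcomp β₁ β₁' rfl rfl).symm]

/-! Structure cells, as morphisms of the category of proarrows and cells. -/

section Structure

variable {x y t s : D}

/-- The associator as an isomorphism of proarrows. -/
def assocIso (m : Pro x y) (n : Pro y t) (p : Pro t s) :
    (⟨compPro (compPro m n) p⟩ : Proarrow D) ≅ ⟨compPro m (compPro n p)⟩ where
  hom := sq (assocHom m n p)
  inv := sq (assocInv m n p)
  hom_inv_id := by rw [← sq_vid, ← assoc_hom_inv, sq_vcomp]
  inv_hom_id := by rw [← sq_vid, ← assoc_inv_hom, sq_vcomp]

/-- The left unitor as an isomorphism of proarrows. -/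
def leftIso (m : Pro x y) : (⟨compPro (idPro x) m⟩ : Proarrow D) ≅ ⟨m⟩ where
  hom := sq (leftHom m)
  inv := sq (leftInv m)
  hom_inv_id := by rw [← sq_vid, ← left_hom_inv, sq_vcomp]
  inv_hom_id := by rw [← sq_vid, ← left_inv_hom, sq_vcomp]

/-- The right unitor as an isomorphism of proarrows. -/
def rightIso (m : Pro x y) : (⟨compPro m (idPro y)⟩ : Proarrow D) ≅ ⟨m⟩ where
  hom := sq (rightHom m)
  inv := sq (rightInv m)
  hom_inv_id := by rw [← sq_vid, ← right_hom_inv, sq_vcomp]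
  inv_hom_id := by rw [← sq_vid, ← right_inv_hom, sq_vcomp]

theorem sq_assocHom (m : Pro x y) (n : Pro y t) (p : Pro t s) :
    sq (assocHom m n p) = (assocIso m n p).hom := rfl

theorem sq_assocInv (m : Pro x y) (n : Pro y t) (p : Pro t s) :
    sq (assocInv m n p) = (assocIso m n p).inv := rfl

theorem sq_leftHom (m : Pro x y) : sq (leftHom m) = (leftIso m).hom := rfl

theorem sq_leftInv (m : Pro x y) : sq (leftInv m) = (leftIso m).inv := rfl

theorem sq_rightHom (m : Pro x y) : sq (rightHom m) = (rightIso m).hom := rfl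

theorem sq_rightInv (m : Pro x y) : sq (rightInv m) = (rightIso m).inv := rfl

variable {x' y' t' s' : D} {f : x ⟶ x'} {g : y ⟶ y'} {h : t ⟶ t'} {k : s ⟶ s'}
  {m : Pro x y} {n : Pro y t} {p : Pro t s} {m' : Pro x' y'} {n' : Pro y' t'} {p' : Pro t' s'}

theorem assocIso_naturality (α : Cell f g m m') (β : Cell g h n n') (γ : Cell h k p p') :
    sq (hcomp (hcomp α β) γ) ≫ (assocIso m' n' p').hom =
      (assocIso m n p).hom ≫ sq (hcomp α (hcomp β γ)) := by
  have := congrArg sq (assoc_naturality α β γ)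
  rwa [sq_vcomp, sq_vcomp] at this

theorem assocIso_inv_naturality (α : Cell f g m m') (β : Cell g h n n') (γ : Cell h k p p') :
    sq (hcomp α (hcomp β γ)) ≫ (assocIso m' n' p').inv =
      (assocIso m n p).inv ≫ sq (hcomp (hcomp α β) γ) := by
  rw [Iso.comp_inv_eq, Category.assoc, assocIso_naturality, Iso.inv_hom_id_assoc]

theorem leftIso_naturality (α : Cell f g m m') :
    sq (hcomp (hid f) α) ≫ (leftIso m').hom = (leftIso m).hom ≫ sq α := by
  have := congrArg sq (left_naturality α)
  rwa [sq_vcomp, sq_vcomp] at this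

theorem leftIso_inv_naturality (α : Cell f g m m') :
    sq α ≫ (leftIso m').inv = (leftIso m).inv ≫ sq (hcomp (hid f) α) := by
  rw [Iso.comp_inv_eq, Category.assoc, leftIso_naturality, Iso.inv_hom_id_assoc]

theorem rightIso_naturality (α : Cell f g m m') :
    sq (hcomp α (hid g)) ≫ (rightIso m').hom = (rightIso m).hom ≫ sq α := by
  have := congrArg sq (right_naturality α)
  rwa [sq_vcomp, sq_vcomp] at this

theorem rightIso_inv_naturality (α : Cell f g m m') :
    sq α ≫ (rightIso m').inv = (rightIso m).inv ≫ sq (hcomp α (hid g)) := by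
  rw [Iso.comp_inv_eq, Category.assoc, rightIso_naturality, Iso.inv_hom_id_assoc]

end Structure

/-! ### The underlying bicategory in terms of proarrows and cells -/

section Bicategory

variable {x y t s : UnderlyingBicategory D}

/-- A 2-cell of the underlying bicategory as a morphism of the category of proarrows and cells. -/
def gsq {m n : x ⟶ y} (α : m ⟶ n) :
    (⟨(m : Pro x.obj y.obj)⟩ : Proarrow D) ⟶ ⟨(n : Pro x.obj y.obj)⟩ :=
  sq (show Cell (𝟙 x.obj) (𝟙 y.obj) m n from α)

theorem gsq_injective {m n : x ⟶ y} {α β : m ⟶ n} (h : gsq α = gsq β) : α = β :=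
  sq_injective (α := α) (β := β) h

theorem gsq_id (m : x ⟶ y) : gsq (𝟙 m) = 𝟙 _ := rfl

theorem gsq_comp {m n p : x ⟶ y} (α : m ⟶ n) (β : n ⟶ p) : gsq (α ≫ β) = gsq α ≫ gsq β :=
  sq_gcomp α β

theorem gsq_hom_inv {x y : UnderlyingBicategory D} {m n : x ⟶ y} (e : m ≅ n) :
    gsq e.hom ≫ gsq e.inv = 𝟙 _ := by
  rw [← gsq_comp, e.hom_inv_id, gsq_id]

theorem gsq_inv_hom {x y : UnderlyingBicategory D} {m n : x ⟶ y} (e : m ≅ n) :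
    gsq e.inv ≫ gsq e.hom = 𝟙 _ := by
  rw [← gsq_comp, e.inv_hom_id, gsq_id]

/-- A 2-cell that carries `u` to `u'`, followed by one that carries `u'` to `u''`. -/
theorem sq_comp_gsq {x y : UnderlyingBicategory D} {s : Proarrow D} {m n p : x ⟶ y}
    {u : s ⟶ ⟨(m : Pro x.obj y.obj)⟩} {u' : s ⟶ ⟨(n : Pro x.obj y.obj)⟩}
    {u'' : s ⟶ ⟨(p : Pro x.obj y.obj)⟩}
    {α : m ⟶ n} {β : n ⟶ p} (h : u ≫ gsq α = u') (h' : u' ≫ gsq β = u'') :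
    u ≫ gsq (α ≫ β) = u'' := by
  rw [gsq_comp, ← Category.assoc, h, h']

/-- The form in which a compatibility of a comparison isomorphism with projections enters the
axioms of an oplax transformation. -/
theorem comp_eq_of_inv_comp_eq {x y : UnderlyingBicategory D} {m n : x ⟶ y} (e : m ≅ n)
    {s t : UnderlyingBicategory D} {k : s ⟶ t} {f : x.obj ⟶ s.obj} {g : y.obj ⟶ t.obj}
    {α : Cell f g m k} {β : Cell f g n k} (h : gsq e.inv ≫ sq α = sq β) :
    sq α ≫ gsq (𝟙 k) = gsq (e.hom ≫ 𝟙 n) ≫ sq β := by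
  rw [Category.comp_id, ← h, ← Category.assoc, gsq_hom_inv]
  exact (Category.comp_id _).trans (Category.id_comp _).symm

end Bicategory

section Coherence

variable {x y t : D}

theorem leftIso_idPro (x : D) : leftIso (idPro x) = rightIso (idPro x) :=
  Iso.ext (congrArg gsq (unitors_equal (a := (⟨x⟩ : UnderlyingBicategory D))))

theorem triangle_sq (m : Pro x y) (n : Pro y t) :
    (assocIso m (idPro y) n).hom ≫ sq (hcomp (vid m) (leftHom n)) =
      sq (hcomp (rightHom m) (vid n)) := by
  have := congrArg sq (triangle m n)
  rwa [sq_vcomp] at this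

theorem triangle_inv_sq (m : Pro x y) (n : Pro y t) :
    sq (hcomp (vid m) (leftInv n)) ≫ (assocIso m (idPro y) n).inv =
      sq (hcomp (rightInv m) (vid n)) := by
  have h := congrArg gsq (triangle_assoc_comp_left_inv (a := (⟨x⟩ : UnderlyingBicategory D))
    (b := ⟨y⟩) (c := ⟨t⟩) m n)
  rw [gsq_comp] at h
  exact h

theorem rightIso_compPro_hom (m : Pro x y) (n : Pro y t) :
    (rightIso (compPro m n)).hom =
      (assocIso m n (idPro t)).hom ≫ sq (hcomp (vid m) (rightHom n)) := by
  have := congrArg gsq (rightUnitor_comp (a := (⟨x⟩ : UnderlyingBicategory D))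
    (b := ⟨y⟩) (c := ⟨t⟩) m n)
  rw [gsq_comp] at this
  exact this

theorem rightIso_compPro_inv (m : Pro x y) (n : Pro y t) :
    (rightIso (compPro m n)).inv =
      sq (hcomp (vid m) (rightInv n)) ≫ (assocIso m n (idPro t)).inv := by
  have := congrArg gsq (rightUnitor_comp_inv (a := (⟨x⟩ : UnderlyingBicategory D))
    (b := ⟨y⟩) (c := ⟨t⟩) m n)
  rw [gsq_comp] at this
  exact this

theorem leftIso_compPro_inv (m : Pro x y) (n : Pro y t) :
    (leftIso (compPro m n)).inv =
      sq (hcomp (leftInv m) (vid n)) ≫ (assocIso (idPro x) m n).hom := by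
  have := congrArg gsq (leftUnitor_comp_inv (a := (⟨x⟩ : UnderlyingBicategory D))
    (b := ⟨y⟩) (c := ⟨t⟩) m n)
  rw [gsq_comp] at this
  exact this

end Coherence

/-! ### Companions -/

section Insert

variable {x y t s x' y' t' s' : D} {f : x ⟶ x'} {g : y ⟶ y'} {h : t ⟶ t'}

/-- The cell `m ⇒ m ⊙ n` over `(1, g)` obtained from a cell `v : id ⇒ n` over `(1, g)`. -/
def insertRight (m : Pro x y) {g : y ⟶ t} {n : Pro y t} (v : Cell (𝟙 y) g (idPro y) n) :
    Cell (𝟙 x) g m (compPro m n) :=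
  vcomp (rightInv m) (hcomp (vid m) v) (Category.id_comp _) (Category.id_comp _)

/-- The cell `m ⇒ p ⊙ n` over `(1, g)` obtained from a cell `u : id ⇒ p` over `(1, f)` and a cell
`α : m ⇒ n` over `(f, g)`. -/
def insertLeft {m : Pro x y} {n : Pro x' y'} {p : Pro x x'} (u : Cell (𝟙 x) f (idPro x) p)
    (α : Cell f g m n) : Cell (𝟙 x) g m (compPro p n) :=
  vcomp (leftInv m) (hcomp u α) (Category.id_comp _) (Category.id_comp _)

theorem sq_insertRight (m : Pro x y) {g : y ⟶ t} {n : Pro y t} (v : Cell (𝟙 y) g (idPro y) n) :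
    sq (insertRight m v) = (rightIso m).inv ≫ sq (hcomp (vid m) v) :=
  sq_vcomp _ _ _ _

theorem sq_insertLeft {m : Pro x y} {n : Pro x' y'} {p : Pro x x'}
    (u : Cell (𝟙 x) f (idPro x) p) (α : Cell f g m n) :
    sq (insertLeft u α) = (leftIso m).inv ≫ sq (hcomp u α) :=
  sq_vcomp _ _ _ _

/-- The composite of two cells `id ⇒ m` over `(1, f)` and `id ⇒ n` over `(1, g)`. -/
def unitComp {f : x ⟶ y} {g : y ⟶ t} {m : Pro x y} {n : Pro y t}
    (u : Cell (𝟙 x) f (idPro x) m) (v : Cell (𝟙 y) g (idPro y) n) :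
    Cell (𝟙 x) (f ≫ g) (idPro x) (compPro m n) :=
  vcomp u (insertRight m v) (Category.id_comp _) rfl

theorem sq_unitComp {f : x ⟶ y} {g : y ⟶ t} {m : Pro x y} {n : Pro y t}
    (u : Cell (𝟙 x) f (idPro x) m) (v : Cell (𝟙 y) g (idPro y) n) :
    sq (unitComp u v) = sq u ≫ sq (insertRight m v) :=
  sq_vcomp _ _ _ _

/-- A cell `u ⊙ α` may be formed by composing with an external identity first. -/
theorem comp_sq_insertRight {m : Pro x y} {n : Pro x' y'} (α : Cell f g m n) {k : y' ⟶ t}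
    {p : Pro y' t} (v : Cell (𝟙 y') k (idPro y') p) {j : y ⟶ t} {β : Cell g j (idPro y) p}
    (hβ : sq (hid g) ≫ sq v = sq β) :
    sq α ≫ sq (insertRight n v) = (rightIso m).inv ≫ sq (hcomp α β) := by
  rw [sq_insertRight, ← Category.assoc, rightIso_inv_naturality, Category.assoc,
    sq_hcomp_comp (Category.comp_id _) hβ]

theorem sq_unitComp_eq {f : x ⟶ y} {g : y ⟶ t} {m : Pro x y} {n : Pro y t}
    (u : Cell (𝟙 x) f (idPro x) m) (v : Cell (𝟙 y) g (idPro y) n) {β : Cell f (f ≫ g) (idPro x) n}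
    (hβ : sq (hid f) ≫ sq v = sq β) :
    sq (unitComp u v) = (leftIso (idPro x)).inv ≫ sq (hcomp u β) := by
  rw [sq_unitComp, comp_sq_insertRight u v hβ, leftIso_idPro]

theorem insertRight_comp_whiskerLeft (m : Pro x y) {g g' : y ⟶ t} {n n' : Pro y t}
    {v : Cell (𝟙 y) g (idPro y) n} {v' : Cell (𝟙 y) g' (idPro y) n'}
    {γ : Cell (𝟙 y) (𝟙 t) n n'} (hγ : sq v ≫ sq γ = sq v') :
    sq (insertRight m v) ≫ sq (hcomp (vid m) γ) = sq (insertRight m v') := by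
  rw [sq_insertRight, sq_insertRight, Category.assoc, sq_hcomp_comp (Category.comp_id _) hγ]

theorem insertRight_comp_whiskerRight {m m' : Pro x y} {g : y ⟶ t} {n : Pro y t}
    (v : Cell (𝟙 y) g (idPro y) n) (γ : Cell (𝟙 x) (𝟙 y) m m') :
    sq (insertRight m v) ≫ sq (hcomp γ (vid n)) = sq γ ≫ sq (insertRight m' v) := by
  have h : sq (hid (𝟙 y)) ≫ sq v = sq v := by rw [sq_hid_id, Category.id_comp]
  rw [comp_sq_insertRight γ v h, sq_insertRight, Category.assoc,
    sq_hcomp_comp (α := vid m) (β' := vid n) (Category.id_comp (sq γ)) (Category.comp_id (sq v))]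

theorem insertRight_comp_assocHom (m : Pro x y) (n : Pro y t) {g : t ⟶ s} {p : Pro t s}
    (v : Cell (𝟙 t) g (idPro t) p) :
    sq (insertRight (compPro m n) v) ≫ (assocIso m n p).hom =
      sq (hcomp (vid m) (insertRight n v)) := by
  rw [sq_insertRight, ← hcomp_vid, Category.assoc, assocIso_naturality, rightIso_compPro_inv,
    Category.assoc, Iso.inv_hom_id_assoc]
  exact sq_hcomp_comp (Category.comp_id _) (sq_insertRight n v).symm

theorem insertRight_unitComp_comp_assocInv (m : Pro x y) {f : y ⟶ t} {g : t ⟶ s} {n : Pro y t}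
    {p : Pro t s} (u : Cell (𝟙 y) f (idPro y) n) (v : Cell (𝟙 t) g (idPro t) p) :
    sq (insertRight m (unitComp u v)) ≫ (assocIso m n p).inv =
      sq (insertRight m u) ≫ sq (insertRight (compPro m n) v) := by
  rw [Iso.comp_inv_eq, Category.assoc, insertRight_comp_assocHom, sq_insertRight, sq_insertRight,
    Category.assoc, sq_hcomp_comp (Category.comp_id _) (sq_unitComp u v).symm]

theorem unitComp_assoc {f : x ⟶ y} {g : y ⟶ t} {h : t ⟶ s} {m : Pro x y} {n : Pro y t}
    {p : Pro t s} (u : Cell (𝟙 x) f (idPro x) m) (v : Cell (𝟙 y) g (idPro y) n)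
    (w : Cell (𝟙 t) h (idPro t) p) :
    sq (unitComp (unitComp u v) w) ≫ (assocIso m n p).hom = sq (unitComp u (unitComp v w)) := by
  rw [← Iso.eq_comp_inv, sq_unitComp, sq_unitComp, sq_unitComp, Category.assoc, Category.assoc,
    insertRight_unitComp_comp_assocInv]

theorem unitComp_assoc_inv {f : x ⟶ y} {g : y ⟶ t} {h : t ⟶ s} {m : Pro x y} {n : Pro y t}
    {p : Pro t s} (u : Cell (𝟙 x) f (idPro x) m) (v : Cell (𝟙 y) g (idPro y) n)
    (w : Cell (𝟙 t) h (idPro t) p) :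
    sq (unitComp u (unitComp v w)) ≫ (assocIso m n p).inv = sq (unitComp (unitComp u v) w) := by
  rw [Iso.comp_inv_eq, unitComp_assoc]

theorem unitComp_vid {f : x ⟶ y} {m : Pro x y} (u : Cell (𝟙 x) f (idPro x) m) :
    sq u ≫ (rightIso m).inv = sq (unitComp u (vid (idPro y))) := by
  rw [sq_unitComp, sq_insertRight, sq_hcomp_vid, Category.comp_id]

theorem vid_unitComp {f : x ⟶ y} {m : Pro x y} (u : Cell (𝟙 x) f (idPro x) m) :
    sq u ≫ (leftIso m).inv = sq (unitComp (vid (idPro x)) u) := by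
  rw [leftIso_inv_naturality, sq_unitComp, sq_insertRight, sq_vid, leftIso_idPro, hid_id,
    Category.id_comp]

/-- Whiskering carries composite unit cells to composite unit cells. -/
theorem unitComp_comp_whiskerLeft {f : x ⟶ y} {g g' : y ⟶ t} {m : Pro x y} {n n' : Pro y t}
    (u : Cell (𝟙 x) f (idPro x) m) {v : Cell (𝟙 y) g (idPro y) n}
    {v' : Cell (𝟙 y) g' (idPro y) n'} {γ : Cell (𝟙 y) (𝟙 t) n n'} (hγ : sq v ≫ sq γ = sq v') :
    sq (unitComp u v) ≫ sq (hcomp (vid m) γ) = sq (unitComp u v') := by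
  rw [sq_unitComp, sq_unitComp, Category.assoc, insertRight_comp_whiskerLeft m hγ]

theorem unitComp_comp_whiskerRight {f f' : x ⟶ y} {g : y ⟶ t} {m m' : Pro x y} {n : Pro y t}
    {u : Cell (𝟙 x) f (idPro x) m} {u' : Cell (𝟙 x) f' (idPro x) m'}
    (v : Cell (𝟙 y) g (idPro y) n) {γ : Cell (𝟙 x) (𝟙 y) m m'} (hγ : sq u ≫ sq γ = sq u') :
    sq (unitComp u v) ≫ sq (hcomp γ (vid n)) = sq (unitComp u' v) := by
  rw [sq_unitComp, sq_unitComp, Category.assoc, insertRight_comp_whiskerRight, ← hγ,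
    Category.assoc]

end Insert

namespace Companion

variable {x y : D} {f : x ⟶ y} {m : Pro x y} (c : Companion f m)

theorem sq_external : sq (hcomp c.unit c.counit) ≫ (rightIso m).hom = (leftIso m).hom := by
  have := congrArg sq c.external
  rwa [sq_gcomp] at this

theorem sq_internal : sq c.unit ≫ sq c.counit = sq (hid f) := by
  rw [← c.internal, sq_vcomp]

/-- Cells out of a companion are determined by their composites with the unit. -/
theorem hom_ext_unit {x' y' : D} {p : Pro x' y'} {a : x ⟶ x'} {b : y ⟶ y'} {X Y : Cell a b m p}
    (h : sq c.unit ≫ sq X = sq c.unit ≫ sq Y) : X = Y := by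
  -- By the external equation, `Z` is recovered as `(unit ≫ Z) ⊙ counit`.
  have key : ∀ Z : Cell a b m p, (leftIso m).hom ≫ sq Z =
      sq (hcomp (vcomp c.unit Z rfl rfl) (vcomp c.counit (hid b) rfl rfl)) ≫
        (rightIso p).hom := fun Z => by
    rw [← sq_hcomp_comp (sq_vcomp c.unit Z rfl rfl).symm (sq_vcomp c.counit (hid b) rfl rfl).symm,
      Category.assoc, rightIso_naturality, ← Category.assoc, c.sq_external]
  rw [← sq_vcomp _ _ rfl rfl, ← sq_vcomp _ _ rfl rfl] at h
  have h := sq_injective h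
  apply sq_injective
  rw [← cancel_epi (leftIso m).hom, key, key, h]

/-- Cells into a companion are determined by their composites with the counit. -/
theorem hom_ext_counit {x' y' : D} {p : Pro x' y'} {a : x' ⟶ x} {b : y' ⟶ y}
    {X Y : Cell a b p m} (h : sq X ≫ sq c.counit = sq Y ≫ sq c.counit) : X = Y := by
  -- By the external equation, `Z` is recovered as `unit ⊙ (Z ≫ counit)`.
  have key : ∀ Z : Cell a b p m, (leftIso p).hom ≫ sq Z =
      sq (hcomp (vcomp (hid a) c.unit rfl rfl) (vcomp Z c.counit rfl rfl)) ≫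
        (rightIso m).hom := fun Z => by
    rw [← sq_hcomp_comp (sq_vcomp (hid a) c.unit rfl rfl).symm (sq_vcomp Z c.counit rfl rfl).symm,
      Category.assoc, c.sq_external, leftIso_naturality]
  rw [← sq_vcomp _ _ rfl rfl, ← sq_vcomp _ _ rfl rfl] at h
  have h := sq_injective h
  apply sq_injective
  rw [← cancel_epi (leftIso p).hom, key, key, h]

/-- The external equation of a companion `f_!`, composed externally with `n`. -/
theorem hcomp_insertRight_counit {t : D} (n : Pro t x) :
    sq (hcomp (insertRight n c.unit) c.counit) ≫ (rightIso (compPro n m)).hom = 𝟙 _ := by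
  rw [← sq_hcomp_comp (sq_insertRight n c.unit).symm (Category.id_comp (sq c.counit)),
    rightIso_compPro_hom, Category.assoc, ← Category.assoc (sq (hcomp (hcomp _ _) _)),
    assocIso_naturality, Category.assoc]
  rw [sq_hcomp_comp (Category.id_comp (sq (vid n)))
    (c.sq_external.trans (sq_leftHom m).symm), triangle_sq]
  exact (sq_hcomp_comp (rightIso n).inv_hom_id (Category.id_comp (𝟙 _))).trans
    (sq_hcomp_vid _ _)

/-- Cells out of an external composite `n ⊙ f_!` are determined by their composites with the unit
of the companion `f_!`. -/
theorem hom_ext_insertRight {t x' y' : D} {n : Pro t x} {p : Pro x' y'} {a : t ⟶ x'} {b : y ⟶ y'}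
    {X Y : Cell a b (compPro n m) p}
    (h : sq (insertRight n c.unit) ≫ sq X = sq (insertRight n c.unit) ≫ sq Y) : X = Y := by
  have key : ∀ Z : Cell a b (compPro n m) p, sq Z =
      sq (hcomp (vcomp (insertRight n c.unit) Z rfl rfl) (vcomp c.counit (hid b) rfl rfl)) ≫
        (rightIso p).hom := fun Z => by
    rw [← sq_hcomp_comp (sq_vcomp _ Z rfl rfl).symm (sq_vcomp c.counit (hid b) rfl rfl).symm,
      Category.assoc, rightIso_naturality, ← Category.assoc, c.hcomp_insertRight_counit,
      Category.id_comp]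
  rw [← sq_vcomp _ _ rfl rfl, ← sq_vcomp _ _ rfl rfl] at h
  have h := sq_injective h
  apply sq_injective
  rw [key X, key Y, h]

/-- A companion structure from a unit and a counit, where the external equation is replaced by
the condition that globular endocells are determined by their composites with the unit. -/
def mkOfExt {x y : D} {f : x ⟶ y} {m : Pro x y} (unit : Cell (𝟙 x) f (idPro x) m)
    (counit : Cell f (𝟙 y) m (idPro y)) (internal : sq unit ≫ sq counit = sq (hid f))
    (ext : ∀ X Y : Cell (𝟙 x) (𝟙 y) m m, sq unit ≫ sq X = sq unit ≫ sq Y → X = Y) :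
    Companion f m where
  unit := unit
  counit := counit
  external := by
    -- The two sides of the external equation differ by a globular endocell that fixes the unit.
    have h := ext (gcomp (leftInv m) (gcomp (hcomp unit counit) (rightHom m))) (vid m) (by
      rw [sq_gcomp, sq_gcomp, sq_leftInv, ← Category.assoc, leftIso_inv_naturality,
        Category.assoc, ← Category.assoc (sq (hcomp _ _)),
        sq_hcomp_comp (α'' := unit) (by rw [sq_hid_id, Category.id_comp]) internal,
        sq_rightHom, rightIso_naturality, leftIso_idPro, Iso.inv_hom_id_assoc, sq_vid,
        Category.comp_id])
    have h := congrArg sq h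
    rw [sq_gcomp, sq_leftInv, Iso.inv_comp_eq, sq_vid, Category.comp_id] at h
    exact sq_injective h
  internal := sq_injective (by rw [sq_vcomp, internal])

/-- The unit of a composite companion inserts the two units one after the other. -/
theorem sq_compUnit {x y t : D} {f : x ⟶ y} {g : y ⟶ t} {k : x ⟶ t} {f' : Pro x y} {g' : Pro y t}
    (cf : Companion f f') (cg : Companion g g') (h : f ≫ g = k) :
    sq (compUnit cf cg h) = sq (unitComp cf.unit cg.unit) := by
  rw [compUnit, sq_vcomp, sq_vcomp, sq_unitComp, sq_insertRight, ← Category.assoc (sq cf.unit),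
    rightIso_inv_naturality, sq_leftInv, leftIso_idPro]

/-- The composite of two companions. -/
def comp {x y t : D} {f : x ⟶ y} {g : y ⟶ t} {k : x ⟶ t} {f' : Pro x y} {g' : Pro y t}
    (cf : Companion f f') (cg : Companion g g') (h : f ≫ g = k) : Companion k (compPro f' g') :=
  mkOfExt (compUnit cf cg h)
    (vcomp (vcomp (hcomp cf.counit (vid g')) (leftHom g') (Category.comp_id _)
      (Category.comp_id _)) cg.counit h (Category.comp_id _))
    (by
      rw [sq_compUnit, sq_vcomp, sq_vcomp, sq_unitComp, sq_insertRight]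
      have e : sq (hcomp (vid f') cg.unit) ≫ sq (hcomp cf.counit (vid g')) =
          sq (hcomp cf.counit (hid (𝟙 y))) ≫ sq (hcomp (hid (𝟙 y)) cg.unit) :=
        sq_hcomp_comp_eq (by rw [sq_vid, Category.id_comp, sq_hid_id, Category.comp_id])
          (by rw [sq_vid, Category.comp_id, sq_hid_id, Category.id_comp])
      have e' := leftIso_naturality cg.unit
      have e'' := rightIso_inv_naturality cf.counit
      simp only [Category.assoc]
      rw [reassoc_of% e, sq_leftHom, reassoc_of% e', ← reassoc_of% e'', leftIso_idPro,
        Iso.inv_hom_id_assoc, ← Category.assoc, cf.sq_internal, cg.sq_internal, ← sq_hid_comp, h])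
    (fun X Y hXY => by
      rw [sq_compUnit, sq_unitComp, Category.assoc, Category.assoc, ← sq_vcomp _ X rfl rfl,
        ← sq_vcomp _ Y rfl rfl] at hXY
      have := congrArg sq (cf.hom_ext_unit hXY)
      rw [sq_vcomp, sq_vcomp] at this
      exact cg.hom_ext_insertRight this)

/-- The unit of a companion of an identity arrow is invertible. -/
def isoOfId {x : UnderlyingBicategory D} {m : x ⟶ x} (c : Companion (𝟙 x.obj) m) : 𝟙 x ≅ m where
  hom := c.unit
  inv := c.counit
  hom_inv_id := gsq_injective (by
    rw [gsq_comp]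
    exact c.sq_internal.trans (sq_hid_id _))
  inv_hom_id := c.hom_ext_unit (by
    refine (congrArg (sq c.unit ≫ ·) (sq_gcomp c.counit c.unit)).trans ?_
    refine (Category.assoc _ _ _).symm.trans ((congrArg (· ≫ sq c.unit) c.sq_internal).trans ?_)
    exact (congrArg (· ≫ sq c.unit) (sq_hid_id _)).trans
      ((Category.id_comp _).trans (Category.comp_id _).symm))

end Companion

/-! ### Sliding -/

section Slide

variable {x y t x' y' t' x'' y'' : D}

/-- The globular cell `X : m ⊙ n₁ ⇒ n₂ ⊙ m'` corresponds to the cell `α : m ⇒ m'` by sliding.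
As opposed to `slide`, this only involves the unit cells of the companions `n₁` and `n₂`. -/
def Represents {f : x ⟶ x'} {g : y ⟶ y'} {m : Pro x y} {m' : Pro x' y'}
    {n₂ : Pro x x'} {n₁ : Pro y y'} (u : Cell (𝟙 x) f (idPro x) n₂)
    (v : Cell (𝟙 y) g (idPro y) n₁) (α : Cell f g m m')
    (X : Cell (𝟙 x) (𝟙 y') (compPro m n₁) (compPro n₂ m')) : Prop :=
  sq (insertRight m v) ≫ sq X = sq (insertLeft u α)

variable {f : x ⟶ x'} {g : y ⟶ y'} {h : t ⟶ t'} {m : Pro x y}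
  {m' : Pro x' y'} {n₂ : Pro x x'} {n₁ : Pro y y'}

theorem represents_slide (cf : Companion f n₂) (cg : Companion g n₁) (α : Cell f g m m') :
    Represents cf.unit cg.unit α (slide cf cg α) := by
  have e : sq (slide cf cg α) = sq (hcomp (insertLeft cf.unit α) cg.counit) ≫
      (rightIso (compPro n₂ m')).hom := by
    rw [slide, sq_gcomp, sq_gcomp, ← Category.assoc,
      sq_hcomp_comp (sq_insertLeft cf.unit α).symm (Category.id_comp (sq cg.counit))]
    rfl
  have e' : sq (hcomp (vid m) cg.unit) ≫ sq (hcomp (insertLeft cf.unit α) cg.counit) =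
      sq (hcomp (insertLeft cf.unit α) (hid g)) :=
    sq_hcomp_comp (Category.id_comp _) cg.sq_internal
  rw [Represents, e, sq_insertRight, Category.assoc, reassoc_of% e', rightIso_naturality,
    Iso.inv_hom_id_assoc]

/-- Sliding sends the external identity of an arrow to the identity of its companion. -/
theorem represents_hid (u : Cell (𝟙 x) f (idPro x) n₂) :
    Represents u u (hid f) (gcomp (leftHom n₂) (rightInv n₂)) := by
  have e := leftIso_naturality u
  rw [hid_id] at e
  rw [Represents, sq_gcomp, sq_insertRight, sq_insertLeft, Category.assoc, sq_leftHom,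
    reassoc_of% e, sq_rightInv, ← leftIso_idPro, Iso.inv_hom_id_assoc, rightIso_inv_naturality,
    leftIso_idPro]

/-- Sliding sends the identity cell of a proarrow to its identity 2-cell. -/
theorem represents_vid (m : Pro x y) :
    Represents (vid (idPro x)) (vid (idPro y)) (vid m) (gcomp (rightHom m) (leftInv m)) := by
  rw [Represents, sq_gcomp, sq_insertRight, sq_insertLeft, sq_hcomp_vid, sq_hcomp_vid,
    Category.comp_id, Category.comp_id, sq_rightHom, sq_leftInv, Iso.inv_hom_id_assoc]

section

variable {u : Cell (𝟙 x) f (idPro x) n₂} {v : Cell (𝟙 y) g (idPro y) n₁} {α : Cell f g m m'}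
  {X : Cell (𝟙 x) (𝟙 y') (compPro m n₁) (compPro n₂ m')}

theorem Represents.eq {c : Companion g n₁} {Y : Cell (𝟙 x) (𝟙 y') (compPro m n₁) (compPro n₂ m')}
    (hX : Represents u c.unit α X) (hY : Represents u c.unit α Y) : X = Y :=
  c.hom_ext_insertRight (hX.trans hY.symm)

theorem Represents.congr (hX : Represents u v α X) {f' : x ⟶ x'} {g' : y ⟶ y'}
    {u' : Cell (𝟙 x) f' (idPro x) n₂} {v' : Cell (𝟙 y) g' (idPro y) n₁}
    {α' : Cell f' g' m m'} (hu : sq u = sq u') (hv : sq v = sq v') (hα : sq α = sq α') :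
    Represents u' v' α' X := by
  obtain rfl := right_eq_of_sq_eq hu
  obtain rfl := right_eq_of_sq_eq hv
  obtain rfl := sq_injective hu
  obtain rfl := sq_injective hv
  obtain rfl := sq_injective hα
  exact hX

theorem Represents.whiskerRight_comp (hX : Represents u v α X) {p : Pro x y}
    (γ : Cell (𝟙 x) (𝟙 y) p m) {β : Cell f g p m'} (hβ : sq γ ≫ sq α = sq β) :
    Represents u v β (gcomp (hcomp γ (vid n₁)) X) := by
  rw [Represents, sq_gcomp, ← Category.assoc, insertRight_comp_whiskerRight, Category.assoc,
    show _ = _ from hX, sq_insertLeft, sq_insertLeft, ← Category.assoc, leftIso_inv_naturality,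
    Category.assoc, sq_hcomp_comp (α'' := u) (by rw [sq_hid_id, Category.id_comp]) hβ]

theorem Represents.comp_whiskerLeft (hX : Represents u v α X) {p : Pro x' y'}
    (γ : Cell (𝟙 x') (𝟙 y') m' p) {β : Cell f g m p} (hβ : sq α ≫ sq γ = sq β) :
    Represents u v β (gcomp X (hcomp (vid n₂) γ)) := by
  rw [Represents, sq_gcomp, ← Category.assoc, show _ = _ from hX, sq_insertLeft, sq_insertLeft,
    Category.assoc, sq_hcomp_comp (Category.comp_id _) hβ]

/-- Change of the companion on the left boundary. -/
theorem Represents.comp_whiskerRight (hX : Represents u v α X) {p : Pro x x'}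
    (γ : Cell (𝟙 x) (𝟙 x') n₂ p) {u' : Cell (𝟙 x) f (idPro x) p} (hu : sq u ≫ sq γ = sq u') :
    Represents u' v α (gcomp X (hcomp γ (vid m'))) := by
  rw [Represents, sq_gcomp, ← Category.assoc, show _ = _ from hX, sq_insertLeft, sq_insertLeft,
    Category.assoc, sq_hcomp_comp hu (Category.comp_id _)]

/-- Change of the companion on the right boundary. -/
theorem Represents.whiskerLeft_comp (hX : Represents u v α X) {p : Pro y y'}
    (γ : Cell (𝟙 y) (𝟙 y') p n₁) {v' : Cell (𝟙 y) g (idPro y) p} (hv : sq v' ≫ sq γ = sq v) :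
    Represents u v' α (gcomp (hcomp (vid m) γ) X) := by
  rw [Represents, sq_gcomp, ← Category.assoc, insertRight_comp_whiskerLeft m hv]
  exact hX

/-- Sliding sends composites in the arrow direction to pasting composites. -/
theorem Represents.vcomp (hX : Represents u v α X) {f' : x' ⟶ x''} {g' : y' ⟶ y''}
    {m'' : Pro x'' y''} {p₂ : Pro x' x''} {p₁ : Pro y' y''} {u' : Cell (𝟙 x') f' (idPro x') p₂}
    {v' : Cell (𝟙 y') g' (idPro y') p₁} {β : Cell f' g' m' m''}
    {Y : Cell (𝟙 x') (𝟙 y'') (compPro m' p₁) (compPro p₂ m'')} (hY : Represents u' v' β Y) :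
    Represents (unitComp u u') (unitComp v v') (DoubleCategory.vcomp α β rfl rfl)
      (gcomp (assocInv m n₁ p₁) (gcomp (hcomp X (vid p₁)) (gcomp (assocHom n₂ m' p₁)
        (gcomp (hcomp (vid n₂) Y) (assocInv n₂ p₂ m''))))) := by
  have e₄ : sq (insertLeft u α) ≫ sq (hcomp (vid n₂) (insertRight m' v')) ≫
      sq (hcomp (vid n₂) Y) = (leftIso m).inv ≫
        sq (hcomp u (DoubleCategory.vcomp α (insertLeft u' β) (Category.comp_id _) rfl)) := by
    rw [sq_hcomp_comp (Category.comp_id (sq (vid n₂))) hY, sq_insertLeft, Category.assoc,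
      sq_hcomp_comp (Category.comp_id _) (sq_vcomp _ _ _ _).symm]
  have e₅ : sq (DoubleCategory.vcomp α (insertLeft u' β) (Category.comp_id _) rfl) =
      sq (leftInv m) ≫ sq (hcomp (DoubleCategory.vcomp (hid f) u' (Category.comp_id _) rfl)
        (DoubleCategory.vcomp α β rfl rfl)) := by
    rw [sq_vcomp, sq_insertLeft, ← Category.assoc, leftIso_inv_naturality, Category.assoc,
      sq_hcomp_comp (sq_vcomp (hid f) u' (Category.comp_id _) rfl).symm
        (sq_vcomp α β rfl rfl).symm]
    rfl
  have e₆ := sq_unitComp_eq u u' (sq_vcomp (hid f) u' (Category.comp_id _) rfl).symm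
  rw [leftIso_idPro] at e₆
  -- Insert `v`, apply `X`, insert `v'`, apply `Y`; the units `u` and `u'` come out on the left.
  rw [Represents]
  simp only [sq_gcomp, sq_assocInv, sq_assocHom]
  rw [← Category.assoc, insertRight_unitComp_comp_assocInv, Category.assoc,
    ← Category.assoc (sq (insertRight (compPro m n₁) v')), insertRight_comp_whiskerRight,
    Category.assoc, ← Category.assoc, show _ = _ from hX, ← Category.assoc (sq (insertRight _ v')),
    insertRight_comp_assocHom, ← Category.assoc (sq (hcomp (vid n₂) _)), ← Category.assoc, e₄,
    ← sq_hcomp_comp (Category.id_comp (sq u)) e₅.symm, Category.assoc, Category.assoc,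
    assocIso_inv_naturality, sq_insertLeft]
  congr 1
  rw [← Category.assoc]
  refine (congrArg (· ≫ _) (triangle_inv_sq (idPro x) m)).trans ?_
  exact sq_hcomp_comp e₆.symm (Category.id_comp _)

/-- Sliding sends external composites to pasting composites. -/
theorem Represents.hcomp (hX : Represents u v α X) {p : Pro y t} {p' : Pro y' t'} {n₀ : Pro t t'}
    {w : Cell (𝟙 t) h (idPro t) n₀} {β : Cell g h p p'}
    {Y : Cell (𝟙 y) (𝟙 t') (compPro p n₀) (compPro n₁ p')} (hY : Represents v w β Y) :
    Represents u w (DoubleCategory.hcomp α β)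
      (gcomp (assocHom m p n₀) (gcomp (DoubleCategory.hcomp (vid m) Y) (gcomp (assocInv m n₁ p')
        (gcomp (DoubleCategory.hcomp X (vid p')) (assocHom n₂ m' p'))))) := by
  rw [Represents]
  simp only [sq_gcomp, sq_assocInv, sq_assocHom]
  rw [← Category.assoc, insertRight_comp_assocHom, ← Category.assoc,
    sq_hcomp_comp (Category.id_comp (sq (vid m))) hY,
    ← sq_hcomp_comp (Category.id_comp (sq (vid m))) (sq_insertLeft v β).symm, Category.assoc,
    ← Category.assoc (sq (DoubleCategory.hcomp (vid m) (DoubleCategory.hcomp v β))),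
    assocIso_inv_naturality, Category.assoc, ← Category.assoc]
  refine (congrArg (· ≫ _) (triangle_inv_sq m p)).trans ?_
  rw [← Category.assoc, sq_hcomp_comp (sq_insertRight m v).symm (Category.id_comp (sq β)),
    ← Category.assoc, sq_hcomp_comp hX (Category.comp_id _),
    ← sq_hcomp_comp (sq_insertLeft u α).symm (Category.id_comp (sq β)), Category.assoc,
    assocIso_naturality, sq_insertLeft, leftIso_compPro_inv, Category.assoc]

/-- If `α` is compatible with unit cells of `m` and `m'`, then a cell that corresponds to `α` is
compatible with the composite unit cells. -/
theorem Represents.unitComp_comp (hX : Represents u v α X) {k : x ⟶ y} {k' : x' ⟶ y'}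
    {r : Cell (𝟙 x) k (idPro x) m} {r' : Cell (𝟙 x') k' (idPro x') m'}
    (hα : sq r ≫ sq α = sq (hid f) ≫ sq r') :
    sq (unitComp r v) ≫ sq X = sq (unitComp u r') := by
  have hα' := hα.trans (sq_vcomp (hid f) r' (Category.comp_id _) rfl).symm
  rw [sq_unitComp, Category.assoc, show _ = _ from hX, sq_insertLeft, ← Category.assoc,
    leftIso_inv_naturality, Category.assoc,
    sq_hcomp_comp (by rw [sq_hid_id, Category.id_comp]) hα',
    sq_unitComp_eq u r' (sq_vcomp (hid f) r' (Category.comp_id _) rfl).symm]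

end

end Slide

/-! ### Companions and conjoints as adjoint proarrows -/

namespace Conjoint

variable {x y : D} {f : x ⟶ y} {m : Pro y x} (c : Conjoint f m)

theorem sq_external : sq (hcomp c.counit c.unit) ≫ (leftIso m).hom = (rightIso m).hom := by
  have := congrArg sq c.external
  rwa [sq_gcomp] at this

theorem sq_internal : sq c.unit ≫ sq c.counit = sq (hid f) := by
  rw [← c.internal, sq_vcomp]

/-- Cells out of a conjoint are determined by their composites with the unit. -/
theorem hom_ext_unit {x' y' : D} {p : Pro y' x'} {a : y ⟶ y'} {b : x ⟶ x'} {X Y : Cell a b m p}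
    (h : sq c.unit ≫ sq X = sq c.unit ≫ sq Y) : X = Y := by
  have key : ∀ Z : Cell a b m p, (rightIso m).hom ≫ sq Z =
      sq (hcomp (vcomp c.counit (hid a) rfl rfl) (vcomp c.unit Z rfl rfl)) ≫
        (leftIso p).hom := fun Z => by
    rw [← sq_hcomp_comp (sq_vcomp c.counit (hid a) rfl rfl).symm (sq_vcomp c.unit Z rfl rfl).symm,
      Category.assoc, leftIso_naturality, ← Category.assoc, c.sq_external]
  rw [← sq_vcomp _ _ rfl rfl, ← sq_vcomp _ _ rfl rfl] at h
  have h := sq_injective h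
  apply sq_injective
  rw [← cancel_epi (rightIso m).hom, key, key, h]

/-- A conjoint structure from a unit and a counit, where the external equation is replaced by
the condition that globular endocells are determined by their composites with the unit. -/
def mkOfExt {x y : D} {f : x ⟶ y} {m : Pro y x} (unit : Cell f (𝟙 x) (idPro x) m)
    (counit : Cell (𝟙 y) f m (idPro y)) (internal : sq unit ≫ sq counit = sq (hid f))
    (ext : ∀ X Y : Cell (𝟙 y) (𝟙 x) m m, sq unit ≫ sq X = sq unit ≫ sq Y → X = Y) :
    Conjoint f m where
  unit := unit
  counit := counit
  external := by
    have h := ext (gcomp (rightInv m) (gcomp (hcomp counit unit) (leftHom m))) (vid m) (by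
      rw [sq_gcomp, sq_gcomp, sq_rightInv, ← Category.assoc, rightIso_inv_naturality,
        Category.assoc, ← Category.assoc (sq (hcomp _ _)),
        sq_hcomp_comp (β'' := unit) internal (by rw [sq_hid_id, Category.id_comp]),
        sq_leftHom, leftIso_naturality, leftIso_idPro, Iso.inv_hom_id_assoc, sq_vid,
        Category.comp_id])
    have h := congrArg sq h
    rw [sq_gcomp, sq_rightInv, Iso.inv_comp_eq, sq_vid, Category.comp_id] at h
    exact sq_injective h
  internal := sq_injective (by rw [sq_vcomp, internal])

/-- A conjoint of an isomorphism is a companion of its inverse. -/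
def companionOfInverse {g : y ⟶ x} (hfg : f ≫ g = 𝟙 x) (hgf : g ≫ f = 𝟙 y) : Companion g m :=
  Companion.mkOfExt (vcomp (hid g) c.unit hgf (Category.comp_id _))
    (vcomp c.counit (hid g) (Category.id_comp _) hfg)
    (by
      rw [sq_vcomp, sq_vcomp, Category.assoc, ← Category.assoc (sq c.unit), c.sq_internal,
        ← sq_hid_comp, ← sq_hid_comp, ← Category.assoc, hgf, Category.id_comp])
    (fun X Y h => c.hom_ext_unit (by
      have h := congrArg (sq (hid f) ≫ ·) h
      have e : sq (hid f) ≫ sq (hid g) = 𝟙 _ := by rw [← sq_hid_comp, hfg, sq_hid_id]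
      simpa only [sq_vcomp, Category.assoc, reassoc_of% e] using h))

end Conjoint

/-- A companion of an isomorphism is a conjoint of its inverse. -/
def Companion.conjointOfInverse {x y : D} {f : x ⟶ y} {m : Pro x y} (c : Companion f m) {g : y ⟶ x}
    (hfg : f ≫ g = 𝟙 x) (hgf : g ≫ f = 𝟙 y) : Conjoint g m :=
  Conjoint.mkOfExt (vcomp (hid g) c.unit (Category.comp_id _) hgf)
    (vcomp c.counit (hid g) hfg (Category.id_comp _))
    (by
      rw [sq_vcomp, sq_vcomp, Category.assoc, ← Category.assoc (sq c.unit), c.sq_internal,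
        ← sq_hid_comp, ← sq_hid_comp, ← Category.assoc, hgf, Category.id_comp])
    (fun X Y h => c.hom_ext_unit (by
      have h := congrArg (sq (hid f) ≫ ·) h
      have e : sq (hid f) ≫ sq (hid g) = 𝟙 _ := by rw [← sq_hid_comp, hfg, sq_hid_id]
      simpa only [sq_vcomp, Category.assoc, reassoc_of% e] using h))

section Adjunction

variable {x y : D} {f : x ⟶ y} {m : Pro x y} {n : Pro y x}

/-- The unit of the adjunction between a companion and a conjoint. -/
def Companion.adjUnit (c : Companion f m) (k : Conjoint f n) :
    Cell (𝟙 x) (𝟙 x) (idPro x) (compPro m n) :=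
  gcomp (leftInv (idPro x)) (hcomp c.unit k.unit)

/-- The counit of the adjunction between a companion and a conjoint. -/
def Companion.adjCounit (c : Companion f m) (k : Conjoint f n) :
    Cell (𝟙 y) (𝟙 y) (compPro n m) (idPro y) :=
  gcomp (hcomp k.counit c.counit) (leftHom (idPro y))

theorem Companion.adj_left_triangle (c : Companion f m) (k : Conjoint f n) :
    sq (hcomp (c.adjUnit k) (vid m)) ≫ (assocIso m n m).hom ≫ sq (hcomp (vid m) (c.adjCounit k)) =
      (leftIso m).hom ≫ (rightIso m).inv := by
  have e₁ : sq (hcomp c.unit (hcomp k.unit (vid m))) ≫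
      sq (hcomp (vid m) (hcomp k.counit c.counit)) = sq (hcomp c.unit (hcomp (hid f) c.counit)) :=
    sq_hcomp_comp (Category.comp_id _) (sq_hcomp_comp k.sq_internal (Category.id_comp _))
  have e₂ : sq (hcomp c.unit (hcomp (hid f) c.counit)) ≫
      sq (hcomp (vid m) (leftHom (idPro y))) =
      sq (hcomp (vid (idPro x)) (leftHom m)) ≫ sq (hcomp c.unit c.counit) :=
    sq_hcomp_comp_eq ((Category.comp_id _).trans (Category.id_comp _).symm)
      (leftIso_naturality c.counit)
  have e₃ : sq (hcomp (leftInv (idPro x)) (vid m)) ≫ sq (hcomp (rightHom (idPro x)) (vid m)) =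
      𝟙 _ :=
    (sq_hcomp_comp (by rw [sq_leftInv, sq_rightHom, leftIso_idPro, Iso.inv_hom_id, sq_vid])
      (Category.id_comp (sq (vid m)))).trans (sq_hcomp_vid _ _)
  have e₄ := triangle_sq (idPro x) m
  rw [Companion.adjUnit, Companion.adjCounit,
    ← sq_hcomp_comp (sq_gcomp _ _).symm (Category.id_comp (sq (vid m))),
    ← sq_hcomp_comp (Category.id_comp (sq (vid m))) (sq_gcomp _ _).symm, Category.assoc,
    ← Category.assoc (sq (hcomp (hcomp _ _) _)), assocIso_naturality, Category.assoc,
    reassoc_of% e₁]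
  refine (congrArg (fun t => _ ≫ _ ≫ t) e₂).trans ?_
  rw [reassoc_of% e₄, reassoc_of% e₃, ← c.sq_external, Category.assoc, Iso.hom_inv_id,
    Category.comp_id]

theorem Companion.adj_right_triangle (c : Companion f m) (k : Conjoint f n) :
    sq (hcomp (vid n) (c.adjUnit k)) ≫ (assocIso n m n).inv ≫ sq (hcomp (c.adjCounit k) (vid n)) =
      (rightIso n).hom ≫ (leftIso n).inv := by
  have e₁ : sq (hcomp (hcomp (vid n) c.unit) k.unit) ≫
      sq (hcomp (hcomp k.counit c.counit) (vid n)) = sq (hcomp (hcomp k.counit (hid f)) k.unit) :=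
    sq_hcomp_comp (sq_hcomp_comp (Category.id_comp _) c.sq_internal) (Category.comp_id _)
  have e₂ : sq (hcomp (hcomp k.counit (hid f)) k.unit) ≫
      sq (hcomp (leftHom (idPro y)) (vid n)) =
      sq (hcomp (rightHom n) (vid (idPro x))) ≫ sq (hcomp k.counit k.unit) :=
    sq_hcomp_comp_eq (by
        rw [sq_leftHom, leftIso_idPro]
        exact rightIso_naturality k.counit)
      ((Category.comp_id _).trans (Category.id_comp _).symm)
  have e₃ : sq (hcomp (rightInv n) (vid (idPro x))) ≫ sq (hcomp (rightHom n) (vid (idPro x))) =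
      𝟙 _ :=
    (sq_hcomp_comp ((rightIso n).inv_hom_id.trans (sq_vid _).symm)
      (Category.id_comp (sq (vid (idPro x))))).trans (sq_hcomp_vid _ _)
  have e₄ := triangle_inv_sq n (idPro x)
  rw [Companion.adjUnit, Companion.adjCounit,
    ← sq_hcomp_comp (sq_gcomp _ _).symm (Category.id_comp (sq (vid n))),
    ← sq_hcomp_comp (Category.id_comp (sq (vid n))) (sq_gcomp _ _).symm, Category.assoc,
    ← Category.assoc (sq (hcomp _ (hcomp _ _))), assocIso_inv_naturality, Category.assoc,
    reassoc_of% e₁]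
  refine (congrArg (fun t => _ ≫ _ ≫ t) e₂).trans ?_
  rw [reassoc_of% e₄, reassoc_of% e₃, ← k.sq_external, Category.assoc, Iso.hom_inv_id,
    Category.comp_id]

end Adjunction

/-- A companion of an arrow is left adjoint to a conjoint of it. -/
def Companion.adjunction {x y : UnderlyingBicategory D} {f : x.obj ⟶ y.obj} {m : x ⟶ y} {n : y ⟶ x}
    (c : Companion f m) (k : Conjoint f n) : m ⊣ n where
  unit := c.adjUnit k
  counit := c.adjCounit k
  left_triangle := gsq_injective (by
    have e : leftZigzag (f := m) (g := n) (c.adjUnit k) (c.adjCounit k) =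
        gcomp (hcomp (c.adjUnit k) (vid m))
          (gcomp (assocHom m n m) (hcomp (vid m) (c.adjCounit k))) := by
      rw [leftZigzag]
      simp [bicategoricalComp]
      rfl
    rw [gsq_comp, e]
    refine Eq.trans ?_ (c.adj_left_triangle k)
    rw [← sq_assocHom, ← sq_gcomp, ← sq_gcomp]
    rfl)
  right_triangle := gsq_injective (by
    have e : rightZigzag (f := m) (g := n) (c.adjUnit k) (c.adjCounit k) =
        gcomp (hcomp (vid n) (c.adjUnit k))
          (gcomp (assocInv n m n) (hcomp (c.adjCounit k) (vid n))) := by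
      rw [rightZigzag]
      simp [bicategoricalComp]
      rfl
    rw [gsq_comp, e]
    refine Eq.trans ?_ (c.adj_right_triangle k)
    rw [← sq_assocInv, ← sq_gcomp, ← sq_gcomp]
    rfl)

/-! ### Companions of the structure arrows of products -/

/-- An arrow is transposable if it has a companion that is a map of the underlying bicategory. -/
def Transposable {x y : UnderlyingBicategory D} (f : x.obj ⟶ y.obj) : Prop :=
  ∃ m : x ⟶ y, Nonempty (Companion f m) ∧ Bicategory.IsLeftAdjoint m

theorem Transposable.of_conjoint {x y : UnderlyingBicategory D} {f : x.obj ⟶ y.obj} {m : x ⟶ y}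
    {n : y ⟶ x} (c : Companion f m) (k : Conjoint f n) : Transposable f :=
  ⟨m, ⟨c⟩, Bicategory.IsLeftAdjoint.mk (c.adjunction k)⟩

theorem Transposable.comp {x y t : UnderlyingBicategory D} {f : x.obj ⟶ y.obj} {g : y.obj ⟶ t.obj}
    (hf : Transposable f) (hg : Transposable g) {k : x.obj ⟶ t.obj} (h : f ≫ g = k) :
    Transposable k := by
  obtain ⟨m, ⟨cm⟩, hm⟩ := hf
  obtain ⟨n, ⟨cn⟩, hn⟩ := hg
  exact ⟨m ≫ n, ⟨cm.comp cn h⟩, Bicategory.IsLeftAdjoint.mk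
    ((Bicategory.Adjunction.ofIsLeftAdjoint m).comp (Bicategory.Adjunction.ofIsLeftAdjoint n))⟩

namespace LaxFiniteProducts

variable (P : LaxFiniteProducts D)

/-- Cells into a product of proarrows are determined by their boundary arrows and their
projections. -/
theorem hom_ext {I J A : Type} [Finite I] [Finite J] [Finite A] {x : I → D} {y : J → D}
    {l : A → I} {r : A → J} {m : ∀ a, Pro (x (l a)) (y (r a))} {s t : D} {p : Pro s t}
    {f : s ⟶ (P.fan x).pt} {g : t ⟶ (P.fan y).pt} {α β : Cell f g p (P.cone l r m).pro}
    (h : ∀ a, sq α ≫ sq ((P.cone l r m).proj a) = sq β ≫ sq ((P.cone l r m).proj a)) : α = β := by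
  obtain ⟨γ, -, hγ⟩ := P.isProduct l r m p f g
    (fun a => vcomp α ((P.cone l r m).proj a) rfl rfl)
  rw [hγ α fun _ => rfl, hγ β fun a => sq_injective (by rw [sq_vcomp, sq_vcomp, h])]

theorem exists_lift {I J A : Type} [Finite I] [Finite J] [Finite A] {x : I → D} {y : J → D}
    {l : A → I} {r : A → J} {m : ∀ a, Pro (x (l a)) (y (r a))} {s t : D} {p : Pro s t}
    (f : s ⟶ (P.fan x).pt) (g : t ⟶ (P.fan y).pt) {f' : ∀ a, s ⟶ x (l a)} {g' : ∀ a, t ⟶ y (r a)}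
    (α : ∀ a, Cell (f' a) (g' a) p (m a)) (hf : ∀ a, f' a = f ≫ (P.fan x).proj (l a))
    (hg : ∀ a, g' a = g ≫ (P.fan y).proj (r a)) :
    ∃ β : Cell f g p (P.cone l r m).pro, ∀ a, sq β ≫ sq ((P.cone l r m).proj a) = sq (α a) := by
  choose α' hα' using fun a => exists_sq_eq (α a) (hf a) (hg a)
  obtain ⟨β, hβ, -⟩ := P.isProduct l r m p f g α'
  exact ⟨β, fun a => by rw [← hα' a, ← hβ a, sq_vcomp]⟩

/-- The arrow between products that is induced by a map of index sets. -/
def reindex {I J : Type} [Finite I] [Finite J] (x : I → D) (φ : J → I) :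
    (P.fan x).pt ⟶ (P.fan fun j => x (φ j)).pt :=
  (P.isLimit fun j => x (φ j)).lift (Fan.mk _ fun j => (P.fan x).proj (φ j))

theorem reindex_proj {I J : Type} [Finite I] [Finite J] (x : I → D) (φ : J → I) (j : J) :
    P.reindex x φ ≫ (P.fan fun j => x (φ j)).proj j = (P.fan x).proj (φ j) :=
  (P.isLimit fun j => x (φ j)).fac _ ⟨j⟩

theorem arrow_ext {I : Type} [Finite I] {x : I → D} {s : D} {f g : s ⟶ (P.fan x).pt}
    (h : ∀ i, f ≫ (P.fan x).proj i = g ≫ (P.fan x).proj i) : f = g :=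
  (P.isLimit x).hom_ext fun ⟨i⟩ => h i

variable {P}

/-- In the iso-strong case, the external identity of a product is a product of external
identities: cells into it are determined by their projections. -/
theorem IsIsoStrong.hom_ext_idPro (hP : P.IsIsoStrong) {I : Type} [Finite I] {x : I → D} {s t : D}
    {p : Pro s t} {f : s ⟶ (P.fan x).pt} {g : t ⟶ (P.fan x).pt} {α β : Cell f g p (idPro _)}
    (h : ∀ i, sq α ≫ sq (hid ((P.fan x).proj i)) = sq β ≫ sq (hid ((P.fan x).proj i))) :
    α = β := by
  obtain ⟨κ, hκ⟩ := P.exists_lift (l := fun i : I => i) (r := fun i => i)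
    (m := fun i => idPro (x i)) (𝟙 _) (𝟙 _) (fun i => hid ((P.fan x).proj i))
    (fun _ => (Category.id_comp _).symm) (fun _ => (Category.id_comp _).symm)
  obtain ⟨κ', h₁, -⟩ := hP.unit x κ fun i => sq_injective (by rw [sq_vcomp, hκ])
  have h₁ : sq κ ≫ sq κ' = 𝟙 _ := by rw [← sq_gcomp, h₁, sq_vid]
  have hαβ : vcomp α κ (Category.comp_id _) (Category.comp_id _) =
      vcomp β κ (Category.comp_id _) (Category.comp_id _) := P.hom_ext fun i => by
    rw [sq_vcomp, sq_vcomp, Category.assoc, Category.assoc, hκ, h]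
  have hαβ := congrArg (sq · ≫ sq κ') hαβ
  simp only [sq_vcomp, Category.assoc, h₁, Category.comp_id] at hαβ
  exact sq_injective hαβ

theorem IsIsoStrong.exists_lift_idPro (hP : P.IsIsoStrong) {I : Type} [Finite I] {x : I → D}
    {s t : D} {p : Pro s t} (f : s ⟶ (P.fan x).pt) (g : t ⟶ (P.fan x).pt) {f' g' : ∀ i, _ ⟶ x i}
    (α : ∀ i, Cell (f' i) (g' i) p (idPro (x i))) (hf : ∀ i, f' i = f ≫ (P.fan x).proj i)
    (hg : ∀ i, g' i = g ≫ (P.fan x).proj i) :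
    ∃ β : Cell f g p (idPro _), ∀ i, sq β ≫ sq (hid ((P.fan x).proj i)) = sq (α i) := by
  obtain ⟨κ, hκ⟩ := P.exists_lift (l := fun i : I => i) (r := fun i => i)
    (m := fun i => idPro (x i)) (𝟙 _) (𝟙 _) (fun i => hid ((P.fan x).proj i))
    (fun _ => (Category.id_comp _).symm) (fun _ => (Category.id_comp _).symm)
  obtain ⟨κ', -, h₂⟩ := hP.unit x κ fun i => sq_injective (by rw [sq_vcomp, hκ])
  have h₂ : sq κ' ≫ sq κ = 𝟙 _ := by rw [← sq_gcomp, h₂, sq_vid]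
  obtain ⟨β, hβ⟩ := P.exists_lift (l := fun i : I => i) (r := fun i => i) f g α hf hg
  refine ⟨vcomp β κ' (Category.comp_id _) (Category.comp_id _), fun i => ?_⟩
  rw [sq_vcomp, ← hκ, Category.assoc, reassoc_of% h₂, hβ]

section Reindex

variable {I J : Type} [Finite I] [Finite J]

/-- The companion of a reindexing arrow `Π x → Π (x ∘ φ)` is the product of external identities
that is indexed by the span `I ←φ- J =id= J`. -/
theorem IsIsoStrong.nonempty_companion_reindex (hP : P.IsIsoStrong) (x : I → D) (φ : J → I) :
    Nonempty (Companion (P.reindex x φ)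
      (P.cone (y := fun j => x (φ j)) φ (fun j => j) fun j => idPro (x (φ j))).pro) := by
  set c := P.cone (x := x) (y := fun j => x (φ j)) φ (fun j => j) fun j => idPro (x (φ j))
  obtain ⟨u, hu⟩ := P.exists_lift (x := x) (y := fun j => x (φ j)) (l := φ) (r := fun j => j)
    (m := fun j => idPro (x (φ j))) (𝟙 _) (P.reindex x φ) (fun j => hid ((P.fan x).proj (φ j)))
    (fun _ => (Category.id_comp _).symm) (fun j => (P.reindex_proj x φ j).symm)
  obtain ⟨e, he⟩ := hP.exists_lift_idPro (x := fun j => x (φ j)) (P.reindex x φ) (𝟙 _)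
    c.proj (fun j => (P.reindex_proj x φ j).symm) (fun _ => (Category.id_comp _).symm)
  refine ⟨⟨u, e, ?_, ?_⟩⟩
  · refine P.hom_ext fun j => ?_
    rw [sq_gcomp, Category.assoc, sq_rightHom, ← rightIso_naturality, ← Category.assoc,
      sq_hcomp_comp (hu j) (he j), sq_leftHom, ← leftIso_naturality, leftIso_idPro]
  · refine hP.hom_ext_idPro (x := fun j => x (φ j)) fun j => ?_
    rw [sq_vcomp, Category.assoc, he, hu, ← sq_hid_comp, P.reindex_proj]

/-- The conjoint of a reindexing arrow `Π x → Π (x ∘ φ)` is the product of external identities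
that is indexed by the span `J =id= J -φ→ I`. -/
theorem IsIsoStrong.nonempty_conjoint_reindex (hP : P.IsIsoStrong) (x : I → D) (φ : J → I) :
    Nonempty (Conjoint (P.reindex x φ)
      (P.cone (x := fun j => x (φ j)) (fun j => j) φ fun j => idPro (x (φ j))).pro) := by
  set c := P.cone (x := fun j => x (φ j)) (y := x) (fun j => j) φ fun j => idPro (x (φ j))
  obtain ⟨u, hu⟩ := P.exists_lift (x := fun j => x (φ j)) (y := x) (l := fun j => j) (r := φ)
    (m := fun j => idPro (x (φ j))) (P.reindex x φ) (𝟙 _) (fun j => hid ((P.fan x).proj (φ j)))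
    (fun j => (P.reindex_proj x φ j).symm) (fun _ => (Category.id_comp _).symm)
  obtain ⟨e, he⟩ := hP.exists_lift_idPro (x := fun j => x (φ j)) (𝟙 _) (P.reindex x φ)
    c.proj (fun _ => (Category.id_comp _).symm) (fun j => (P.reindex_proj x φ j).symm)
  refine ⟨⟨u, e, ?_, ?_⟩⟩
  · refine P.hom_ext fun j => ?_
    rw [sq_gcomp, Category.assoc, sq_leftHom, ← leftIso_naturality, ← Category.assoc,
      sq_hcomp_comp (he j) (hu j), sq_rightHom, ← rightIso_naturality, leftIso_idPro]
  · refine hP.hom_ext_idPro (x := fun j => x (φ j)) fun j => ?_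
    rw [sq_vcomp, Category.assoc, he, hu, ← sq_hid_comp, P.reindex_proj]

theorem IsIsoStrong.transposable_reindex (hP : P.IsIsoStrong) (x : I → D) (φ : J → I) :
    Transposable (x := ⟨_⟩) (y := ⟨_⟩) (P.reindex x φ) :=
  .of_conjoint (hP.nonempty_companion_reindex x φ).some (hP.nonempty_conjoint_reindex x φ).some

end Reindex

/-- Any projection from a product is transposable, being the composite of a reindexing arrow and
the projection from the product of a one-member family. -/
theorem IsIsoStrong.transposable_proj (hP : P.IsIsoStrong) (hU : P.UnaryTransposable) {I : Type}
    [Finite I] (x : I → D) (i : I) : Transposable (x := ⟨_⟩) (y := ⟨_⟩) ((P.fan x).proj i) := by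
  obtain ⟨⟨_, ⟨c⟩⟩, ⟨_, ⟨k⟩⟩⟩ := hU (x i)
  exact (hP.transposable_reindex x fun _ : Unit => i).comp (.of_conjoint c k)
    (P.reindex_proj x (fun _ : Unit => i) ())

/-- Any arrow from `x` to a product of copies of `x` whose components are identities is
transposable, being the composite of the inverse of the projection from the product of a one-member
family and a reindexing arrow. -/
theorem IsIsoStrong.transposable_diag (hP : P.IsIsoStrong) (hU : P.UnaryTransposable) {J : Type}
    [Finite J] {x : D} (y : J → D) (hy : ∀ j, y j = x) (d : x ⟶ (P.fan y).pt)
    (hd : ∀ j, d ≫ (P.fan y).proj j = eqToHom (hy j).symm) :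
    Transposable (x := ⟨_⟩) (y := ⟨_⟩) d := by
  obtain rfl : y = fun _ => x := funext hy
  obtain ⟨⟨_, ⟨c⟩⟩, ⟨_, ⟨k⟩⟩⟩ := hU x
  set p := (P.fan fun _ : Unit => x).proj ()
  let e : x ⟶ (P.fan fun _ : Unit => x).pt :=
    (P.isLimit fun _ : Unit => x).lift (Fan.mk _ fun _ => 𝟙 x)
  have h₁ : e ≫ p = 𝟙 _ := (P.isLimit fun _ : Unit => x).fac _ ⟨()⟩
  have h₂ : p ≫ e = 𝟙 _ := P.arrow_ext fun ⟨⟩ => by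
    rw [Category.assoc, Category.id_comp]
    exact (congrArg (p ≫ ·) h₁).trans (Category.comp_id _)
  refine Transposable.comp (y := ⟨_⟩)
    (.of_conjoint (k.companionOfInverse h₂ h₁) (c.conjointOfInverse h₂ h₁))
    (hP.transposable_reindex (fun _ : Unit => x) fun _ : J => ()) (P.arrow_ext fun j => ?_)
  rw [Category.assoc, P.reindex_proj, hd]
  exact h₁

end LaxFiniteProducts

namespace LaxFiniteProducts

variable {P : LaxFiniteProducts D}

/-- In the iso-strong case, the external composite of two parallel products is a parallel product
of external composites: cells into it are determined by their projections. -/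
theorem IsIsoStrong.hom_ext_compPro (hP : P.IsIsoStrong) {I : Type} [Finite I] {x y t : I → D}
    {m : ∀ i, Pro (x i) (y i)} {n : ∀ i, Pro (y i) (t i)} {a b : D} {p : Pro a b}
    {f : a ⟶ (P.fan x).pt} {g : b ⟶ (P.fan t).pt}
    {α β : Cell f g p (compPro (P.parallel m).pro (P.parallel n).pro)}
    (h : ∀ i, sq α ≫ sq (hcomp ((P.parallel m).proj i) ((P.parallel n).proj i)) =
      sq β ≫ sq (hcomp ((P.parallel m).proj i) ((P.parallel n).proj i))) : α = β := by
  obtain ⟨κ, hκ⟩ := P.exists_lift (l := fun i : I => i) (r := fun i => i)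
    (m := fun i => compPro (m i) (n i)) (𝟙 _) (𝟙 _)
    (fun i => hcomp ((P.parallel m).proj i) ((P.parallel n).proj i))
    (fun _ => (Category.id_comp _).symm) (fun _ => (Category.id_comp _).symm)
  obtain ⟨κ', h₁, -⟩ := hP.comp m n κ fun i => sq_injective (by rw [sq_vcomp, hκ])
  have h₁ : sq κ ≫ sq κ' = 𝟙 _ := by rw [← sq_gcomp, h₁, sq_vid]
  have hαβ : vcomp α κ (Category.comp_id _) (Category.comp_id _) =
      vcomp β κ (Category.comp_id _) (Category.comp_id _) := P.hom_ext fun i => by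
    rw [sq_vcomp, sq_vcomp, Category.assoc, Category.assoc, hκ, h]
  have hαβ := congrArg (sq · ≫ sq κ') hαβ
  simp only [sq_vcomp, Category.assoc, h₁, Category.comp_id] at hαβ
  exact sq_injective hαβ

theorem IsIsoStrong.exists_lift_compPro (hP : P.IsIsoStrong) {I : Type} [Finite I] {x y t : I → D}
    {m : ∀ i, Pro (x i) (y i)} {n : ∀ i, Pro (y i) (t i)} {a b : D} {p : Pro a b}
    (f : a ⟶ (P.fan x).pt) (g : b ⟶ (P.fan t).pt) {f' : ∀ i, a ⟶ x i} {g' : ∀ i, b ⟶ t i}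
    (α : ∀ i, Cell (f' i) (g' i) p (compPro (m i) (n i))) (hf : ∀ i, f' i = f ≫ (P.fan x).proj i)
    (hg : ∀ i, g' i = g ≫ (P.fan t).proj i) :
    ∃ β : Cell f g p (compPro (P.parallel m).pro (P.parallel n).pro),
      ∀ i, sq β ≫ sq (hcomp ((P.parallel m).proj i) ((P.parallel n).proj i)) = sq (α i) := by
  obtain ⟨κ, hκ⟩ := P.exists_lift (l := fun i : I => i) (r := fun i => i)
    (m := fun i => compPro (m i) (n i)) (𝟙 _) (𝟙 _)
    (fun i => hcomp ((P.parallel m).proj i) ((P.parallel n).proj i))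
    (fun _ => (Category.id_comp _).symm) (fun _ => (Category.id_comp _).symm)
  obtain ⟨κ', -, h₂⟩ := hP.comp m n κ fun i => sq_injective (by rw [sq_vcomp, hκ])
  have h₂ : sq κ' ≫ sq κ = 𝟙 _ := by rw [← sq_gcomp, h₂, sq_vid]
  obtain ⟨β, hβ⟩ := P.exists_lift (l := fun i : I => i) (r := fun i => i) f g α hf hg
  refine ⟨vcomp β κ' (Category.comp_id _) (Category.comp_id _), fun i => ?_⟩
  rw [sq_vcomp, ← hκ, Category.assoc, reassoc_of% h₂, hβ]

/-! ### Binary products -/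

section Binary

/-- A pair of objects as a family indexed by `Bool`. -/
def pairObj (p : UnderlyingBicategory D × UnderlyingBicategory D) : Bool → D
  | true => p.1.obj
  | false => p.2.obj

/-- A pair of proarrows as a family indexed by `Bool`. -/
def pairPro {p q : UnderlyingBicategory D × UnderlyingBicategory D} (m : p ⟶ q) :
    ∀ b : Bool, Pro (pairObj p b) (pairObj q b)
  | true => m.1
  | false => m.2

variable {p q r : UnderlyingBicategory D × UnderlyingBicategory D}

/-- A binary fan as a fan over a family indexed by `Bool`. -/
def pairFan (s : BinaryFan p.1.obj p.2.obj) : Fan (pairObj p) :=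
  Fan.mk s.pt fun
    | true => s.fst
    | false => s.snd

variable (P) in
/-- The first projection from a binary product of objects. -/
def fst (p : UnderlyingBicategory D × UnderlyingBicategory D) :
    (P.fan (pairObj p)).pt ⟶ p.1.obj :=
  (P.fan (pairObj p)).proj true

variable (P) in
/-- The second projection from a binary product of objects. -/
def snd (p : UnderlyingBicategory D × UnderlyingBicategory D) :
    (P.fan (pairObj p)).pt ⟶ p.2.obj :=
  (P.fan (pairObj p)).proj false

variable (P) in
/-- The first projection from a binary product of proarrows. -/
def fstCell (m : p ⟶ q) : Cell (P.fst p) (P.fst q) (P.parallel (pairPro m)).pro m.1 :=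
  (P.parallel (pairPro m)).proj true

variable (P) in
/-- The second projection from a binary product of proarrows. -/
def sndCell (m : p ⟶ q) : Cell (P.snd p) (P.snd q) (P.parallel (pairPro m)).pro m.2 :=
  (P.parallel (pairPro m)).proj false

section

variable {s t : D} {n : Pro s t} {f : s ⟶ (P.fan (pairObj p)).pt} {g : t ⟶ (P.fan (pairObj q)).pt}

theorem pair_hom_ext {m : p ⟶ q} {α β : Cell f g n (P.parallel (pairPro m)).pro}
    (h₁ : sq α ≫ sq (P.fstCell m) = sq β ≫ sq (P.fstCell m))
    (h₂ : sq α ≫ sq (P.sndCell m) = sq β ≫ sq (P.sndCell m)) : α = β :=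
  P.hom_ext fun
    | true => h₁
    | false => h₂

theorem exists_lift_pair (m : p ⟶ q) (f : s ⟶ (P.fan (pairObj p)).pt)
    (g : t ⟶ (P.fan (pairObj q)).pt) {f₁ f₂ g₁ g₂} (α : Cell f₁ g₁ n m.1) (β : Cell f₂ g₂ n m.2)
    (hf₁ : f₁ = f ≫ P.fst p) (hf₂ : f₂ = f ≫ P.snd p) (hg₁ : g₁ = g ≫ P.fst q)
    (hg₂ : g₂ = g ≫ P.snd q) :
    ∃ γ : Cell f g n (P.parallel (pairPro m)).pro,
      sq γ ≫ sq (P.fstCell m) = sq α ∧ sq γ ≫ sq (P.sndCell m) = sq β := by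
  subst hf₁ hf₂ hg₁ hg₂
  obtain ⟨γ, hγ⟩ := P.exists_lift (m := pairPro m) f g
    (f' := fun b => f ≫ (P.fan (pairObj p)).proj b) (g' := fun b => g ≫ (P.fan (pairObj q)).proj b)
    (fun
      | true => α
      | false => β) (fun _ => rfl) (fun _ => rfl)
  exact ⟨γ, hγ true, hγ false⟩

theorem IsIsoStrong.pair_hom_ext_idPro (hP : P.IsIsoStrong) {g : t ⟶ (P.fan (pairObj p)).pt}
    {α β : Cell f g n (idPro _)}
    (h₁ : sq α ≫ sq (hid (P.fst p)) = sq β ≫ sq (hid (P.fst p)))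
    (h₂ : sq α ≫ sq (hid (P.snd p)) = sq β ≫ sq (hid (P.snd p))) : α = β :=
  hP.hom_ext_idPro fun
    | true => h₁
    | false => h₂

theorem IsIsoStrong.exists_lift_pair_idPro (hP : P.IsIsoStrong) (f : s ⟶ (P.fan (pairObj p)).pt)
    (g : t ⟶ (P.fan (pairObj p)).pt) {f₁ f₂ g₁ g₂} (α : Cell f₁ g₁ n (idPro p.1.obj))
    (β : Cell f₂ g₂ n (idPro p.2.obj))
    (hf₁ : f₁ = f ≫ P.fst p) (hf₂ : f₂ = f ≫ P.snd p) (hg₁ : g₁ = g ≫ P.fst p)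
    (hg₂ : g₂ = g ≫ P.snd p) :
    ∃ γ : Cell f g n (idPro _),
      sq γ ≫ sq (hid (P.fst p)) = sq α ∧ sq γ ≫ sq (hid (P.snd p)) = sq β := by
  subst hf₁ hf₂ hg₁ hg₂
  obtain ⟨γ, hγ⟩ := hP.exists_lift_idPro f g
    (f' := fun b => f ≫ (P.fan (pairObj p)).proj b) (g' := fun b => g ≫ (P.fan (pairObj p)).proj b)
    (fun
      | true => α
      | false => β) (fun _ => rfl) (fun _ => rfl)
  exact ⟨γ, hγ true, hγ false⟩

theorem IsIsoStrong.pair_hom_ext_compPro (hP : P.IsIsoStrong) {m : p ⟶ r} {m' : r ⟶ q}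
    {α β : Cell f g n (compPro (P.parallel (pairPro m)).pro (P.parallel (pairPro m')).pro)}
    (h₁ : sq α ≫ sq (hcomp (P.fstCell m) (P.fstCell m')) =
      sq β ≫ sq (hcomp (P.fstCell m) (P.fstCell m')))
    (h₂ : sq α ≫ sq (hcomp (P.sndCell m) (P.sndCell m')) =
      sq β ≫ sq (hcomp (P.sndCell m) (P.sndCell m'))) : α = β :=
  hP.hom_ext_compPro fun
    | true => h₁
    | false => h₂

theorem IsIsoStrong.exists_lift_pair_compPro (hP : P.IsIsoStrong) (m : p ⟶ r) (m' : r ⟶ q)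
    (f : s ⟶ (P.fan (pairObj p)).pt) (g : t ⟶ (P.fan (pairObj q)).pt) {f₁ f₂ g₁ g₂}
    (α : Cell f₁ g₁ n (compPro m.1 m'.1)) (β : Cell f₂ g₂ n (compPro m.2 m'.2))
    (hf₁ : f₁ = f ≫ P.fst p) (hf₂ : f₂ = f ≫ P.snd p) (hg₁ : g₁ = g ≫ P.fst q)
    (hg₂ : g₂ = g ≫ P.snd q) :
    ∃ γ : Cell f g n (compPro (P.parallel (pairPro m)).pro (P.parallel (pairPro m')).pro),
      sq γ ≫ sq (hcomp (P.fstCell m) (P.fstCell m')) = sq α ∧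
        sq γ ≫ sq (hcomp (P.sndCell m) (P.sndCell m')) = sq β := by
  subst hf₁ hf₂ hg₁ hg₂
  obtain ⟨γ, hγ⟩ := hP.exists_lift_compPro (m := pairPro m) (n := pairPro m') f g
    (f' := fun b => f ≫ (P.fan (pairObj p)).proj b) (g' := fun b => g ≫ (P.fan (pairObj q)).proj b)
    (fun
      | true => α
      | false => β) (fun _ => rfl) (fun _ => rfl)
  exact ⟨γ, hγ true, hγ false⟩

end

theorem exists_tensorMap₂ {m n : p ⟶ q} (α : m ⟶ n) :
    ∃ γ : Cell (𝟙 _) (𝟙 _) (P.parallel (pairPro m)).pro (P.parallel (pairPro n)).pro,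
      sq γ ≫ sq (P.fstCell n) = sq (P.fstCell m) ≫ gsq α.1 ∧
        sq γ ≫ sq (P.sndCell n) = sq (P.sndCell m) ≫ gsq α.2 := by
  obtain ⟨γ, h₁, h₂⟩ := P.exists_lift_pair n (𝟙 _) (𝟙 _)
    (vcomp (P.fstCell m) α.1 (Category.comp_id _) (Category.comp_id _))
    (vcomp (P.sndCell m) α.2 (Category.comp_id _) (Category.comp_id _))
    (Category.id_comp _).symm (Category.id_comp _).symm (Category.id_comp _).symm
    (Category.id_comp _).symm
  exact ⟨γ, h₁.trans (sq_vcomp _ _ _ _), h₂.trans (sq_vcomp _ _ _ _)⟩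

/-- The product of a pair of 2-cells. -/
noncomputable def tensorMap₂ {m n : p ⟶ q} (α : m ⟶ n) :
    Cell (𝟙 _) (𝟙 _) (P.parallel (pairPro m)).pro (P.parallel (pairPro n)).pro :=
  (P.exists_tensorMap₂ α).choose

theorem tensorMap₂_fst {m n : p ⟶ q} (α : m ⟶ n) :
    sq (P.tensorMap₂ α) ≫ sq (P.fstCell n) = sq (P.fstCell m) ≫ gsq α.1 :=
  (P.exists_tensorMap₂ α).choose_spec.1

theorem tensorMap₂_snd {m n : p ⟶ q} (α : m ⟶ n) :
    sq (P.tensorMap₂ α) ≫ sq (P.sndCell n) = sq (P.sndCell m) ≫ gsq α.2 :=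
  (P.exists_tensorMap₂ α).choose_spec.2

variable (P)

theorem exists_tensorId (p : UnderlyingBicategory D × UnderlyingBicategory D) :
    ∃ γ : Cell (𝟙 _) (𝟙 _) (idPro _) (P.parallel (pairPro (𝟙 p))).pro,
      sq γ ≫ sq (P.fstCell (𝟙 p)) = sq (hid (P.fst p)) ∧
        sq γ ≫ sq (P.sndCell (𝟙 p)) = sq (hid (P.snd p)) :=
  P.exists_lift_pair (𝟙 p) (𝟙 _) (𝟙 _) (hid (P.fst p)) (hid (P.snd p))
    (Category.id_comp _).symm (Category.id_comp _).symm (Category.id_comp _).symm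
    (Category.id_comp _).symm

/-- The comparison of binary products with external identities. -/
noncomputable def tensorId (p : UnderlyingBicategory D × UnderlyingBicategory D) :
    Cell (𝟙 _) (𝟙 _) (idPro _) (P.parallel (pairPro (𝟙 p))).pro :=
  (P.exists_tensorId p).choose

theorem tensorId_fst (p : UnderlyingBicategory D × UnderlyingBicategory D) :
    sq (P.tensorId p) ≫ sq (P.fstCell (𝟙 p)) = sq (hid (P.fst p)) :=
  (P.exists_tensorId p).choose_spec.1

theorem tensorId_snd (p : UnderlyingBicategory D × UnderlyingBicategory D) :
    sq (P.tensorId p) ≫ sq (P.sndCell (𝟙 p)) = sq (hid (P.snd p)) :=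
  (P.exists_tensorId p).choose_spec.2

theorem exists_tensorComp (m : p ⟶ q) (n : q ⟶ r) :
    ∃ γ : Cell (𝟙 _) (𝟙 _) (compPro (P.parallel (pairPro m)).pro (P.parallel (pairPro n)).pro)
        (P.parallel (pairPro (m ≫ n))).pro,
      sq γ ≫ sq (P.fstCell (m ≫ n)) = sq (hcomp (P.fstCell m) (P.fstCell n)) ∧
        sq γ ≫ sq (P.sndCell (m ≫ n)) = sq (hcomp (P.sndCell m) (P.sndCell n)) :=
  P.exists_lift_pair (m ≫ n) (𝟙 _) (𝟙 _) (hcomp (P.fstCell m) (P.fstCell n))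
    (hcomp (P.sndCell m) (P.sndCell n))
    (Category.id_comp _).symm (Category.id_comp _).symm (Category.id_comp _).symm
    (Category.id_comp _).symm

/-- The comparison of binary products with external composition. -/
noncomputable def tensorComp (m : p ⟶ q) (n : q ⟶ r) :
    Cell (𝟙 _) (𝟙 _) (compPro (P.parallel (pairPro m)).pro (P.parallel (pairPro n)).pro)
      (P.parallel (pairPro (m ≫ n))).pro :=
  (P.exists_tensorComp m n).choose

theorem tensorComp_fst (m : p ⟶ q) (n : q ⟶ r) :
    sq (P.tensorComp m n) ≫ sq (P.fstCell (m ≫ n)) = sq (hcomp (P.fstCell m) (P.fstCell n)) :=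
  (P.exists_tensorComp m n).choose_spec.1

theorem tensorComp_snd (m : p ⟶ q) (n : q ⟶ r) :
    sq (P.tensorComp m n) ≫ sq (P.sndCell (m ≫ n)) = sq (hcomp (P.sndCell m) (P.sndCell n)) :=
  (P.exists_tensorComp m n).choose_spec.2

/-- The lax functor that sends pairs of proarrows to their products. -/
noncomputable def tensorLax :
    LaxFunctor (UnderlyingBicategory D × UnderlyingBicategory D) (UnderlyingBicategory D) where
  obj p := ⟨(P.fan (pairObj p)).pt⟩
  map m := (P.parallel (pairPro m)).pro
  map₂ α := P.tensorMap₂ α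
  map₂_id m := P.pair_hom_ext
    ((P.tensorMap₂_fst (𝟙 m)).trans ((Category.comp_id _).trans (Category.id_comp _).symm))
    ((P.tensorMap₂_snd (𝟙 m)).trans ((Category.comp_id _).trans (Category.id_comp _).symm))
  map₂_comp {p q m n k} α β := by
    change P.tensorMap₂ (α ≫ β) = gcomp (P.tensorMap₂ α) (P.tensorMap₂ β)
    apply P.pair_hom_ext
    · rw [sq_gcomp, Category.assoc, tensorMap₂_fst, tensorMap₂_fst, ← Category.assoc,
        tensorMap₂_fst, Category.assoc]
      exact congrArg (_ ≫ ·) (gsq_comp α.1 β.1)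
    · rw [sq_gcomp, Category.assoc, tensorMap₂_snd, tensorMap₂_snd, ← Category.assoc,
        tensorMap₂_snd, Category.assoc]
      exact congrArg (_ ≫ ·) (gsq_comp α.2 β.2)
  mapId p := P.tensorId p
  mapComp m n := P.tensorComp m n
  mapComp_naturality_left {p q r m m'} α n := by
    change gcomp (P.tensorComp m n) (P.tensorMap₂ (α ▷ n)) =
      gcomp (hcomp (P.tensorMap₂ α) (vid _)) (P.tensorComp m' n)
    apply P.pair_hom_ext
    · rw [sq_gcomp, sq_gcomp, Category.assoc, Category.assoc, tensorComp_fst, tensorMap₂_fst,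
        ← Category.assoc, tensorComp_fst]
      exact sq_hcomp_comp_eq (P.tensorMap₂_fst α).symm
        ((Category.comp_id _).trans (Category.id_comp _).symm)
    · rw [sq_gcomp, sq_gcomp, Category.assoc, Category.assoc, tensorComp_snd, tensorMap₂_snd,
        ← Category.assoc, tensorComp_snd]
      exact sq_hcomp_comp_eq (P.tensorMap₂_snd α).symm
        ((Category.comp_id _).trans (Category.id_comp _).symm)
  mapComp_naturality_right {p q r} m n n' β := by
    change gcomp (P.tensorComp m n) (P.tensorMap₂ (m ◁ β)) =
      gcomp (hcomp (vid _) (P.tensorMap₂ β)) (P.tensorComp m n')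
    apply P.pair_hom_ext
    · rw [sq_gcomp, sq_gcomp, Category.assoc, Category.assoc, tensorComp_fst, tensorMap₂_fst,
        ← Category.assoc, tensorComp_fst]
      exact sq_hcomp_comp_eq ((Category.comp_id _).trans (Category.id_comp _).symm)
        (P.tensorMap₂_fst β).symm
    · rw [sq_gcomp, sq_gcomp, Category.assoc, Category.assoc, tensorComp_snd, tensorMap₂_snd,
        ← Category.assoc, tensorComp_snd]
      exact sq_hcomp_comp_eq ((Category.comp_id _).trans (Category.id_comp _).symm)
        (P.tensorMap₂_snd β).symm
  map₂_associator {p q r s} m n k := by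
    change gcomp (hcomp (P.tensorComp m n) (vid _))
        (gcomp (P.tensorComp (m ≫ n) k) (P.tensorMap₂ (α_ m n k).hom)) =
      gcomp (assocHom _ _ _) (gcomp (hcomp (vid _) (P.tensorComp n k)) (P.tensorComp m (n ≫ k)))
    apply P.pair_hom_ext
    · simp only [sq_gcomp, Category.assoc]
      rw [tensorComp_fst, tensorMap₂_fst, ← Category.assoc (sq (P.tensorComp (m ≫ n) k)),
        tensorComp_fst, ← Category.assoc, sq_hcomp_comp (P.tensorComp_fst m n)
        (Category.id_comp (sq (P.fstCell k))), sq_hcomp_comp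
        (Category.id_comp (sq (P.fstCell m))) (P.tensorComp_fst n k)]
      exact assocIso_naturality _ _ _
    · simp only [sq_gcomp, Category.assoc]
      rw [tensorComp_snd, tensorMap₂_snd, ← Category.assoc (sq (P.tensorComp (m ≫ n) k)),
        tensorComp_snd, ← Category.assoc, sq_hcomp_comp (P.tensorComp_snd m n)
        (Category.id_comp (sq (P.sndCell k))), sq_hcomp_comp
        (Category.id_comp (sq (P.sndCell m))) (P.tensorComp_snd n k)]
      exact assocIso_naturality _ _ _
  map₂_leftUnitor {p q} m := by
    change P.tensorMap₂ (λ_ m).inv = gcomp (leftInv _) (gcomp (hcomp (P.tensorId p) (vid _))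
      (P.tensorComp (𝟙 p) m))
    apply P.pair_hom_ext
    · simp only [sq_gcomp, Category.assoc]
      rw [tensorMap₂_fst, tensorComp_fst, sq_hcomp_comp (P.tensorId_fst p)
        (Category.id_comp (sq (P.fstCell m)))]
      exact leftIso_inv_naturality _
    · simp only [sq_gcomp, Category.assoc]
      rw [tensorMap₂_snd, tensorComp_snd, sq_hcomp_comp (P.tensorId_snd p)
        (Category.id_comp (sq (P.sndCell m)))]
      exact leftIso_inv_naturality _
  map₂_rightUnitor {p q} m := by
    change P.tensorMap₂ (ρ_ m).inv = gcomp (rightInv _) (gcomp (hcomp (vid _) (P.tensorId q))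
      (P.tensorComp m (𝟙 q)))
    apply P.pair_hom_ext
    · simp only [sq_gcomp, Category.assoc]
      rw [tensorMap₂_fst, tensorComp_fst, sq_hcomp_comp (Category.id_comp (sq (P.fstCell m)))
        (P.tensorId_fst q)]
      exact rightIso_inv_naturality _
    · simp only [sq_gcomp, Category.assoc]
      rw [tensorMap₂_snd, tensorComp_snd, sq_hcomp_comp (Category.id_comp (sq (P.sndCell m)))
        (P.tensorId_snd q)]
      exact rightIso_inv_naturality _

variable {P}

theorem IsIsoStrong.isIso_tensorLax_mapId (hP : P.IsIsoStrong)
    (p : UnderlyingBicategory D × UnderlyingBicategory D) : IsIso (P.tensorLax.mapId p) := by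
  obtain ⟨γ, h₁, h₂⟩ := hP.exists_lift_pair_idPro (p := p) (𝟙 _) (𝟙 _) (P.fstCell (𝟙 p))
    (P.sndCell (𝟙 p)) (Category.id_comp _).symm (Category.id_comp _).symm (Category.id_comp _).symm
    (Category.id_comp _).symm
  refine ⟨γ, ?_, ?_⟩
  · change gcomp (P.tensorId p) γ = vid _
    apply hP.pair_hom_ext_idPro
    · rw [sq_gcomp, Category.assoc, h₁, sq_vid, Category.id_comp, tensorId_fst]
    · rw [sq_gcomp, Category.assoc, h₂, sq_vid, Category.id_comp, tensorId_snd]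
  · change gcomp γ (P.tensorId p) = vid _
    apply P.pair_hom_ext
    · rw [sq_gcomp, Category.assoc, tensorId_fst, sq_vid, Category.id_comp]
      exact h₁
    · rw [sq_gcomp, Category.assoc, tensorId_snd, sq_vid, Category.id_comp]
      exact h₂

theorem IsIsoStrong.isIso_tensorLax_mapComp (hP : P.IsIsoStrong) (m : p ⟶ q) (n : q ⟶ r) :
    IsIso (P.tensorLax.mapComp m n) := by
  obtain ⟨γ, h₁, h₂⟩ := hP.exists_lift_pair_compPro m n (𝟙 _) (𝟙 _) (P.fstCell (m ≫ n))
    (P.sndCell (m ≫ n)) (Category.id_comp _).symm (Category.id_comp _).symm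
    (Category.id_comp _).symm (Category.id_comp _).symm
  refine ⟨γ, ?_, ?_⟩
  · change gcomp (P.tensorComp m n) γ = vid _
    apply hP.pair_hom_ext_compPro
    · rw [sq_gcomp, Category.assoc, h₁, sq_vid, Category.id_comp, tensorComp_fst]
    · rw [sq_gcomp, Category.assoc, h₂, sq_vid, Category.id_comp, tensorComp_snd]
  · change gcomp γ (P.tensorComp m n) = vid _
    apply P.pair_hom_ext
    · rw [sq_gcomp, Category.assoc, tensorComp_fst, sq_vid, Category.id_comp]
      exact h₁
    · rw [sq_gcomp, Category.assoc, tensorComp_snd, sq_vid, Category.id_comp]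
      exact h₂

/-- The pseudofunctor that sends pairs of proarrows to their products. -/
noncomputable def IsIsoStrong.tensor (hP : P.IsIsoStrong) :
    UnderlyingBicategory D × UnderlyingBicategory D ⥤ᵖ UnderlyingBicategory D :=
  have := hP.isIso_tensorLax_mapId
  have := fun {p q r} m n => hP.isIso_tensorLax_mapComp (p := p) (q := q) (r := r) m n
  Pseudofunctor.mkOfLax' P.tensorLax

/-- Binary products of objects and of proarrows make up a right adjoint of the diagonal double
functor. -/
noncomputable def IsIsoStrong.binaryDoubleProduct (hP : P.IsIsoStrong) :
    BinaryDoubleProduct hP.tensor where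
  fst := P.fst
  snd := P.snd
  isLimit p := BinaryFan.isLimitMk
    (fun s => (P.isLimit (pairObj p)).lift (pairFan s))
    (fun s => (P.isLimit (pairObj p)).fac (pairFan s) ⟨true⟩)
    (fun s => (P.isLimit (pairObj p)).fac (pairFan s) ⟨false⟩)
    (fun s m h₁ h₂ => P.arrow_ext fun
      | true => h₁.trans ((P.isLimit (pairObj p)).fac (pairFan s) ⟨true⟩).symm
      | false => h₂.trans ((P.isLimit (pairObj p)).fac (pairFan s) ⟨false⟩).symm)
  fstCell := P.fstCell
  sndCell := P.sndCell
  existsUnique m _ _ n f g α β := by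
    obtain ⟨γ, h₁, h₂⟩ := P.exists_lift_pair m f g α β rfl rfl rfl rfl
    refine ⟨γ, ⟨sq_injective ((sq_vcomp _ _ _ _).trans h₁),
      sq_injective ((sq_vcomp _ _ _ _).trans h₂)⟩, fun γ' h => P.pair_hom_ext ?_ ?_⟩
    · rw [h₁, ← h.1]
      exact (sq_vcomp _ _ _ _).symm
    · rw [h₂, ← h.2]
      exact (sq_vcomp _ _ _ _).symm
  map₂_fst α := sq_injective ((sq_vcomp _ _ _ _).trans
    ((P.tensorMap₂_fst α).trans (sq_vcomp _ _ _ _).symm))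
  map₂_snd α := sq_injective ((sq_vcomp _ _ _ _).trans
    ((P.tensorMap₂_snd α).trans (sq_vcomp _ _ _ _).symm))
  mapId_fst p := sq_injective ((sq_vcomp _ _ _ _).trans (P.tensorId_fst p))
  mapId_snd p := sq_injective ((sq_vcomp _ _ _ _).trans (P.tensorId_snd p))
  mapComp_fst m n := sq_injective ((sq_vcomp _ _ _ _).trans (P.tensorComp_fst m n))
  mapComp_snd m n := sq_injective ((sq_vcomp _ _ _ _).trans (P.tensorComp_snd m n))

end Binary

end LaxFiniteProducts

/-! ### Coherence of sliding -/

section Slide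

variable {x y t x' y' t' : D} {f : x ⟶ x'} {g : y ⟶ y'} {h : t ⟶ t'}
  {n₂ : Pro x x'} {n₁ : Pro y y'} {n₀ : Pro t t'}

/-- Slid cells satisfy the naturality axiom of an oplax transformation for 2-cells. -/
theorem slide_naturality (cf : Companion f n₂) (cg : Companion g n₁) {m p : Pro x y}
    {m' p' : Pro x' y'} {α : Cell f g m m'} {β : Cell f g p p'} {γ : Cell (𝟙 x) (𝟙 y) m p}
    {γ' : Cell (𝟙 x') (𝟙 y') m' p'} (h : sq γ ≫ sq β = sq α ≫ sq γ') :
    gcomp (hcomp γ (vid n₁)) (slide cf cg β) = gcomp (slide cf cg α) (hcomp (vid n₂) γ') :=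
  Represents.eq (c := cg)
    ((represents_slide cf cg β).whiskerRight_comp γ
      (sq_vcomp γ β (Category.id_comp _) (Category.id_comp _)).symm)
    ((represents_slide cf cg α).comp_whiskerLeft γ' (h.symm.trans (sq_vcomp _ _ _ _).symm))

/-- Slid cells satisfy the axiom of an oplax transformation for identities; `a` and `b` stand for
the comparison 2-cells of the two functors. -/
theorem slide_id (c : Companion f n₂) {m : Pro x x} {m' : Pro x' x'} {α : Cell f f m m'}
    {a : Cell (𝟙 x) (𝟙 x) m (idPro x)} {b : Cell (𝟙 x') (𝟙 x') m' (idPro x')}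
    (h : sq α ≫ sq b = sq a ≫ sq (hid f)) :
    gcomp (slide c c α) (hcomp (vid n₂) b) =
      gcomp (hcomp a (vid n₂)) (gcomp (leftHom n₂) (rightInv n₂)) :=
  Represents.eq (c := c)
    ((represents_slide c c α).comp_whiskerLeft b
      (sq_vcomp α b (Category.comp_id _) (Category.comp_id _)).symm)
    ((represents_hid c.unit).whiskerRight_comp a (h.symm.trans (sq_vcomp _ _ _ _).symm))

/-- Slid cells satisfy the axiom of an oplax transformation for composites; `a` and `b` stand for
the comparison 2-cells of the two functors. -/
theorem slide_comp (cf : Companion f n₂) (cg : Companion g n₁) (ch : Companion h n₀)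
    {m : Pro x y} {p : Pro y t} {m' : Pro x' y'} {p' : Pro y' t'} {q : Pro x t} {q' : Pro x' t'}
    {α : Cell f g m m'} {β : Cell g h p p'} {γ : Cell f h q q'}
    {a : Cell (𝟙 x) (𝟙 t) q (compPro m p)} {b : Cell (𝟙 x') (𝟙 t') q' (compPro m' p')}
    (e : sq γ ≫ sq b = sq a ≫ sq (hcomp α β)) :
    gcomp (slide cf ch γ) (hcomp (vid n₂) b) =
      gcomp (hcomp a (vid n₀)) (gcomp (assocHom m p n₀) (gcomp (hcomp (vid m) (slide cg ch β))
        (gcomp (assocInv m n₁ p') (gcomp (hcomp (slide cf cg α) (vid p'))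
          (assocHom n₂ m' p'))))) :=
  Represents.eq (c := ch)
    ((represents_slide cf ch γ).comp_whiskerLeft b
      (sq_vcomp γ b (Category.comp_id _) (Category.comp_id _)).symm)
    (((represents_slide cf cg α).hcomp (represents_slide cg ch β)).whiskerRight_comp a
      (e.symm.trans (sq_vcomp _ _ _ _).symm))

/-- The external identity of `x` is a companion of the identity of `x`. -/
def Companion.id (x : D) : Companion (𝟙 x) (idPro x) :=
  .mkOfExt (vid _) (vid _) (by rw [sq_hid_id, sq_vid, Category.id_comp]) fun X Y h => by
    rw [sq_vid, Category.id_comp, Category.id_comp] at h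
    exact sq_injective h

/-- If `X` corresponds to the identity cell of `m` by sliding with respect to companions of
identities, then the units of these companions satisfy the modification axiom with respect
to `X`. -/
theorem modification_of_represents {m : Pro x y} {n : Pro x x} {n' : Pro y y}
    {γ : Cell (𝟙 x) (𝟙 x) (idPro x) n} {γ' : Cell (𝟙 y) (𝟙 y) (idPro y) n'}
    {X : Cell (𝟙 x) (𝟙 y) (compPro m n') (compPro n m)} (hX : Represents γ γ' (vid m) X) :
    gcomp (hcomp (vid m) γ') X = gcomp (gcomp (rightHom m) (leftInv m)) (hcomp γ (vid m)) :=
  Represents.eq (c := Companion.id y)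
    (hX.whiskerLeft_comp γ' (Category.id_comp _))
    ((represents_vid m).comp_whiskerRight γ (Category.id_comp _))

theorem insertRight_comp_hcomp {m : Pro x y} {m' : Pro x' y'} {n : Pro y t} {n' : Pro y' t'}
    {k : y ⟶ t} {k' : y' ⟶ t'} {α : Cell f g m m'} {β : Cell g h n n'}
    {v : Cell (𝟙 y) k (idPro y) n} {v' : Cell (𝟙 y') k' (idPro y') n'}
    (e : sq v ≫ sq β = sq (hid g) ≫ sq v') :
    sq (insertRight m v) ≫ sq (hcomp α β) = sq α ≫ sq (insertRight m' v') := by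
  have e' := (sq_vcomp (hid g) v' (Category.comp_id _) rfl).symm
  rw [comp_sq_insertRight α v' e', sq_insertRight, Category.assoc,
    sq_hcomp_comp (Category.id_comp (sq α)) (e.trans e')]

theorem insertLeft_comp_hcomp {s s' : D} {b : x ⟶ t} {b' : x' ⟶ t'}
    {m : Pro x x'} {m' : Pro y y'} {p : Pro x t} {p' : Pro y s} {n : Pro t t'} {n' : Pro s s'}
    {c : t ⟶ s} {c' : t' ⟶ s'} {d : x ⟶ y} {d' : x' ⟶ y'} {e : y ⟶ s} {e' : y' ⟶ s'}
    {u : Cell (𝟙 x) b (idPro x) p} {α : Cell b b' m n} {φ : Cell d c p p'} {ψ : Cell c c' n n'}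
    {u' : Cell (𝟙 y) e (idPro y) p'} {α' : Cell e e' m' n'} {μ : Cell d d' m m'}
    (h₁ : sq u ≫ sq φ = sq (hid d) ≫ sq u') (h₂ : sq α ≫ sq ψ = sq μ ≫ sq α') :
    sq (insertLeft u α) ≫ sq (hcomp φ ψ) = sq μ ≫ sq (insertLeft u' α') := by
  rw [sq_insertLeft, sq_insertLeft, ← Category.assoc (sq μ), leftIso_inv_naturality,
    Category.assoc, Category.assoc, sq_hcomp_comp_eq h₁ h₂]

end Slide

end DoubleCategory

/-! ### Products of cells and of companions -/

namespace BinaryDoubleProduct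

variable {D : Type u} [DoubleCategory.{z, w, v} D]

variable {T : UnderlyingBicategory D × UnderlyingBicategory D ⥤ᵖ UnderlyingBicategory D}
  (Q : BinaryDoubleProduct T)

variable {p q r p' q' : UnderlyingBicategory D × UnderlyingBicategory D}

theorem arrow_ext {s : D} {f g : s ⟶ (T.obj p).obj} (h₁ : f ≫ Q.fst p = g ≫ Q.fst p)
    (h₂ : f ≫ Q.snd p = g ≫ Q.snd p) : f = g :=
  BinaryFan.IsLimit.hom_ext (Q.isLimit p) h₁ h₂

/-- A product of two proarrows is a product in the category of proarrows and cells. -/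
theorem hom_ext {m : p ⟶ q} {n : Proarrow D}
    {α β : n ⟶ ⟨(T.map m : Pro (T.obj p).obj (T.obj q).obj)⟩}
    (h₁ : α ≫ sq (Q.fstCell m) = β ≫ sq (Q.fstCell m))
    (h₂ : α ≫ sq (Q.sndCell m) = β ≫ sq (Q.sndCell m)) : α = β := by
  obtain ⟨f, g, α⟩ := α
  obtain ⟨f', g', β⟩ := β
  obtain rfl : f = f' := Q.arrow_ext (congrArg Square.left h₁) (congrArg Square.left h₂)
  obtain rfl : g = g' := Q.arrow_ext (congrArg Square.right h₁) (congrArg Square.right h₂)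
  obtain ⟨γ, -, hγ⟩ := Q.existsUnique m n.pro f g (vcomp α (Q.fstCell m) rfl rfl)
    (vcomp α (Q.sndCell m) rfl rfl)
  have h₁ := sq_injective h₁
  have h₂ := sq_injective h₂
  rw [hγ α ⟨rfl, rfl⟩, hγ β ⟨h₁.symm, h₂.symm⟩]

theorem exists_lift (m : p ⟶ q) {s t : D} {n : Pro s t} (f : s ⟶ (T.obj p).obj)
    (g : t ⟶ (T.obj q).obj) {f₁ f₂ g₁ g₂} (α : Cell f₁ g₁ n m.1) (β : Cell f₂ g₂ n m.2)
    (hf₁ : f ≫ Q.fst p = f₁) (hf₂ : f ≫ Q.snd p = f₂) (hg₁ : g ≫ Q.fst q = g₁)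
    (hg₂ : g ≫ Q.snd q = g₂) :
    ∃ γ : Cell f g n (T.map m), sq γ ≫ sq (Q.fstCell m) = sq α ∧
      sq γ ≫ sq (Q.sndCell m) = sq β := by
  subst hf₁ hf₂ hg₁ hg₂
  obtain ⟨γ, ⟨h₁, h₂⟩, -⟩ := Q.existsUnique m n f g α β
  exact ⟨γ, congrArg sq h₁, congrArg sq h₂⟩

theorem sq_map₂_fst {m n : p ⟶ q} (α : m ⟶ n) :
    gsq (T.map₂ α) ≫ sq (Q.fstCell n) = sq (Q.fstCell m) ≫ gsq α.1 :=
  (sq_vcomp _ _ _ _).symm.trans ((congrArg sq (Q.map₂_fst α)).trans (sq_vcomp _ _ _ _))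

theorem sq_map₂_snd {m n : p ⟶ q} (α : m ⟶ n) :
    gsq (T.map₂ α) ≫ sq (Q.sndCell n) = sq (Q.sndCell m) ≫ gsq α.2 :=
  (sq_vcomp _ _ _ _).symm.trans ((congrArg sq (Q.map₂_snd α)).trans (sq_vcomp _ _ _ _))

theorem sq_mapId_fst (p : UnderlyingBicategory D × UnderlyingBicategory D) :
    gsq (T.mapId p).inv ≫ sq (Q.fstCell (𝟙 p)) = sq (hid (Q.fst p)) :=
  (sq_vcomp _ _ _ _).symm.trans (congrArg sq (Q.mapId_fst p))

theorem sq_mapId_snd (p : UnderlyingBicategory D × UnderlyingBicategory D) :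
    gsq (T.mapId p).inv ≫ sq (Q.sndCell (𝟙 p)) = sq (hid (Q.snd p)) :=
  (sq_vcomp _ _ _ _).symm.trans (congrArg sq (Q.mapId_snd p))

theorem sq_mapComp_fst (m : p ⟶ q) (n : q ⟶ r) :
    gsq (T.mapComp m n).inv ≫ sq (Q.fstCell (m ≫ n)) = sq (hcomp (Q.fstCell m) (Q.fstCell n)) :=
  (sq_vcomp _ _ _ _).symm.trans (congrArg sq (Q.mapComp_fst m n))

theorem sq_mapComp_snd (m : p ⟶ q) (n : q ⟶ r) :
    gsq (T.mapComp m n).inv ≫ sq (Q.sndCell (m ≫ n)) = sq (hcomp (Q.sndCell m) (Q.sndCell n)) :=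
  (sq_vcomp _ _ _ _).symm.trans (congrArg sq (Q.mapComp_snd m n))

/-- The product of two arrows. -/
noncomputable def arrow (f₁ : p.1.obj ⟶ q.1.obj) (f₂ : p.2.obj ⟶ q.2.obj) :
    (T.obj p).obj ⟶ (T.obj q).obj :=
  (Q.isLimit q).lift (BinaryFan.mk (Q.fst p ≫ f₁) (Q.snd p ≫ f₂))

theorem arrow_fst (f₁ : p.1.obj ⟶ q.1.obj) (f₂ : p.2.obj ⟶ q.2.obj) :
    Q.arrow f₁ f₂ ≫ Q.fst q = Q.fst p ≫ f₁ :=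
  (Q.isLimit q).fac _ ⟨.left⟩

theorem arrow_snd (f₁ : p.1.obj ⟶ q.1.obj) (f₂ : p.2.obj ⟶ q.2.obj) :
    Q.arrow f₁ f₂ ≫ Q.snd q = Q.snd p ≫ f₂ :=
  (Q.isLimit q).fac _ ⟨.right⟩

section Cell

variable {m : p ⟶ q} {n : p' ⟶ q'} {f₁ : p.1.obj ⟶ p'.1.obj} {f₂ : p.2.obj ⟶ p'.2.obj}
  {g₁ : q.1.obj ⟶ q'.1.obj} {g₂ : q.2.obj ⟶ q'.2.obj}

theorem exists_cell (α : Cell f₁ g₁ m.1 n.1) (β : Cell f₂ g₂ m.2 n.2) :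
    ∃ γ : Cell (Q.arrow f₁ f₂) (Q.arrow g₁ g₂) (T.map m) (T.map n),
      sq γ ≫ sq (Q.fstCell n) = sq (Q.fstCell m) ≫ sq α ∧
        sq γ ≫ sq (Q.sndCell n) = sq (Q.sndCell m) ≫ sq β := by
  obtain ⟨γ, h₁, h₂⟩ := Q.exists_lift n (Q.arrow f₁ f₂) (Q.arrow g₁ g₂)
    (vcomp (Q.fstCell m) α rfl rfl) (vcomp (Q.sndCell m) β rfl rfl) (Q.arrow_fst _ _)
    (Q.arrow_snd _ _) (Q.arrow_fst _ _) (Q.arrow_snd _ _)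
  exact ⟨γ, h₁.trans (sq_vcomp _ _ _ _), h₂.trans (sq_vcomp _ _ _ _)⟩

/-- The product of two cells. -/
noncomputable def cell (α : Cell f₁ g₁ m.1 n.1) (β : Cell f₂ g₂ m.2 n.2) :
    Cell (Q.arrow f₁ f₂) (Q.arrow g₁ g₂) (T.map m) (T.map n) :=
  (Q.exists_cell α β).choose

theorem cell_fst (α : Cell f₁ g₁ m.1 n.1) (β : Cell f₂ g₂ m.2 n.2) :
    sq (Q.cell α β) ≫ sq (Q.fstCell n) = sq (Q.fstCell m) ≫ sq α :=
  (Q.exists_cell α β).choose_spec.1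

theorem cell_snd (α : Cell f₁ g₁ m.1 n.1) (β : Cell f₂ g₂ m.2 n.2) :
    sq (Q.cell α β) ≫ sq (Q.sndCell n) = sq (Q.sndCell m) ≫ sq β :=
  (Q.exists_cell α β).choose_spec.2

end Cell

section Unit

variable {n : p ⟶ q} {f₁ : p.1.obj ⟶ q.1.obj} {f₂ : p.2.obj ⟶ q.2.obj}

theorem exists_unit (u₁ : Cell (𝟙 _) f₁ (idPro _) n.1) (u₂ : Cell (𝟙 _) f₂ (idPro _) n.2) :
    ∃ γ : Cell (𝟙 _) (Q.arrow f₁ f₂) (idPro _) (T.map n),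
      sq γ ≫ sq (Q.fstCell n) = sq (hid (Q.fst p)) ≫ sq u₁ ∧
        sq γ ≫ sq (Q.sndCell n) = sq (hid (Q.snd p)) ≫ sq u₂ := by
  obtain ⟨γ, h₁, h₂⟩ := Q.exists_lift n (𝟙 _) (Q.arrow f₁ f₂)
    (vcomp (hid (Q.fst p)) u₁ (Category.comp_id _) rfl)
    (vcomp (hid (Q.snd p)) u₂ (Category.comp_id _) rfl) (Category.id_comp _) (Category.id_comp _)
    (Q.arrow_fst _ _) (Q.arrow_snd _ _)
  exact ⟨γ, h₁.trans (sq_vcomp _ _ _ _), h₂.trans (sq_vcomp _ _ _ _)⟩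

/-- The product of two cells `id ⇒ n₁` over `(1, f₁)` and `id ⇒ n₂` over `(1, f₂)`. -/
noncomputable def unit (u₁ : Cell (𝟙 _) f₁ (idPro _) n.1) (u₂ : Cell (𝟙 _) f₂ (idPro _) n.2) :
    Cell (𝟙 _) (Q.arrow f₁ f₂) (idPro (T.obj p).obj) (T.map n) :=
  (Q.exists_unit u₁ u₂).choose

theorem unit_fst (u₁ : Cell (𝟙 _) f₁ (idPro _) n.1) (u₂ : Cell (𝟙 _) f₂ (idPro _) n.2) :
    sq (Q.unit u₁ u₂) ≫ sq (Q.fstCell n) = sq (hid (Q.fst p)) ≫ sq u₁ :=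
  (Q.exists_unit u₁ u₂).choose_spec.1

theorem unit_snd (u₁ : Cell (𝟙 _) f₁ (idPro _) n.1) (u₂ : Cell (𝟙 _) f₂ (idPro _) n.2) :
    sq (Q.unit u₁ u₂) ≫ sq (Q.sndCell n) = sq (hid (Q.snd p)) ≫ sq u₂ :=
  (Q.exists_unit u₁ u₂).choose_spec.2

theorem unit_comp_map₂ {n' : p ⟶ q} {u₁ : Cell (𝟙 _) f₁ (idPro _) n.1}
    {u₂ : Cell (𝟙 _) f₂ (idPro _) n.2} {f₁' : p.1.obj ⟶ q.1.obj} {f₂' : p.2.obj ⟶ q.2.obj}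
    {u₁' : Cell (𝟙 _) f₁' (idPro _) n'.1} {u₂' : Cell (𝟙 _) f₂' (idPro _) n'.2} (γ : n ⟶ n')
    (h₁ : sq u₁ ≫ gsq γ.1 = sq u₁') (h₂ : sq u₂ ≫ gsq γ.2 = sq u₂') :
    sq (Q.unit u₁ u₂) ≫ gsq (T.map₂ γ) = sq (Q.unit u₁' u₂') := by
  apply Q.hom_ext
  · rw [Category.assoc, sq_map₂_fst, ← Category.assoc, unit_fst, Category.assoc, h₁, unit_fst]
  · rw [Category.assoc, sq_map₂_snd, ← Category.assoc, unit_snd, Category.assoc, h₂, unit_snd]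

theorem unit_vid (p : UnderlyingBicategory D × UnderlyingBicategory D) :
    sq (Q.unit (n := 𝟙 p) (vid (idPro p.1.obj)) (vid (idPro p.2.obj))) = gsq (T.mapId p).inv := by
  apply Q.hom_ext
  · rw [unit_fst, sq_mapId_fst]
    exact Category.comp_id _
  · rw [unit_snd, sq_mapId_snd]
    exact Category.comp_id _

theorem unit_vid_comp (p : UnderlyingBicategory D × UnderlyingBicategory D) :
    sq (Q.unit (n := 𝟙 p) (vid (idPro p.1.obj)) (vid (idPro p.2.obj))) ≫ gsq (T.mapId p).hom =
      sq (vid (idPro (T.obj p).obj)) := by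
  rw [unit_vid]
  exact gsq_inv_hom _

/-- The comparison of `T` with external composition carries the composite of product unit cells to
the product of composite unit cells. -/
theorem unitComp_comp_mapComp {k : q ⟶ r} {g₁ : q.1.obj ⟶ r.1.obj} {g₂ : q.2.obj ⟶ r.2.obj}
    (u₁ : Cell (𝟙 _) f₁ (idPro _) n.1) (u₂ : Cell (𝟙 _) f₂ (idPro _) n.2)
    (v₁ : Cell (𝟙 _) g₁ (idPro _) k.1) (v₂ : Cell (𝟙 _) g₂ (idPro _) k.2) :
    sq (unitComp (Q.unit u₁ u₂) (Q.unit v₁ v₂)) ≫ gsq (T.mapComp n k).inv =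
      sq (Q.unit (n := n ≫ k) (unitComp u₁ v₁) (unitComp u₂ v₂)) := by
  apply Q.hom_ext
  · rw [Category.assoc, sq_mapComp_fst, unit_fst, sq_unitComp, Category.assoc,
      insertRight_comp_hcomp (Q.unit_fst v₁ v₂), ← Category.assoc, unit_fst, Category.assoc]
    exact congrArg (_ ≫ ·) (sq_unitComp u₁ v₁).symm
  · rw [Category.assoc, sq_mapComp_snd, unit_snd, sq_unitComp, Category.assoc,
      insertRight_comp_hcomp (Q.unit_snd v₁ v₂), ← Category.assoc, unit_snd, Category.assoc]
    exact congrArg (_ ≫ ·) (sq_unitComp u₂ v₂).symm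

end Unit

/-- The pseudofunctor `T` preserves represented cells. -/
theorem represents_mapSquare {m : p ⟶ q} {m' : p' ⟶ q'} {n₂ : p ⟶ p'} {n₁ : q ⟶ q'}
    {f₁ : p.1.obj ⟶ p'.1.obj} {f₂ : p.2.obj ⟶ p'.2.obj}
    {g₁ : q.1.obj ⟶ q'.1.obj} {g₂ : q.2.obj ⟶ q'.2.obj}
    {u₁ : Cell (𝟙 _) f₁ (idPro _) n₂.1} {u₂ : Cell (𝟙 _) f₂ (idPro _) n₂.2}
    {v₁ : Cell (𝟙 _) g₁ (idPro _) n₁.1} {v₂ : Cell (𝟙 _) g₂ (idPro _) n₁.2}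
    {α : Cell f₁ g₁ m.1 m'.1} {β : Cell f₂ g₂ m.2 m'.2} {X : m ≫ n₁ ⟶ n₂ ≫ m'}
    (h₁ : Represents u₁ v₁ α X.1) (h₂ : Represents u₂ v₂ β X.2) :
    Represents (Q.unit u₁ u₂) (Q.unit v₁ v₂) (Q.cell α β) (mapSquare T X) := by
  have h₁ : _ = _ := h₁
  have h₂ : _ = _ := h₂
  change sq (insertRight _ (Q.unit v₁ v₂)) ≫ gsq (mapSquare T X) = _
  rw [mapSquare, gsq_comp, gsq_comp, ← Category.assoc, ← Category.assoc]
  refine Eq.trans ?_ ((congrArg (_ ≫ ·) (gsq_inv_hom (T.mapComp n₂ m'))).trans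
    (Category.comp_id _))
  rw [← Category.assoc]
  congr 1
  apply Q.hom_ext
  · rw [Category.assoc, Category.assoc, sq_map₂_fst, ← Category.assoc (gsq _), sq_mapComp_fst,
      ← Category.assoc, insertRight_comp_hcomp (Q.unit_fst v₁ v₂), Category.assoc,
      Category.assoc, sq_mapComp_fst, insertLeft_comp_hcomp (Q.unit_fst u₁ u₂) (Q.cell_fst α β)]
    exact congrArg (_ ≫ ·) h₁
  · rw [Category.assoc, Category.assoc, sq_map₂_snd, ← Category.assoc (gsq _), sq_mapComp_snd,
      ← Category.assoc, insertRight_comp_hcomp (Q.unit_snd v₁ v₂), Category.assoc,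
      Category.assoc, sq_mapComp_snd, insertLeft_comp_hcomp (Q.unit_snd u₁ u₂) (Q.cell_snd α β)]
    exact congrArg (_ ≫ ·) h₂

theorem exists_counit {n : p ⟶ q} {f₁ : p.1.obj ⟶ q.1.obj} {f₂ : p.2.obj ⟶ q.2.obj}
    (c₁ : Cell f₁ (𝟙 _) n.1 (idPro _)) (c₂ : Cell f₂ (𝟙 _) n.2 (idPro _)) :
    ∃ γ : Cell (Q.arrow f₁ f₂) (𝟙 _) (T.map n) (idPro (T.obj q).obj),
      sq γ ≫ sq (hid (Q.fst q)) = sq (Q.fstCell n) ≫ sq c₁ ∧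
        sq γ ≫ sq (hid (Q.snd q)) = sq (Q.sndCell n) ≫ sq c₂ := by
  obtain ⟨γ, h₁, h₂⟩ := Q.exists_lift (𝟙 q) (Q.arrow f₁ f₂) (𝟙 _)
    (vcomp (Q.fstCell n) c₁ rfl (Category.comp_id _))
    (vcomp (Q.sndCell n) c₂ rfl (Category.comp_id _)) (Q.arrow_fst _ _) (Q.arrow_snd _ _)
    (Category.id_comp _) (Category.id_comp _)
  have e : sq (vcomp γ (T.mapId q).hom (Category.comp_id _) (Category.comp_id _)) ≫
      gsq (T.mapId q).inv = sq γ := by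
    rw [sq_vcomp, Category.assoc]
    exact (congrArg (_ ≫ ·) (gsq_hom_inv (T.mapId q))).trans (Category.comp_id _)
  refine ⟨vcomp γ (T.mapId q).hom (Category.comp_id _) (Category.comp_id _), ?_, ?_⟩
  · rw [← sq_mapId_fst, ← Category.assoc, e, h₁, sq_vcomp]
  · rw [← sq_mapId_snd, ← Category.assoc, e, h₂, sq_vcomp]

/-- Cells into the external identity of a product are determined by their projections. -/
theorem idPro_hom_ext {s t : D} {n : Pro s t} {f : s ⟶ (T.obj p).obj} {g : t ⟶ (T.obj p).obj}
    {α β : Cell f g n (idPro (T.obj p).obj)}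
    (h₁ : sq α ≫ sq (hid (Q.fst p)) = sq β ≫ sq (hid (Q.fst p)))
    (h₂ : sq α ≫ sq (hid (Q.snd p)) = sq β ≫ sq (hid (Q.snd p))) : α = β := by
  rw [← sq_mapId_fst, ← Category.assoc, ← Category.assoc] at h₁
  rw [← sq_mapId_snd, ← Category.assoc, ← Category.assoc] at h₂
  have h := congrArg (· ≫ gsq (T.mapId p).hom) (Q.hom_ext h₁ h₂)
  simp only [Category.assoc, gsq_inv_hom] at h
  exact sq_injective ((Category.comp_id _).symm.trans (h.trans (Category.comp_id _)))

/-- The product of two companions. -/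
noncomputable def companion {n : p ⟶ q} {f₁ : p.1.obj ⟶ q.1.obj} {f₂ : p.2.obj ⟶ q.2.obj}
    (c₁ : Companion f₁ n.1) (c₂ : Companion f₂ n.2) : Companion (Q.arrow f₁ f₂) (T.map n) where
  unit := Q.unit c₁.unit c₂.unit
  counit := (Q.exists_counit c₁.counit c₂.counit).choose
  external := sq_injective (by
    obtain ⟨h₁, h₂⟩ := (Q.exists_counit c₁.counit c₂.counit).choose_spec
    rw [sq_gcomp, sq_rightHom, sq_leftHom]
    apply Q.hom_ext
    · rw [Category.assoc, ← rightIso_naturality, ← Category.assoc,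
        sq_hcomp_comp_eq (Q.unit_fst c₁.unit c₂.unit) h₁, ← leftIso_naturality, Category.assoc,
        c₁.sq_external]
    · rw [Category.assoc, ← rightIso_naturality, ← Category.assoc,
        sq_hcomp_comp_eq (Q.unit_snd c₁.unit c₂.unit) h₂, ← leftIso_naturality, Category.assoc,
        c₂.sq_external])
  internal := Q.idPro_hom_ext
    (by
      rw [sq_vcomp, Category.assoc, (Q.exists_counit c₁.counit c₂.counit).choose_spec.1,
        ← Category.assoc, unit_fst, Category.assoc, c₁.sq_internal, ← sq_hid_comp, ← sq_hid_comp,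
        arrow_fst])
    (by
      rw [sq_vcomp, Category.assoc, (Q.exists_counit c₁.counit c₂.counit).choose_spec.2,
        ← Category.assoc, unit_snd, Category.assoc, c₂.sq_internal, ← sq_hid_comp, ← sq_hid_comp,
        arrow_snd])

end BinaryDoubleProduct

namespace BinaryDoubleProduct

variable {D : Type u} [DoubleCategory.{z, w, v} D]
  {T : UnderlyingBicategory D × UnderlyingBicategory D ⥤ᵖ UnderlyingBicategory D}
  (Q : BinaryDoubleProduct T)

/-! ### The lax adjunction between the diagonal and the product -/

/-- The diagonal arrow of an object. -/
noncomputable def diag (x : UnderlyingBicategory D) : x.obj ⟶ (T.obj (x, x)).obj :=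
  (Q.isLimit (x, x)).lift (BinaryFan.mk (𝟙 x.obj) (𝟙 x.obj))

theorem diag_fst (x : UnderlyingBicategory D) : Q.diag x ≫ Q.fst (x, x) = 𝟙 x.obj :=
  (Q.isLimit (x, x)).fac _ ⟨.left⟩

theorem diag_snd (x : UnderlyingBicategory D) : Q.diag x ≫ Q.snd (x, x) = 𝟙 x.obj :=
  (Q.isLimit (x, x)).fac _ ⟨.right⟩

section

variable {x y t : UnderlyingBicategory D}

theorem exists_diagCell (m : x ⟶ y) :
    ∃ γ : Cell (Q.diag x) (Q.diag y) m (T.map (Prod.mkHom m m)),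
      sq γ ≫ sq (Q.fstCell (Prod.mkHom m m)) = sq (vid m) ∧
        sq γ ≫ sq (Q.sndCell (Prod.mkHom m m)) = sq (vid m) :=
  Q.exists_lift (Prod.mkHom m m) (Q.diag x) (Q.diag y) (vid m) (vid m) (Q.diag_fst x)
    (Q.diag_snd x) (Q.diag_fst y) (Q.diag_snd y)

/-- The diagonal cell of a proarrow. -/
noncomputable def diagCell (m : x ⟶ y) :
    Cell (Q.diag x) (Q.diag y) m (T.map (Prod.mkHom m m)) :=
  (Q.exists_diagCell m).choose

theorem diagCell_fst (m : x ⟶ y) :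
    sq (Q.diagCell m) ≫ sq (Q.fstCell (Prod.mkHom m m)) = 𝟙 _ :=
  (Q.exists_diagCell m).choose_spec.1

theorem diagCell_snd (m : x ⟶ y) :
    sq (Q.diagCell m) ≫ sq (Q.sndCell (Prod.mkHom m m)) = 𝟙 _ :=
  (Q.exists_diagCell m).choose_spec.2

theorem diagCell_naturality {m n : x ⟶ y} (α : m ⟶ n) :
    gsq α ≫ sq (Q.diagCell n) = sq (Q.diagCell m) ≫ gsq (T.map₂ ((α, α) : (m, m) ⟶ (n, n))) := by
  apply Q.hom_ext
  · refine (Category.assoc _ _ _).trans ((congrArg (_ ≫ ·) (Q.diagCell_fst n)).trans ?_)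
    refine Eq.trans ?_ ((Category.assoc _ _ _).trans (congrArg (_ ≫ ·) (Q.sq_map₂_fst _))).symm
    refine Eq.trans ?_ ((Category.assoc _ _ _).symm.trans
      (congrArg (· ≫ _) (Q.diagCell_fst m))).symm
    exact (Category.comp_id _).trans (Category.id_comp _).symm
  · refine (Category.assoc _ _ _).trans ((congrArg (_ ≫ ·) (Q.diagCell_snd n)).trans ?_)
    refine Eq.trans ?_ ((Category.assoc _ _ _).trans (congrArg (_ ≫ ·) (Q.sq_map₂_snd _))).symm
    refine Eq.trans ?_ ((Category.assoc _ _ _).symm.trans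
      (congrArg (· ≫ _) (Q.diagCell_snd m))).symm
    exact (Category.comp_id _).trans (Category.id_comp _).symm

theorem diagCell_id (x : UnderlyingBicategory D) :
    sq (Q.diagCell (𝟙 x)) ≫ gsq (T.mapId (x, x)).hom = sq (hid (Q.diag x)) := by
  have h : sq (Q.diagCell (𝟙 x)) = sq (hid (Q.diag x)) ≫ gsq (T.mapId (x, x)).inv := by
    apply Q.hom_ext
    · refine (Q.diagCell_fst _).trans (Eq.trans ?_ ((Category.assoc _ _ _).trans
        (congrArg (sq (hid (Q.diag x)) ≫ ·) (Q.sq_mapId_fst (x, x)))).symm)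
      rw [← sq_hid_comp, diag_fst, sq_hid_id]
      rfl
    · refine (Q.diagCell_snd _).trans (Eq.trans ?_ ((Category.assoc _ _ _).trans
        (congrArg (sq (hid (Q.diag x)) ≫ ·) (Q.sq_mapId_snd (x, x)))).symm)
      rw [← sq_hid_comp, diag_snd, sq_hid_id]
      rfl
  rw [h, Category.assoc, gsq_inv_hom]
  exact Category.comp_id _

theorem diagCell_comp (m : x ⟶ y) (n : y ⟶ t) :
    sq (Q.diagCell (m ≫ n)) ≫ gsq (T.mapComp (Prod.mkHom m m) (Prod.mkHom n n)).hom =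
      sq (hcomp (Q.diagCell m) (Q.diagCell n)) := by
  have h : sq (Q.diagCell (m ≫ n)) = sq (hcomp (Q.diagCell m) (Q.diagCell n)) ≫
      gsq (T.mapComp (Prod.mkHom m m) (Prod.mkHom n n)).inv := by
    apply Q.hom_ext
    · refine (Q.diagCell_fst _).trans (Eq.trans ?_ (Category.assoc _ _ _).symm)
      refine Eq.trans ?_ (congrArg (sq (hcomp (Q.diagCell m) (Q.diagCell n)) ≫ ·)
        (Q.sq_mapComp_fst _ _)).symm
      exact ((sq_hcomp_comp (Q.diagCell_fst m) (Q.diagCell_fst n)).trans (sq_hcomp_vid _ _)).symm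
    · refine (Q.diagCell_snd _).trans (Eq.trans ?_ (Category.assoc _ _ _).symm)
      refine Eq.trans ?_ (congrArg (sq (hcomp (Q.diagCell m) (Q.diagCell n)) ≫ ·)
        (Q.sq_mapComp_snd _ _)).symm
      exact ((sq_hcomp_comp (Q.diagCell_snd m) (Q.diagCell_snd n)).trans (sq_hcomp_vid _ _)).symm
  rw [h, Category.assoc, gsq_inv_hom]
  exact Category.comp_id _

end

/-- A choice of companions `diag x`, `fst p` and `snd p` of the diagonals and of the projections. -/
structure Companions where
  diag : ∀ x, x ⟶ T.obj (x, x)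
  diagCompanion : ∀ x, Companion (Q.diag x) (diag x)
  fst : ∀ p, T.obj p ⟶ p.1
  fstCompanion : ∀ p, Companion (Q.fst p) (fst p)
  snd : ∀ p, T.obj p ⟶ p.2
  sndCompanion : ∀ p, Companion (Q.snd p) (snd p)

namespace Companions

variable {Q} (C : Q.Companions)

/-- The oplax transformation whose components are companions of the diagonals. -/
noncomputable def unit : Oplax.OplaxTrans (Pseudofunctor.id (UnderlyingBicategory D)).toOplax
    ((diagonal (UnderlyingBicategory D)).comp T).toOplax where
  app := C.diag
  naturality m := slide (C.diagCompanion _) (C.diagCompanion _) (Q.diagCell m)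
  naturality_naturality α := slide_naturality _ _ (Q.diagCell_naturality α)
  naturality_id x := slide_id (C.diagCompanion x) (by
    change _ ≫ gsq (T.map₂ (𝟙 (𝟙 (x, x))) ≫ (T.mapId (x, x)).hom) = 𝟙 _ ≫ _
    rw [T.map₂_id, Category.id_comp]
    exact (Q.diagCell_id x).trans (Category.id_comp _).symm)
  naturality_comp {x y t} m n := slide_comp (C.diagCompanion x) (C.diagCompanion y)
    (C.diagCompanion t) (by
      change _ ≫ gsq (T.map₂ (𝟙 (Prod.mkHom m m ≫ Prod.mkHom n n)) ≫ (T.mapComp _ _).hom) =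
        𝟙 _ ≫ _
      rw [T.map₂_id, Category.id_comp]
      exact (Q.diagCell_comp m n).trans (Category.id_comp _).symm)

/-- The oplax transformation whose components are companions of the projections. -/
noncomputable def counit : Oplax.OplaxTrans (T.comp (diagonal (UnderlyingBicategory D))).toOplax
    (Pseudofunctor.id (UnderlyingBicategory D × UnderlyingBicategory D)).toOplax where
  app p := Prod.mkHom (C.fst p) (C.snd p)
  naturality m :=
    (slide (C.fstCompanion _) (C.fstCompanion _) (Q.fstCell m),
      slide (C.sndCompanion _) (C.sndCompanion _) (Q.sndCell m))
  naturality_naturality α := Prod.ext (slide_naturality _ _ (Q.sq_map₂_fst α))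
    (slide_naturality _ _ (Q.sq_map₂_snd α))
  naturality_id p := Prod.ext
    (slide_id (C.fstCompanion p) (comp_eq_of_inv_comp_eq (T.mapId p) (Q.sq_mapId_fst p)))
    (slide_id (C.sndCompanion p) (comp_eq_of_inv_comp_eq (T.mapId p) (Q.sq_mapId_snd p)))
  naturality_comp {p q r} m n := Prod.ext
    (slide_comp (C.fstCompanion p) (C.fstCompanion q) (C.fstCompanion r)
      (comp_eq_of_inv_comp_eq (T.mapComp m n) (Q.sq_mapComp_fst m n)))
    (slide_comp (C.sndCompanion p) (C.sndCompanion q) (C.sndCompanion r)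
      (comp_eq_of_inv_comp_eq (T.mapComp m n) (Q.sq_mapComp_snd m n)))

end Companions

end BinaryDoubleProduct

theorem mapSquare_diagonal {B : Type u₁} [Bicategory.{z₁, w₁} B] {x x' y y' : B} {f : x ⟶ x'}
    {g : y ⟶ y'} {t : x ⟶ y} {t' : x' ⟶ y'} (n : f ≫ t' ⟶ t ≫ g) :
    mapSquare (diagonal B) n = (n, n) :=
  Prod.ext ((Category.id_comp _).trans (Category.comp_id _))
    ((Category.id_comp _).trans (Category.comp_id _))

namespace BinaryDoubleProduct

variable {D : Type u} [DoubleCategory.{z, w, v} D]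
  {T : UnderlyingBicategory D × UnderlyingBicategory D ⥤ᵖ UnderlyingBicategory D}
  (Q : BinaryDoubleProduct T)

theorem diag_comp_arrow (p : UnderlyingBicategory D × UnderlyingBicategory D) :
    Q.diag (T.obj p) ≫ Q.arrow (p := (T.obj p, T.obj p)) (Q.fst p) (Q.snd p) = 𝟙 _ := by
  apply Q.arrow_ext
  · rw [Category.assoc, arrow_fst]
    exact (Category.assoc _ _ _).symm.trans (congrArg (· ≫ Q.fst p) (Q.diag_fst (T.obj p)))
  · rw [Category.assoc, arrow_snd]
    exact (Category.assoc _ _ _).symm.trans (congrArg (· ≫ Q.snd p) (Q.diag_snd (T.obj p)))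

theorem diagCell_comp_cell {p q : UnderlyingBicategory D × UnderlyingBicategory D} (m : p ⟶ q) :
    sq (Q.diagCell (T.map m)) ≫
      sq (Q.cell (m := Prod.mkHom (T.map m) (T.map m)) (Q.fstCell m) (Q.sndCell m)) = 𝟙 _ := by
  apply Q.hom_ext
  · rw [Category.assoc, cell_fst]
    exact (Category.assoc _ _ _).symm.trans
      (congrArg (· ≫ sq (Q.fstCell m)) (Q.diagCell_fst (T.map m)))
  · rw [Category.assoc, cell_snd]
    exact (Category.assoc _ _ _).symm.trans
      (congrArg (· ≫ sq (Q.sndCell m)) (Q.diagCell_snd (T.map m)))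

/-- The diagonal cell carries the unit cell `u` to the product of two copies of `u`. -/
theorem unit_comp_diagCell {x y : UnderlyingBicategory D} {n : x ⟶ y} {f : x.obj ⟶ y.obj}
    (u : Cell (𝟙 _) f (idPro x.obj) n) :
    sq u ≫ sq (Q.diagCell n) =
      sq (hid (Q.diag x)) ≫ sq (Q.unit (n := Prod.mkHom n n) u u) := by
  apply Q.hom_ext
  · rw [Category.assoc, Category.assoc, unit_fst]
    refine (congrArg (sq u ≫ ·) (Q.diagCell_fst n)).trans ((Category.comp_id _).trans ?_)
    refine Eq.symm ((Category.assoc _ _ _).symm.trans ((congrArg (· ≫ sq u) ?_).trans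
      (Category.id_comp _)))
    exact (sq_hid_comp _ _).symm.trans ((congrArg (fun f => sq (hid f)) (Q.diag_fst x)).trans
      (sq_hid_id _))
  · rw [Category.assoc, Category.assoc, unit_snd]
    refine (congrArg (sq u ≫ ·) (Q.diagCell_snd n)).trans ((Category.comp_id _).trans ?_)
    refine Eq.symm ((Category.assoc _ _ _).symm.trans ((congrArg (· ≫ sq u) ?_).trans
      (Category.id_comp _)))
    exact (sq_hid_comp _ _).symm.trans ((congrArg (fun f => sq (hid f)) (Q.diag_snd x)).trans
      (sq_hid_id _))

namespace Companions

variable {Q} (C : Q.Companions)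

/-- The naturality 2-cells of `F η ; κ F` correspond to identity cells, as the diagonal cell
followed by a projection cell is an identity. -/
theorem represents_leftTriangle_fst {x y : UnderlyingBicategory D} (m : x ⟶ y) :
    Represents (compUnit (C.diagCompanion x) (C.fstCompanion (x, x)) (Q.diag_fst x))
      (compUnit (C.diagCompanion y) (C.fstCompanion (y, y)) (Q.diag_fst y)) (vid m)
      ((leftTriangle C.unit C.counit).naturality m).1 := by
  have h := ((represents_slide (C.diagCompanion x) (C.diagCompanion y) (Q.diagCell m)).vcomp
    (represents_slide (C.fstCompanion (x, x)) (C.fstCompanion (y, y))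
      (Q.fstCell (Prod.mkHom m m)))).congr
    (Companion.sq_compUnit _ _ (Q.diag_fst x)).symm
    (Companion.sq_compUnit _ _ (Q.diag_fst y)).symm
    ((sq_vcomp _ _ _ _).trans ((Q.diagCell_fst m).trans (sq_vid m).symm))
  have e : mapSquare (diagonal (UnderlyingBicategory D)) (C.unit.naturality m) =
    (slide (C.diagCompanion x) (C.diagCompanion y) (Q.diagCell m),
      slide (C.diagCompanion x) (C.diagCompanion y) (Q.diagCell m)) := mapSquare_diagonal _
  have e := congrArg Prod.fst e
  generalize slide (C.diagCompanion x) (C.diagCompanion y) (Q.diagCell m) = X at h e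
  subst e
  exact h

theorem represents_leftTriangle_snd {x y : UnderlyingBicategory D} (m : x ⟶ y) :
    Represents (compUnit (C.diagCompanion x) (C.sndCompanion (x, x)) (Q.diag_snd x))
      (compUnit (C.diagCompanion y) (C.sndCompanion (y, y)) (Q.diag_snd y)) (vid m)
      ((leftTriangle C.unit C.counit).naturality m).2 := by
  have h := ((represents_slide (C.diagCompanion x) (C.diagCompanion y) (Q.diagCell m)).vcomp
    (represents_slide (C.sndCompanion (x, x)) (C.sndCompanion (y, y))
      (Q.sndCell (Prod.mkHom m m)))).congr
    (Companion.sq_compUnit _ _ (Q.diag_snd x)).symm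
    (Companion.sq_compUnit _ _ (Q.diag_snd y)).symm
    ((sq_vcomp _ _ _ _).trans ((Q.diagCell_snd m).trans (sq_vid m).symm))
  have e : mapSquare (diagonal (UnderlyingBicategory D)) (C.unit.naturality m) =
    (slide (C.diagCompanion x) (C.diagCompanion y) (Q.diagCell m),
      slide (C.diagCompanion x) (C.diagCompanion y) (Q.diagCell m)) := mapSquare_diagonal _
  have e := congrArg Prod.snd e
  generalize slide (C.diagCompanion x) (C.diagCompanion y) (Q.diagCell m) = X at h e
  subst e
  exact h

/-- The product of the companions of the two projections. -/
noncomputable def projCompanion (p : UnderlyingBicategory D × UnderlyingBicategory D) :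
    Companion (Q.arrow (p := (T.obj p, T.obj p)) (Q.fst p) (Q.snd p)) (T.map (C.counit.app p)) :=
  Q.companion (p := (T.obj p, T.obj p)) (n := C.counit.app p) (C.fstCompanion p)
    (C.sndCompanion p)

/-- The naturality 2-cells of `η G ; G κ` correspond to identity cells, as the diagonal cell
followed by the product of the projection cells is an identity. -/
theorem represents_rightTriangle {p q : UnderlyingBicategory D × UnderlyingBicategory D}
    (m : p ⟶ q) :
    Represents
      (compUnit (C.diagCompanion (T.obj p)) (C.projCompanion p) (Q.diag_comp_arrow p))
      (compUnit (C.diagCompanion (T.obj q)) (C.projCompanion q) (Q.diag_comp_arrow q))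
      (vid (T.map m)) ((rightTriangle C.unit C.counit).naturality m) :=
  ((represents_slide (C.diagCompanion (T.obj p)) (C.diagCompanion (T.obj q))
      (Q.diagCell (T.map m))).vcomp
    (Q.represents_mapSquare (m := Prod.mkHom (T.map m) (T.map m)) (X := C.counit.naturality m)
      (represents_slide (C.fstCompanion p) (C.fstCompanion q) (Q.fstCell m))
      (represents_slide (C.sndCompanion p) (C.sndCompanion q) (Q.sndCell m)))).congr
    (Companion.sq_compUnit (C.diagCompanion (T.obj p)) (C.projCompanion p)
      (Q.diag_comp_arrow p)).symm
    (Companion.sq_compUnit (C.diagCompanion (T.obj q)) (C.projCompanion q)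
      (Q.diag_comp_arrow q)).symm
    ((sq_vcomp _ _ _ _).trans ((Q.diagCell_comp_cell m).trans (sq_vid (T.map m)).symm))

/-- The triangulator whose components are the isomorphisms `1 ≅ δ ⊙ π` between companions of
identity arrows. -/
noncomputable def leftTriangulator :
    𝟙 (diagonal (UnderlyingBicategory D)).toOplax ≅ leftTriangle C.unit C.counit :=
  Oplax.OplaxTrans.isoMk
    (fun x => Iso.prod
      ((C.diagCompanion x).comp (C.fstCompanion (x, x)) (Q.diag_fst x)).isoOfId
      ((C.diagCompanion x).comp (C.sndCompanion (x, x)) (Q.diag_snd x)).isoOfId)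
    (fun m => Prod.ext (modification_of_represents (C.represents_leftTriangle_fst m))
      (modification_of_represents (C.represents_leftTriangle_snd m)))

/-- The triangulator whose inverse has as components the isomorphisms `1 ≅ δ ⊙ (π × π)` between
companions of identity arrows. -/
noncomputable def rightTriangulator :
    rightTriangle C.unit C.counit ≅ 𝟙 T.toOplax :=
  (Oplax.OplaxTrans.isoMk
    (fun p => ((C.diagCompanion (T.obj p)).comp (C.projCompanion p)
      (Q.diag_comp_arrow p)).isoOfId)
    (fun m => modification_of_represents (C.represents_rightTriangle m))).symm

section

variable (p : UnderlyingBicategory D × UnderlyingBicategory D) (x : UnderlyingBicategory D)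

theorem sq_rightTriangulator_inv_app : gsq (show 𝟙 (T.obj p) ⟶
    C.diag (T.obj p) ≫ T.map (C.counit.app p) from C.rightTriangulator.inv.as.app p) =
    sq (unitComp (C.diagCompanion (T.obj p)).unit
      (Q.unit (p := (T.obj p, T.obj p)) (n := C.counit.app p) (C.fstCompanion p).unit
        (C.sndCompanion p).unit)) :=
  Companion.sq_compUnit (C.diagCompanion (T.obj p)) (C.projCompanion p) (Q.diag_comp_arrow p)

theorem unitComp_comp_leftTriangulator_inv_app_fst :
    sq (unitComp (C.diagCompanion x).unit (C.fstCompanion (x, x)).unit) ≫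
      gsq (C.leftTriangulator.inv.as.app x).1 = sq (vid (idPro x.obj)) :=
  (congrArg (· ≫ _) (Companion.sq_compUnit _ _ (Q.diag_fst x))).symm.trans
    (((C.diagCompanion x).comp (C.fstCompanion (x, x)) (Q.diag_fst x)).sq_internal.trans
      (sq_hid_id _))

theorem unitComp_comp_leftTriangulator_inv_app_snd :
    sq (unitComp (C.diagCompanion x).unit (C.sndCompanion (x, x)).unit) ≫
      gsq (C.leftTriangulator.inv.as.app x).2 = sq (vid (idPro x.obj)) :=
  (congrArg (· ≫ _) (Companion.sq_compUnit _ _ (Q.diag_snd x))).symm.trans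
    (((C.diagCompanion x).comp (C.sndCompanion (x, x)) (Q.diag_snd x)).sq_internal.trans
      (sq_hid_id _))

end

/-- The lax adjunction between the diagonal and the product. -/
noncomputable def laxAdjunction : LaxAdjunction (diagonal (UnderlyingBicategory D)) T where
  unit := C.unit
  counit := C.counit
  s := C.leftTriangulator
  t := C.rightTriangulator
  -- In each of the following three chains, the 2-cells of the swallowtail composite carry unit
  -- cells to unit cells, so that the composite fixes the unit of a companion.
  swallowtail_unit x := by
    apply (C.diagCompanion x).hom_ext_unit
    refine Eq.trans ?_ (Category.comp_id _).symm
    refine sq_comp_gsq (unitComp_vid _) ?_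
    refine sq_comp_gsq (unitComp_comp_whiskerLeft _
      ((Category.id_comp _).trans (C.sq_rightTriangulator_inv_app (x, x)))) ?_
    refine sq_comp_gsq (unitComp_assoc_inv _ _ _) ?_
    refine sq_comp_gsq (unitComp_comp_whiskerRight _ ((represents_slide _ _ _).unitComp_comp
      (Q.unit_comp_diagCell _))) ?_
    refine sq_comp_gsq (unitComp_assoc _ _ _) ?_
    refine sq_comp_gsq (unitComp_comp_whiskerLeft _ (sq_comp_gsq
      (Q.unitComp_comp_mapComp _ _ _ _) (sq_comp_gsq (Q.unit_comp_map₂ _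
        (C.unitComp_comp_leftTriangulator_inv_app_fst x)
        (C.unitComp_comp_leftTriangulator_inv_app_snd x)) (Q.unit_vid_comp (x, x))))) ?_
    exact (Iso.eq_comp_inv _).mp (unitComp_vid _).symm
  swallowtail_counit p := by
    apply Prod.ext
    · apply (C.fstCompanion p).hom_ext_unit
      refine Eq.trans ?_ (Category.comp_id _).symm
      refine sq_comp_gsq (vid_unitComp _) ?_
      refine sq_comp_gsq (unitComp_comp_whiskerRight _ (sq_comp_gsq (Category.comp_id _)
        (sq_comp_gsq ((Category.id_comp _).trans (C.sq_rightTriangulator_inv_app p))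
          (Category.comp_id _)))) ?_
      refine sq_comp_gsq (unitComp_assoc _ _ _) ?_
      refine sq_comp_gsq (unitComp_comp_whiskerLeft _ ((represents_slide _ _ _).unitComp_comp
        (Q.unit_fst _ _))) ?_
      refine sq_comp_gsq (unitComp_assoc_inv _ _ _) ?_
      refine sq_comp_gsq (unitComp_comp_whiskerRight _
        (C.unitComp_comp_leftTriangulator_inv_app_fst (T.obj p))) ?_
      exact (Iso.eq_comp_inv _).mp (vid_unitComp _).symm
    · apply (C.sndCompanion p).hom_ext_unit
      refine Eq.trans ?_ (Category.comp_id _).symm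
      refine sq_comp_gsq (vid_unitComp _) ?_
      refine sq_comp_gsq (unitComp_comp_whiskerRight _ (sq_comp_gsq (Category.comp_id _)
        (sq_comp_gsq ((Category.id_comp _).trans (C.sq_rightTriangulator_inv_app p))
          (Category.comp_id _)))) ?_
      refine sq_comp_gsq (unitComp_assoc _ _ _) ?_
      refine sq_comp_gsq (unitComp_comp_whiskerLeft _ ((represents_slide _ _ _).unitComp_comp
        (Q.unit_snd _ _))) ?_
      refine sq_comp_gsq (unitComp_assoc_inv _ _ _) ?_
      refine sq_comp_gsq (unitComp_comp_whiskerRight _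
        (C.unitComp_comp_leftTriangulator_inv_app_snd (T.obj p))) ?_
      exact (Iso.eq_comp_inv _).mp (vid_unitComp _).symm

end Companions

end BinaryDoubleProduct

/-! ### The terminal object and the terminal proarrow -/

namespace DoubleCategory.LaxFiniteProducts

variable {D : Type u} [DoubleCategory.{z, w, v} D] (P : LaxFiniteProducts D)

/-- The product of the empty family of objects. -/
def one : UnderlyingBicategory D := ⟨(P.fan (Empty.elim : Empty → D)).pt⟩

/-- The product of the empty family of proarrows. -/
def top : P.one ⟶ P.one :=
  (P.parallel (x := (Empty.elim : Empty → D)) (y := (Empty.elim : Empty → D))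
    (fun i => i.elim)).pro

variable {P}

theorem subsingleton_top (m : P.one ⟶ P.one) : Subsingleton (m ⟶ P.top) :=
  ⟨fun _ _ => P.hom_ext fun i => i.elim⟩

theorem IsIsoStrong.exists_topId_iso (hP : P.IsIsoStrong) : Nonempty (P.top ≅ 𝟙 P.one) := by
  have := P.subsingleton_top
  obtain ⟨κ, -⟩ := P.exists_lift (l := fun i : Empty => i) (r := fun i => i)
    (x := (Empty.elim : Empty → D)) (y := (Empty.elim : Empty → D)) (p := idPro P.one.obj)
    (m := fun i => i.elim) (𝟙 _) (𝟙 _) (f' := fun i => i.elim) (g' := fun i => i.elim)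
    (fun i => i.elim) (fun i => i.elim) (fun i => i.elim)
  obtain ⟨κ', -⟩ := hP.exists_lift_idPro (x := (Empty.elim : Empty → D)) (p := P.top)
    (𝟙 _) (𝟙 _) (f' := fun i => i.elim) (g' := fun i => i.elim)
    (fun i => i.elim) (fun i => i.elim) (fun i => i.elim)
  exact ⟨⟨κ', κ, Subsingleton.elim _ _, hP.hom_ext_idPro fun i => i.elim⟩⟩

/-- The comparison of the terminal proarrow with the external identity. -/
noncomputable def IsIsoStrong.topId (hP : P.IsIsoStrong) : P.top ≅ 𝟙 P.one :=
  hP.exists_topId_iso.some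

/-- The pseudofunctor that picks the terminal object and the terminal proarrow. -/
noncomputable def IsIsoStrong.terminal (hP : P.IsIsoStrong) :
    TerminalBicategory ⥤ᵖ UnderlyingBicategory D where
  obj _ := P.one
  map _ := P.top
  map₂ _ := 𝟙 _
  mapId _ := hP.topId
  mapComp _ _ := (ρ_ P.top).symm ≪≫ whiskerLeftIso P.top hP.topId.symm
  map₂_whisker_left _ _ _ _ := (P.subsingleton_top _).elim _ _
  map₂_whisker_right _ _ := (P.subsingleton_top _).elim _ _
  map₂_associator _ _ _ := (P.subsingleton_top _).elim _ _
  map₂_left_unitor _ := (P.subsingleton_top _).elim _ _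
  map₂_right_unitor _ := (P.subsingleton_top _).elim _ _

theorem exists_cell_top {s t : D} (n : Pro s t) (f : s ⟶ P.one.obj) (g : t ⟶ P.one.obj) :
    Nonempty (Cell f g n P.top) := by
  obtain ⟨κ, -⟩ := P.exists_lift (l := fun i : Empty => i) (r := fun i => i)
    (x := (Empty.elim : Empty → D)) (y := (Empty.elim : Empty → D)) (p := n)
    (m := fun i => i.elim) f g (f' := fun i => i.elim) (g' := fun i => i.elim)
    (fun i => i.elim) (fun i => i.elim) (fun i => i.elim)
  exact ⟨κ⟩

/-- Empty products of objects and of proarrows make up a right adjoint of the double functor to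
the terminal double category. -/
noncomputable def IsIsoStrong.nullaryDoubleProduct (hP : P.IsIsoStrong) :
    NullaryDoubleProduct hP.terminal where
  isTerminal _ := IsTerminal.ofUniqueHom
    (fun x => (P.isLimit (Empty.elim : Empty → D)).lift (Fan.mk x fun i => i.elim))
    (fun _ _ => P.arrow_ext fun i => i.elim)
  uniqueCell _ _ _ n f g :=
    { default := (P.exists_cell_top n f g).some
      uniq := fun _ => P.hom_ext fun i => i.elim }

end DoubleCategory.LaxFiniteProducts

namespace NullaryDoubleProduct

variable {D : Type u} [DoubleCategory.{z, w, v} D]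
  {U : TerminalBicategory ⥤ᵖ UnderlyingBicategory D}

/-- The object of the terminal bicategory. -/
abbrev pt : TerminalBicategory := ⟨⟨PUnit.unit⟩⟩

theorem subsingleton_of_iso {x y : UnderlyingBicategory D} {k m n : x ⟶ y} (e : m ≅ n)
    (h : Subsingleton (k ⟶ m)) : Subsingleton (k ⟶ n) :=
  ⟨fun _ _ => (cancel_mono e.inv).mp (h.elim _ _)⟩

/-- The external identity of the terminal object is isomorphic to the terminal proarrow, so that
cells into it are unique. -/
theorem idPro_hom_ext (R : NullaryDoubleProduct U) {a : TerminalBicategory} {s t : D} {n : Pro s t}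
    {f : s ⟶ (U.obj a).obj} {g : t ⟶ (U.obj a).obj} (α β : Cell f g n (idPro (U.obj a).obj)) :
    α = β := by
  have h := (@Unique.instSubsingleton _ (R.uniqueCell (𝟙 a) n f g)).elim
    (vcomp α (U.mapId a).inv (Category.comp_id _) (Category.comp_id _))
    (vcomp β (U.mapId a).inv (Category.comp_id _) (Category.comp_id _))
  have e : ∀ γ : Cell f g n (idPro (U.obj a).obj), sq γ =
      sq (vcomp γ (U.mapId a).inv (Category.comp_id _) (Category.comp_id _)) ≫
        gsq (U.mapId a).hom := fun γ => by
    rw [sq_vcomp, Category.assoc]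
    exact ((congrArg (_ ≫ ·) (gsq_inv_hom (U.mapId a))).trans
      (Category.comp_id _)).symm
  exact sq_injective (by rw [e α, e β, h])

/-- 2-cells into a companion of an arrow to the terminal object are unique. -/
theorem subsingleton_companion (R : NullaryDoubleProduct U) {a : TerminalBicategory}
    {x : UnderlyingBicategory D} {f : x.obj ⟶ (U.obj a).obj} {m : x ⟶ U.obj a}
    (c : Companion f m) (k : x ⟶ U.obj a) : Subsingleton (k ⟶ m) :=
  ⟨fun α β => c.hom_ext_counit (by
    rw [← sq_vcomp α c.counit rfl rfl, ← sq_vcomp β c.counit rfl rfl, R.idPro_hom_ext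
      (vcomp α c.counit rfl rfl) (vcomp β c.counit rfl rfl)])⟩

variable (R : NullaryDoubleProduct U) {m : ∀ x : UnderlyingBicategory D, x ⟶ U.obj pt}
  (c : ∀ x, Companion ((R.isTerminal pt).from x.obj) (m x))

/-- The oplax transformation whose components are companions of the arrows to the terminal
object. -/
noncomputable def unit : Oplax.OplaxTrans (Pseudofunctor.id (UnderlyingBicategory D)).toOplax
    ((toTerminal (UnderlyingBicategory D)).comp U).toOplax where
  app := m
  naturality n := slide (c _) (c _) (R.uniqueCell (𝟙 pt) n _ _).default
  -- The targets `ε ⊙ I m`, `ε ⊙ 1` and `ε ⊙ (I m ⊙ I n)` are all isomorphic to `ε`.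
  naturality_naturality _ := (subsingleton_of_iso
    ((ρ_ _).symm ≪≫ whiskerLeftIso (m _) (U.mapId pt).symm)
    (R.subsingleton_companion (c _) _)).elim _ _
  naturality_id x := (subsingleton_of_iso (ρ_ _).symm (R.subsingleton_companion (c x) _)).elim _ _
  naturality_comp {x _ _} _ _ := (subsingleton_of_iso
    ((ρ_ _).symm ≪≫ whiskerLeftIso (m x) (U.mapId pt).symm ≪≫
      whiskerLeftIso (m x) ((ρ_ _).symm ≪≫ whiskerLeftIso (U.map (𝟙 pt)) (U.mapId pt).symm))
    (R.subsingleton_companion (c x) _)).elim _ _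

/-- Any two parallel 1-cells of the terminal bicategory are equal, hence isomorphic. -/
def terminalIso {a b : TerminalBicategory} (f g : a ⟶ b) : f ≅ g :=
  eqToIso (Discrete.ext (Subsingleton.elim f.as g.as))

variable (U) in
/-- The trivial counit of the adjunction with the terminal bicategory. -/
def counit : Oplax.OplaxTrans (U.comp (toTerminal (UnderlyingBicategory D))).toOplax
    (Pseudofunctor.id TerminalBicategory).toOplax where
  app _ := 𝟙 _
  naturality _ := (terminalIso _ _).hom
  naturality_naturality _ := Subsingleton.elim _ _
  naturality_id _ := Subsingleton.elim _ _
  naturality_comp _ _ := Subsingleton.elim _ _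

/-- A companion of an arrow from the terminal object to itself is isomorphic to an identity. -/
noncomputable def isoOfTerminal : 𝟙 (U.obj pt) ≅ m (U.obj pt) :=
  Companion.isoOfId ((R.isTerminal pt).hom_ext ((R.isTerminal pt).from _) (𝟙 _) ▸ c (U.obj pt))

/-- The triangulator `t`, which is uniquely determined. -/
noncomputable def rightTriangulator :
    rightTriangle (R.unit c) (counit U) ≅ 𝟙 U.toOplax :=
  (Oplax.OplaxTrans.isoMk
    (fun _ => R.isoOfTerminal c ≪≫ (ρ_ _).symm ≪≫ whiskerLeftIso (m _) (U.mapId pt).symm)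
    (fun _ => (subsingleton_of_iso
      (e := (R.isoOfTerminal c ≪≫ (ρ_ _).symm ≪≫ whiskerLeftIso (m _) (U.mapId pt).symm) ≪≫
        (ρ_ _).symm ≪≫ whiskerLeftIso _ (U.mapId pt).symm)
      ⟨fun _ _ => R.idPro_hom_ext _ _⟩).elim _ _)).symm

/-- The lax adjunction between the pseudofunctor to the terminal bicategory and the terminal
object. -/
noncomputable def laxAdjunction : LaxAdjunction (toTerminal (UnderlyingBicategory D)) U where
  unit := R.unit c
  counit := counit U
  s := Oplax.OplaxTrans.isoMk (fun _ => terminalIso _ _) (fun _ => Subsingleton.elim _ _)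
  t := R.rightTriangulator c
  swallowtail_unit x := (R.subsingleton_companion (c x) _).elim _ _
  swallowtail_counit _ := Subsingleton.elim _ _

end NullaryDoubleProduct

/-! ### The cartesian structure -/

section

variable {B : Type u₁} [Bicategory.{z₁, w₁} B] {C : Type u₂} [Bicategory.{z₂, w₂} C]

theorem leftZigzag_eq {x y : B} {f : x ⟶ y} {g : y ⟶ x} (η : 𝟙 x ⟶ f ≫ g) (κ : g ≫ f ⟶ 𝟙 y) :
    leftZigzag η κ = η ▷ f ≫ (α_ f g f).hom ≫ f ◁ κ := by
  simp [leftZigzag, bicategoricalComp]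

theorem rightZigzag_eq {x y : B} {f : x ⟶ y} {g : y ⟶ x} (η : 𝟙 x ⟶ f ≫ g) (κ : g ≫ f ⟶ 𝟙 y) :
    rightZigzag η κ = g ◁ η ≫ (α_ g f g).inv ≫ κ ▷ g := by
  simp [rightZigzag, bicategoricalComp]

/-- A pair of adjunctions is an adjunction in the product bicategory. -/
def adjunctionProd {p q : B × C} {f : p ⟶ q} {g : q ⟶ p} (h₁ : f.1 ⊣ g.1) (h₂ : f.2 ⊣ g.2) :
    f ⊣ g where
  unit := (h₁.unit, h₂.unit)
  counit := (h₁.counit, h₂.counit)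
  left_triangle := (leftZigzag_eq _ _).trans (Prod.ext
    ((leftZigzag_eq _ _).symm.trans h₁.left_triangle)
    ((leftZigzag_eq _ _).symm.trans h₂.left_triangle))
  right_triangle := (rightZigzag_eq _ _).trans (Prod.ext
    ((rightZigzag_eq _ _).symm.trans h₁.right_triangle)
    ((rightZigzag_eq _ _).symm.trans h₂.right_triangle))

theorem isLeftAdjoint_of_components {p q : B × C} {f : p ⟶ q}
    (h₁ : Bicategory.IsLeftAdjoint f.1) (h₂ : Bicategory.IsLeftAdjoint f.2) :
    Bicategory.IsLeftAdjoint f := by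
  obtain ⟨⟨g₁, adj₁⟩⟩ := h₁
  obtain ⟨⟨g₂, adj₂⟩⟩ := h₂
  exact IsLeftAdjoint.mk (adjunctionProd (g := (g₁, g₂)) adj₁ adj₂)

end

namespace DoubleCategory.LaxFiniteProducts

variable {D : Type u} [DoubleCategory.{z, w, v} D] {P : LaxFiniteProducts D}

theorem IsIsoStrong.transposable_fst (hP : P.IsIsoStrong) (hU : P.UnaryTransposable)
    (p : UnderlyingBicategory D × UnderlyingBicategory D) :
    Transposable (x := hP.tensor.obj p) (y := p.1) (hP.binaryDoubleProduct.fst p) :=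
  hP.transposable_proj hU (pairObj p) true

theorem IsIsoStrong.transposable_snd (hP : P.IsIsoStrong) (hU : P.UnaryTransposable)
    (p : UnderlyingBicategory D × UnderlyingBicategory D) :
    Transposable (x := hP.tensor.obj p) (y := p.2) (hP.binaryDoubleProduct.snd p) :=
  hP.transposable_proj hU (pairObj p) false

theorem IsIsoStrong.transposable_diag_pair (hP : P.IsIsoStrong) (hU : P.UnaryTransposable)
    (x : UnderlyingBicategory D) :
    Transposable (y := hP.tensor.obj (x, x)) (hP.binaryDoubleProduct.diag x) :=
  hP.transposable_diag hU (x := x.obj) (pairObj (x, x))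
    (fun
      | true => rfl
      | false => rfl) (hP.binaryDoubleProduct.diag x)
    (fun
      | true => hP.binaryDoubleProduct.diag_fst x
      | false => hP.binaryDoubleProduct.diag_snd x)

theorem IsIsoStrong.transposable_aug (hP : P.IsIsoStrong) (hU : P.UnaryTransposable)
    (x : UnderlyingBicategory D) : Transposable (y := hP.terminal.obj NullaryDoubleProduct.pt)
      ((hP.nullaryDoubleProduct.isTerminal NullaryDoubleProduct.pt).from x.obj) :=
  hP.transposable_diag hU (x := x.obj) (Empty.elim : Empty → D) (fun i => i.elim) _
    (fun i => i.elim)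

end DoubleCategory.LaxFiniteProducts

theorem mainTheorem1 {D : Type u} [DoubleCategory.{z, w, v} D] (P : LaxFiniteProducts D)
    (hP : P.IsIsoStrong) (hU : P.UnaryTransposable) :
    ∃ S : CartesianStructure (UnderlyingBicategory D), Nonempty (TransposedFromProducts S) := by
  choose δ cδ hδ using hP.transposable_diag_pair hU
  choose π₁ c₁ h₁ using hP.transposable_fst hU
  choose π₂ c₂ h₂ using hP.transposable_snd hU
  choose aug cAug hAug using hP.transposable_aug hU
  let C : hP.binaryDoubleProduct.Companions :=
    { diag := δ
      diagCompanion := fun x => (cδ x).some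
      fst := π₁
      fstCompanion := fun p => (c₁ p).some
      snd := π₂
      sndCompanion := fun p => (c₂ p).some }
  let S : CartesianStructure (UnderlyingBicategory D) :=
    { tensor := hP.tensor
      unit := hP.terminal
      adjTensor := C.laxAdjunction
      adjUnit := hP.nullaryDoubleProduct.laxAdjunction fun x => (cAug x).some
      isMap_diag := hδ
      isMap_proj := fun p => isLeftAdjoint_of_components (h₁ p) (h₂ p)
      isMap_aug := hAug }
  exact ⟨S, ⟨{
    prod := hP.binaryDoubleProduct
    term := hP.nullaryDoubleProduct
    diag := hP.binaryDoubleProduct.diag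
    diag_fst := hP.binaryDoubleProduct.diag_fst
    diag_snd := hP.binaryDoubleProduct.diag_snd
    diagCell := hP.binaryDoubleProduct.diagCell
    diagCell_fst := fun m => sq_injective
      ((sq_vcomp _ _ _ _).trans (hP.binaryDoubleProduct.diagCell_fst m))
    diagCell_snd := fun m => sq_injective
      ((sq_vcomp _ _ _ _).trans (hP.binaryDoubleProduct.diagCell_snd m))
    diagCompanion := C.diagCompanion
    diag_naturality := fun _ => rfl
    fstCompanion := C.fstCompanion
    sndCompanion := C.sndCompanion
    fst_naturality := fun _ => rfl
    snd_naturality := fun _ => rfl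
    augCompanion := fun x => (cAug x).some
    aug_naturality := fun _ => rfl
    s_fst := fun _ => rfl
    s_snd := fun _ => rfl }⟩⟩
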